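/- Let $\eta>0$, so that $\Delta=-\cosh\eta<-1$. Let $p$ and $\Theta$ be the odd, analytically continued branches determined by $$e^{ip(z)}=\frac{\sinh(\frac\eta2+iz)}{\sinh(\frac\eta2-iz)},\qquad e^{i\Theta(z)}=-\frac{\sinh(iz+\eta)}{\sinh(iz-\eta)} .$$ Let $U\subset(0,1)\times\mathbb R$ be open, and for $(q,H)\in U$ let $\alpha=\alpha_{q,H}:[-\frac q2,\frac q2]\to\mathbb C$ be a curve of Bethe roots in the thermodynamic limit: a curve symmetric under $z\mapsto-\bar z$, $\alpha(-t)=-\overline{\alpha(t)}$, which solves $$2\pi t=p(\alpha(t))+2iH-\int_{-q/2}^{q/2}\Theta(\alpha(t)-\alpha(s))\,ds ,\qquad |t|\le \tfrac q2,$$ where $p(\alpha(t))$ and $\Theta(\alpha(t)-\alpha(s))$ are continued along the curve, with $\operatorname{Re}p(\alpha(0))=0$ and $\Theta(0)=0$. Assume that $\alpha_{q,H}(t)$ is of class $C^2$ in $(q,H,t)$, up to the endpoints $|t|=\frac q2$ (that is, near every $(q,H,t)$ with $(q,H)\in U$, $|t|\le\frac q2$). Let $C$ be the image of $\alpha$ and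 $\rho=dt/dz$ the density of roots on $C$. For $0<u<\eta$ put $$\mathcal H^{\pm}_u(q,H)=\pm H+l_\pm(u)+\int_C\psi_\pm(z+iu)\,\rho(z)\,dz=\pm H+l_\pm(u)+\int_{-q/2}^{q/2}\log\bigl|e^{\psi_\pm(\alpha(t)+iu)}\bigr|\,dt,$$ where $l_+(u)=\ln\sinh(\eta-u)$, $l_-(u)=\ln\sinh u$ and $$e^{\psi_+(z)}=\frac{\sinh(\frac\eta2-iz)}{\sinh(\frac\eta2+iz)},\qquad e^{\psi_-(z)}=\frac{\sinh(\frac{3\eta}2+iz)}{\sinh(-\frac\eta2-iz)} ,$$ and let the semigrand canonical free energy be $\mathcal H_u(q,H)=\max_\pm\mathcal H_u^\pm(q,H)$. Call $u$ regular for a sign if numerator and denominator of $e^{\psi_\pm(z+iu)}$ (for that sign) have no zero $z$ on $C$. Call $u\in(0,\eta)$ generic at $(q,H)$ if it is regular for both signs and $\mathcal H^+_u(q,H)\ne\mathcal H^-_u(q,H)$. For functions $\mathcal H,\widetilde{\mathcal H}$ of three variables (density $q$, field $H$, spectral parameter), with subscripts denoting partial derivatives with respect to the first, second and third argument, consider the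 identities $$\begin{aligned} &\mathcal H_{11}\widetilde{\mathcal H}_{22}-\widetilde{\mathcal H}_{11}\mathcal H_{22}=0,\\ &\mathcal H_{11}\widetilde{\mathcal H}_{23}+\mathcal H_{12}\widetilde{\mathcal H}_{13}-\mathcal H_{13}\widetilde{\mathcal H}_{12}-\mathcal H_{23}\widetilde{\mathcal H}_{11}=0,\\ &\mathcal H_{12}\widetilde{\mathcal H}_{23}+\mathcal H_{22}\widetilde{\mathcal H}_{13}-\mathcal H_{13}\widetilde{\mathcal H}_{22}-\mathcal H_{23}\widetilde{\mathcal H}_{12}=0, \end{aligned}\qquad(*)$$ where $\mathcal H$ is evaluated at $(q,H,u-v(x))$ and $\widetilde{\mathcal H}$ at $(q,H,w-v(x))$. **Theorem 4.2.** Let $(q,H)\in U$, let $v$ be a real function (the inhomogeneity), and let $x,u,w$ be such that $u-v(x),\,w-v(x)\in(0,\eta)$. 1. For any two signs $\sigma,\tau\in\{+,-\}$, if $u-v(x)$ is regular for $\sigma$ and $w-v(x)$ is regular for $\tau$, then $\mathcal H^\sigma$ and $\mathcal H^\tau$ are $C^2$ near $(q,H,u-v(x))$ and $(q,H,w-v(x))$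 respectively, and $(*)$ holds for $\mathcal H^\sigma$ and $\widetilde{\mathcal H}=\mathcal H^\tau$. 2. The free energy $\mathcal H_s(q,H)$ is $C^2$ near $(q,H,s)$ for every $s$ that is generic at $(q,H)$. 3. The free energy satisfies $(*)$, with $\mathcal H$ and $\widetilde{\mathcal H}$ both equal to the free energy, whenever it is $C^2$ near $(q,H,u-v(x))$ and near $(q,H,w-v(x))$ and both $u-v(x)$ and $w-v(x)$ are generic or limits of generic parameters at $(q,H)$. -/

import Mathlib

open Set Topology

noncomputable section

namespace SixVertex

/-- `e^{i p(z)}`, where `p` is the momentum function. -/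
def expMomentum (η : ℝ) (z : ℂ) : ℂ :=
  Complex.sinh ((η : ℂ) / 2 + Complex.I * z) / Complex.sinh ((η : ℂ) / 2 - Complex.I * z)

/-- `e^{i Θ(z)}`, where `Θ` is the two-body phase. -/
def expPhase (η : ℝ) (z : ℂ) : ℂ :=
  -(Complex.sinh (Complex.I * z + (η : ℂ)) / Complex.sinh (Complex.I * z - (η : ℂ)))

/-- `P` is the branch of `t ↦ p (α t)` along the curve `α` on `[-q/2, q/2]`: a continuous
logarithm of `e^{i p}`, normalised so that it is purely imaginary at the midpoint. For a curve that
is symmetric under `z ↦ -conj z` this is the continuation of the odd branch `p 0 = 0`.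
(As `exp` does not vanish, the equation forces numerator and denominator of `e^{i p}` to be
non-zero along the curve.) -/
structure IsMomentumAlong (η q : ℝ) (α : ℝ → ℂ) (P : ℝ → ℂ) : Prop where
  continuousOn : ContinuousOn P (Icc (-q / 2) (q / 2))
  exp_eq : ∀ t ∈ Icc (-q / 2) (q / 2), Complex.exp (Complex.I * P t) = expMomentum η (α t)
  re_zero : (P 0).re = 0

/-- `Φ` is the branch of `(t, s) ↦ Θ (α t - α s)` along the curve `α` on `[-q/2, q/2]`: the
continuous logarithm of `e^{i Θ}` that vanishes on the diagonal (the odd branch `Θ 0 = 0`). -/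
structure IsPhaseAlong (η q : ℝ) (α : ℝ → ℂ) (Φ : ℝ → ℝ → ℂ) : Prop where
  continuousOn : ContinuousOn (fun x : ℝ × ℝ => Φ x.1 x.2)
    (Icc (-q / 2) (q / 2) ×ˢ Icc (-q / 2) (q / 2))
  exp_eq : ∀ t ∈ Icc (-q / 2) (q / 2), ∀ s ∈ Icc (-q / 2) (q / 2),
    Complex.exp (Complex.I * Φ t s) = expPhase η (α t - α s)
  diag : ∀ t ∈ Icc (-q / 2) (q / 2), Φ t t = 0

/-- `α : [-q/2, q/2] → ℂ` is a curve of Bethe roots in the thermodynamic limit, at density `q` and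
horizontal field `H`: it is symmetric with respect to the imaginary axis and solves
`2 π t = p (α t) + 2 i H - ∫_{-q/2}^{q/2} Θ (α t - α s) ds`.
The contour `C` is the image of `α`; it runs from `A = α (-q/2)` to `B = α (q/2)`. -/
structure IsRootCurve (η q H : ℝ) (α : ℝ → ℂ) : Prop where
  continuousOn : ContinuousOn α (Icc (-q / 2) (q / 2))
  symm : ∀ t ∈ Icc (-q / 2) (q / 2), α (-t) = -(starRingEnd ℂ) (α t)
  bethe : ∃ (P : ℝ → ℂ) (Φ : ℝ → ℝ → ℂ), IsMomentumAlong η q α P ∧ IsPhaseAlong η q α Φ ∧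
    ∀ t ∈ Icc (-q / 2) (q / 2),
      2 * (Real.pi : ℂ) * (t : ℂ) =
        P t + 2 * Complex.I * (H : ℂ) - ∫ s in (-q / 2)..(q / 2), Φ t s

/-- A twice continuously differentiable family of Bethe root curves `t ↦ α q H t`, where `(q, H)`
runs through `U`. -/
structure IsRootFamily (η : ℝ) (U : Set (ℝ × ℝ)) (α : ℝ → ℝ → ℝ → ℂ) : Prop where
  isOpen : IsOpen U
  density_mem : ∀ q H : ℝ, (q, H) ∈ U → 0 < q ∧ q < 1
  rootCurve : ∀ q H : ℝ, (q, H) ∈ U → IsRootCurve η q H (α q H)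
  contDiffAt : ∀ q H : ℝ, (q, H) ∈ U → ∀ t ∈ Icc (-q / 2) (q / 2),
    ContDiffAt ℝ 2 (fun x : ℝ × ℝ × ℝ => α x.1 x.2.1 x.2.2) (q, H, t)

/-- The sign that distinguishes the two terms of a transfer-matrix eigenvalue. -/
inductive Branch where
  | plus
  | minus

/-- The numerator of `e^{ψ_± z}`. -/
def psiNum (η : ℝ) : Branch → ℂ → ℂ
  | .plus, z => Complex.sinh ((η : ℂ) / 2 - Complex.I * z)
  | .minus, z => Complex.sinh (3 * (η : ℂ) / 2 + Complex.I * z)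

/-- The denominator of `e^{ψ_± z}`. -/
def psiDen (η : ℝ) : Branch → ℂ → ℂ
  | .plus, z => Complex.sinh ((η : ℂ) / 2 + Complex.I * z)
  | .minus, z => Complex.sinh (-(η : ℂ) / 2 - Complex.I * z)

/-- `Re ψ_± z = log |e^{ψ_± z}|`, which does not depend on the branch of the logarithm `ψ_±`. -/
def rePsi (η : ℝ) (b : Branch) (z : ℂ) : ℝ :=
  Real.log ‖psiNum η b z / psiDen η b z‖

/-- `l_+ = log sinh (η - u)` and `l_- = log sinh u`. -/
def lTerm (η : ℝ) : Branch → ℝ → ℝ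
  | .plus, u => Real.log (Real.sinh (η - u))
  | .minus, u => Real.log (Real.sinh u)

/-- `± H`. -/
def fieldTerm : Branch → ℝ → ℝ
  | .plus, H => H
  | .minus, H => -H

/-- `𝓗^±_u (q, H) = ± H + l_± + ∫_C ψ_± (z + i u) ρ(z) dz` as a function of `x = (q, H, u)`.
Since `ρ = dt/dz` along `C`, the contour integral is the integral over `t ∈ [-q/2, q/2]` of
`ψ_± (α t + i u)`. The symmetry of `C` and `ψ_± (-conj z + i u) = conj (ψ_± (z + i u))` make it
real, so that it is the integral of `Re ψ_±`. -/
def branchEnergy (η : ℝ) (α : ℝ → ℝ → ℝ → ℂ) (b : Branch) (x : Fin 3 → ℝ) : ℝ :=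
  fieldTerm b (x 1) + lTerm η b (x 2) +
    ∫ t in (-(x 0) / 2)..(x 0 / 2), rePsi η b (α (x 0) (x 1) t + Complex.I * (x 2 : ℂ))

/-- The semigrand canonical free energy `𝓗_u (q, H) = max_± 𝓗^±_u (q, H)`, as a function of
`x = (q, H, u)`. -/
def freeEnergy (η : ℝ) (α : ℝ → ℝ → ℝ → ℂ) (x : Fin 3 → ℝ) : ℝ :=
  max (branchEnergy η α .plus x) (branchEnergy η α .minus x)

/-- `ψ_± (· + i u)` has no singularity on the contour. -/
def PsiRegular (η : ℝ) (α : ℝ → ℝ → ℝ → ℂ) (b : Branch) (q H u : ℝ) : Prop :=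
  ∀ t ∈ Icc (-q / 2) (q / 2),
    psiNum η b (α q H t + Complex.I * (u : ℂ)) ≠ 0 ∧
    psiDen η b (α q H t + Complex.I * (u : ℂ)) ≠ 0

/-- The spectral parameters `u` in `(0, η)` for which the free energy at `(q, H)` is given by
exactly one of the two terms, both of them being given by regular integrands. -/
def genericParameters (η : ℝ) (α : ℝ → ℝ → ℝ → ℂ) (q H : ℝ) : Set ℝ :=
  {u | u ∈ Ioo 0 η ∧ PsiRegular η α .plus q H u ∧ PsiRegular η α .minus q H u ∧
    branchEnergy η α .plus ![q, H, u] ≠ branchEnergy η α .minus ![q, H, u]}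

/-- The second partial derivative `∂_i ∂_j f` at `x`, arguments being numbered `0, 1, 2`. -/
def partial₂ (i j : Fin 3) (f : (Fin 3 → ℝ) → ℝ) (x : Fin 3 → ℝ) : ℝ :=
  fderiv ℝ (fun y => fderiv ℝ f y (Pi.single j 1)) x (Pi.single i 1)

/-- The three bilinear identities between the second derivatives of `f` at `x` and of `g` at `y`.
-/
structure BilinearIdentities (f g : (Fin 3 → ℝ) → ℝ) (x y : Fin 3 → ℝ) : Prop where
  first : partial₂ 0 0 f x * partial₂ 1 1 g y - partial₂ 0 0 g y * partial₂ 1 1 f x = 0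
  second : partial₂ 0 0 f x * partial₂ 1 2 g y + partial₂ 0 1 f x * partial₂ 0 2 g y
    - partial₂ 0 2 f x * partial₂ 0 1 g y - partial₂ 1 2 f x * partial₂ 0 0 g y = 0
  third : partial₂ 0 1 f x * partial₂ 1 2 g y + partial₂ 1 1 f x * partial₂ 0 2 g y
    - partial₂ 0 2 f x * partial₂ 1 1 g y - partial₂ 1 2 f x * partial₂ 0 1 g y = 0

end SixVertex

end

/-!
The three identities say that, at fixed `(q, H)`, the Hessian of a branch energy in `(q, H)` is a
linear function of its mixed derivatives `Q = ∂_q ∂_u` and `P = ∂_H ∂_u`, with coefficients that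
depend neither on the spectral parameter nor on the branch:
`∂_q ∂_q = m₁ P + m₂ Q`, `∂_H ∂_H = -κ² (m₁ P + m₂ Q)`, `∂_q ∂_H = m₂ P - κ² m₁ Q`
(`exists_partial₂_relations`). Substituting these makes each identity a polynomial identity.

After rescaling the parameter interval to `[-1/2, 1/2]` the roots are `b (x, y) = α q H (q y)` with
`x = (q, H)`, and `RootSystem` records what the argument uses of the Bethe equation. The shift
function `F_e = q ∂_e b / ∂_y b` measures how the contour moves in a direction `e` of the
`(q, H)`-plane. The variation of `q ∫ χ(b) dy` in the direction `e` is the endpoint contribution of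
`χ F_e` plus the integral of `χ` against a density on the contour (`firstVar_eq`). The second
variation has the same form with endpoint values `χ F_e ∂_e b` (`secondVar_eq`). Differentiating the
Bethe equation shows that all these densities solve one linear integral equation, whose source
consists of the endpoint contributions alone (`firstDensity_eq`, `secondDensity_eq`). The
second variation and the two first variations have two endpoint values each, so a fixed
determinant combination of them (`defect`) has no endpoint contribution, and its density `n` solves
the homogeneous equation `2 π n(z) + ∫ K(z - w) n(w) dw = 0`.

The homogeneous equation is not assumed to be uniquely solvable. A solution `n` that is continuous
in `x` extends analytically to `N_x(z)`; as `K` is even, the contours at `x₁` and at `x₂` give the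
same integral of `N_x₁ N_x₂` (`potential_symm`). Letting `x₂` tend to `x₁` gives `n² ∂_e b` the same
value at both endpoints (`null_endpoint_eq`). The shifts at the endpoints satisfy
`π (F_e(1/2)² - F_e(-1/2)²) = -2 i e_q e_H` (`shift_sq_sub`), and with the reflection symmetry this
makes the endpoint shifts in the two coordinate directions independent, so `n` vanishes at both
ends. Then the derivative of `N_x` along the contour is again a solution, by integration by parts;
hence all derivatives of `N_x` vanish at an endpoint and `n = 0` (`null_eq_zero`). Therefore the
second variation is a combination of the two first variations with coefficients independent of `χ`
(`re_secondVar`), and `shift_sq_sub` fixes the shape of these coefficients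
(`exists_hessian_relations`). Taking for `χ` the logarithmic derivative of `e^{ψ_±}(· + i u)` turns
the first variations into `P` and `Q`.

The free energy is locally one of the branch energies at a generic parameter, and the identities
pass to limits of generic parameters by continuity of the second derivatives.
-/

open Set Topology

noncomputable section

namespace SixVertex

open MeasureTheory Filter

local notation "𝕀" => Icc (-(1 / 2) : ℝ) (1 / 2)

/-! ### Integrals depending on a parameter -/

section ParametricIntegrals

variable {F : Type*} [NormedAddCommGroup F] [NormedSpace ℝ F] {a b : ℝ}

theorem continuousOn_paramIntegral {X : Type*} [TopologicalSpace X]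
    [FirstCountableTopology X] {f : X × ℝ → F} {V : Set X}
    (hab : a ≤ b) (hf : ContinuousOn f (V ×ˢ Icc a b)) :
    ContinuousOn (fun x => ∫ y in a..b, f (x, y)) V := by
  intro x hx
  have hsl : ∀ x' ∈ V, ContinuousOn (fun y => f (x', y)) (Icc a b) := fun x' hx' =>
    hf.comp (by fun_prop) fun y hy => ⟨hx', hy⟩
  refine TendstoUniformlyOn.tendsto_intervalIntegral_of_continuousOn (μ := volume) ?_ ?_
  · rw [uIcc_of_le hab]
    filter_upwards [self_mem_nhdsWithin] with x' hx' using hsl x' hx'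
  · rw [uIcc_of_le hab]
    intro u hu
    obtain ⟨v, hv, h⟩ := isCompact_Icc.mem_uniformity_of_prod (f := fun x y => f (x, y)) hf hx
      (symm_le_uniformity hu)
    filter_upwards [hv] with x' hx' y hy using h x' hx' y hy

theorem hasFDerivAt_paramIntegral {𝕜 H : Type*} [RCLike 𝕜] [NormedSpace 𝕜 F]
    [NormedAddCommGroup H] [NormedSpace 𝕜 H] {V : Set H} (hV : IsOpen V) (hab : a ≤ b)
    {f : H → ℝ → F} {f' : H → ℝ → H →L[𝕜] F}
    (hf : ∀ x ∈ V, ContinuousOn (f x) (Icc a b))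
    (hf' : ContinuousOn (fun p : H × ℝ => f' p.1 p.2) (V ×ˢ Icc a b))
    (hd : ∀ x ∈ V, ∀ y ∈ Icc a b, HasFDerivAt (fun x => f x y) (f' x y) x)
    {x : H} (hx : x ∈ V) :
    HasFDerivAt (fun x => ∫ y in a..b, f x y) (∫ y in a..b, f' x y) x := by
  have hsl : ∀ x' ∈ V, ContinuousOn (fun y => f' x' y) (Icc a b) := fun x' hx' =>
    hf'.comp (f := fun y => (x', y)) (by fun_prop) fun y hy => ⟨hx', hy⟩
  have hI : uIoc a b ⊆ Icc a b := by rw [uIoc_of_le hab]; exact Ioc_subset_Icc_self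
  obtain ⟨v, hv, h⟩ := isCompact_Icc.mem_uniformity_of_prod (f := f') hf' hx
      (Metric.dist_mem_uniformity one_pos)
  rw [hV.nhdsWithin_eq hx] at hv
  refine intervalIntegral.hasFDerivAt_integral_of_dominated_of_fderiv_le
    (s := v ∩ V) (F' := f') (bound := fun y => ‖f' x y‖ + 1) (inter_mem hv (hV.mem_nhds hx))
    ?_ ?_ ?_ ?_ ?_ ?_
  · filter_upwards [hV.mem_nhds hx] with x' hx'
    exact ((hf x' hx').mono hI).aestronglyMeasurable measurableSet_uIoc
  · exact ContinuousOn.intervalIntegrable (by rw [uIcc_of_le hab]; exact hf x hx)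
  · exact ((hsl x hx).mono hI).aestronglyMeasurable measurableSet_uIoc
  · refine ae_of_all _ fun y hy x' hx' => ?_
    have := h x' hx'.1 y (hI hy)
    simp only [mem_ofPred_eq, dist_eq_norm] at this
    have h2 := norm_sub_norm_le (f' x' y) (f' x y)
    linarith
  · refine ContinuousOn.intervalIntegrable ?_
    rw [uIcc_of_le hab]
    exact (hsl x hx).norm.add continuousOn_const
  · exact ae_of_all _ fun y hy x' hx' => hd x' hx'.2 y (hI hy)

theorem hasDerivAt_paramIntegral {V : Set ℂ} (hV : IsOpen V) (hab : a ≤ b) {f f' : ℂ → ℝ → ℂ}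
    (hf : ∀ x ∈ V, ContinuousOn (f x) (Icc a b))
    (hf' : ContinuousOn (fun p : ℂ × ℝ => f' p.1 p.2) (V ×ˢ Icc a b))
    (hd : ∀ x ∈ V, ∀ y ∈ Icc a b, HasDerivAt (fun x => f x y) (f' x y) x)
    {x : ℂ} (hx : x ∈ V) :
    HasDerivAt (fun x => ∫ y in a..b, f x y) (∫ y in a..b, f' x y) x := by
  let L : ℂ →L[ℂ] ℂ →L[ℂ] ℂ := (ContinuousLinearMap.mul ℂ ℂ)
  have key := hasFDerivAt_paramIntegral (𝕜 := ℂ) (f' := fun x y => L (f' x y)) hV hab hf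
    (L.continuous.comp_continuousOn hf')
    (fun x hx y hy => by
      refine (hd x hx y hy).hasFDerivAt.congr_fderiv ?_
      ext; simp [L]) hx
  have h := L.intervalIntegral_comp_comm (μ := volume) (a := a) (b := b) (f := f' x) (by
    refine ContinuousOn.intervalIntegrable ?_
    rw [uIcc_of_le hab]
    exact hf'.comp (f := fun y => (x, y)) (by fun_prop) fun y hy => ⟨hx, hy⟩)
  rw [hasDerivAt_iff_hasFDerivAt]
  rw [h] at key
  refine key.congr_fderiv ?_
  ext; simp [L]

variable {E : Type*} [NormedAddCommGroup E] [NormedSpace ℝ E]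

theorem eventually_contDiffAt {n : ℕ} {f : E × ℝ → F} {x : E}
    (hf : ∀ y ∈ Icc a b, ContDiffAt ℝ n f (x, y)) :
    ∀ᶠ x' in 𝓝 x, ∀ y ∈ Icc a b, ContDiffAt ℝ n f (x', y) :=
  isCompact_Icc.eventually_forall_of_forall_eventually
    fun y hy => (hf y hy).eventually (by simp)

theorem hasFDerivAt_paramIntegral_of_contDiffAt {f : E × ℝ → F} (hab : a ≤ b) {x : E}
    (hf : ∀ y ∈ Icc a b, ContDiffAt ℝ 1 f (x, y)) :
    HasFDerivAt (fun x => ∫ y in a..b, f (x, y))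
      (∫ y in a..b, (fderiv ℝ f (x, y)).comp (ContinuousLinearMap.inl ℝ E ℝ)) x := by
  obtain ⟨V, hVf, hV, hxV⟩ := eventually_nhds_iff.1 (eventually_contDiffAt (n := 1) hf)
  refine hasFDerivAt_paramIntegral (f := fun x y => f (x, y))
    (f' := fun x y => (fderiv ℝ f (x, y)).comp (ContinuousLinearMap.inl ℝ E ℝ)) hV hab ?_ ?_ ?_ hxV
  · intro x' hx' y hy
    exact ((hVf x' hx' y hy).continuousAt.comp (f := fun y => (x', y))
      (by fun_prop)).continuousWithinAt
  · rintro ⟨x', y⟩ ⟨hx', hy⟩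
    have h1 := (hVf x' hx' y hy).continuousAt_fderiv (by simp)
    exact (h1.clm_comp continuousAt_const).continuousWithinAt
  · intro x' hx' y hy
    have := ((hVf x' hx' y hy).differentiableAt (by simp)).hasFDerivAt
    exact this.comp x' (hasFDerivAt_prodMk_left x' y)

theorem contDiffAt_paramIntegral.{u} {E F : Type u} [NormedAddCommGroup E] [NormedSpace ℝ E]
    [NormedAddCommGroup F] [NormedSpace ℝ F] {n : ℕ} (hab : a ≤ b) {f : E × ℝ → F} {x : E}
    (hf : ∀ y ∈ Icc a b, ContDiffAt ℝ n f (x, y)) :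
    ContDiffAt ℝ n (fun x => ∫ y in a..b, f (x, y)) x := by
  induction n generalizing F with
  | zero =>
    obtain ⟨V, hVf, hV, hxV⟩ := eventually_nhds_iff.1 (eventually_contDiffAt hf)
    refine contDiffAt_zero.2 ⟨V, hV.mem_nhds hxV, continuousOn_paramIntegral hab ?_⟩
    rintro ⟨x', y⟩ ⟨hx', hy⟩
    exact (hVf x' hx' y hy).continuousAt.continuousWithinAt
  | succ n ih =>
    push_cast at hf ⊢
    have h1 : ∀ᶠ x' in 𝓝 x, ∀ y ∈ Icc a b, ContDiffAt ℝ ((n + 1 : ℕ) : ℕ∞) f (x', y) :=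
      eventually_contDiffAt (n := n + 1) (by exact_mod_cast hf)
    refine contDiffAt_succ_iff_hasFDerivAt.2 ⟨fun x => ∫ y in a..b,
      (fderiv ℝ f (x, y)).comp (ContinuousLinearMap.inl ℝ E ℝ), ⟨_, h1, fun x' hx' => ?_⟩, ?_⟩
    · exact hasFDerivAt_paramIntegral_of_contDiffAt hab fun y hy =>
        (hx' y hy).of_le (by norm_cast; omega)
    · refine ih (f := fun p => (fderiv ℝ f p).comp (ContinuousLinearMap.inl ℝ E ℝ)) fun y hy => ?_
      exact ((hf y hy).fderiv_right le_rfl).clm_comp contDiffAt_const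

theorem fderiv_paramIntegral_apply {f : E × ℝ → F} (hab : a ≤ b) {x : E}
    (hf : ∀ y ∈ Icc a b, ContDiffAt ℝ 1 f (x, y)) (v : E) :
    fderiv ℝ (fun x => ∫ y in a..b, f (x, y)) x v = ∫ y in a..b, fderiv ℝ f (x, y) (v, 0) := by
  rw [(hasFDerivAt_paramIntegral_of_contDiffAt hab hf).fderiv,
    ContinuousLinearMap.intervalIntegral_apply]
  · simp
  · refine ContinuousOn.intervalIntegrable ?_
    rw [uIcc_of_le hab]
    intro y hy
    have h1 := (hf y hy).continuousAt_fderiv (by simp)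
    refine ContinuousAt.continuousWithinAt (ContinuousAt.clm_comp ?_ continuousAt_const)
    exact h1.comp (f := fun y => (x, y)) (by fun_prop)

theorem fderiv_fderiv_paramIntegral {f : E × ℝ → F} (hab : a ≤ b) {x : E}
    (hf : ∀ y ∈ Icc a b, ContDiffAt ℝ 2 f (x, y)) (v w : E) :
    fderiv ℝ (fun x' => fderiv ℝ (fun x => ∫ y in a..b, f (x, y)) x' v) x w =
      ∫ y in a..b, fderiv ℝ (fun p => fderiv ℝ f p (v, 0)) (x, y) (w, 0) := by
  have hev : (fun x' => fderiv ℝ (fun x => ∫ y in a..b, f (x, y)) x' v) =ᶠ[𝓝 x]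
      fun x' => ∫ y in a..b, fderiv ℝ f (x', y) (v, 0) := by
    filter_upwards [eventually_contDiffAt (n := 2) hf] with x' hx'
    exact fderiv_paramIntegral_apply hab (fun y hy => (hx' y hy).of_le (by norm_num)) v
  rw [hev.fderiv_eq]
  exact fderiv_paramIntegral_apply (f := fun p => fderiv ℝ f p (v, 0)) hab (fun y hy =>
    ((hf y hy).fderiv_right (m := 1) (by norm_num)).clm_apply contDiffAt_const) w

end ParametricIntegrals

/-! ### Derivatives on a strip and continuous logarithms -/

section Uniqueness

variable {E F : Type*} [NormedAddCommGroup E] [NormedSpace ℝ E] [NormedAddCommGroup F]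
  [NormedSpace ℝ F]

/-- A continuous logarithm `φ` of a differentiable function is differentiable: near `p` it differs
by a constant from the principal logarithm of `g / g p`. -/
theorem hasFDerivWithinAt_of_exp_eq {φ g : E → ℂ} {g' : E →L[ℝ] ℂ} {s : Set E} {p : E} (hp : p ∈ s)
    (hφ : ContinuousWithinAt φ s p) (h : ∀ x ∈ s, Complex.exp (φ x) = g x)
    (hg : HasFDerivWithinAt g g' s p) : HasFDerivWithinAt φ ((g p)⁻¹ • g') s p := by
  have hgp : g p ≠ 0 := by rw [← h p hp]; exact Complex.exp_ne_zero _
  have h1 : HasFDerivWithinAt (fun x => (g p)⁻¹ * g x) ((g p)⁻¹ • g') s p := by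
    exact hg.const_smul (g p)⁻¹
  have h2 : HasFDerivWithinAt (fun x => φ p + Complex.log ((g p)⁻¹ * g x)) ((g p)⁻¹ • g') s p := by
    have h1' : (g p)⁻¹ * g p = 1 := inv_mul_cancel₀ hgp
    have := ((Complex.hasStrictDerivAt_log (x := (g p)⁻¹ * g p)
      (by simp [h1'])).hasDerivAt.comp_hasFDerivWithinAt p h1).const_add (φ p)
    rw [h1'] at this
    simpa using this
  refine h2.congr_of_eventuallyEq ?_ (by simp [hgp])
  have h3 : Tendsto (fun x => φ x - φ p) (𝓝[s] p) (𝓝 0) := by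
    have := Tendsto.sub_const hφ (φ p)
    rwa [sub_self] at this
  -- for small `φ x - φ p` the principal logarithm inverts `exp`
  have h4 := h3 (Metric.ball_mem_nhds 0 Real.pi_pos)
  filter_upwards [h4, self_mem_nhdsWithin] with x hx hxs
  have h5 : |(φ x - φ p).im| < Real.pi := by
    have : ‖φ x - φ p‖ < Real.pi := by simpa using hx
    exact (Complex.abs_im_le_norm _).trans_lt this
  rw [abs_lt] at h5
  have h6 : (g p)⁻¹ * g x = Complex.exp (φ x - φ p) := by
    rw [Complex.exp_sub, h x hxs, h p hp]; field_simp
  rw [h6, Complex.log_exp h5.1 h5.2.le]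
  ring

/-- A function that vanishes on the strip `U × [a, b]` has zero derivative there, up to the edges
`y = a` and `y = b`, because the strip has unique derivatives. -/
theorem fderiv_apply_eq_zero_of_eqOn {f : E × ℝ → F} {U : Set E} (hU : IsOpen U) {a b : ℝ}
    (hab : a < b) (hf : ∀ x ∈ U, ∀ y ∈ Icc a b, f (x, y) = 0) {x : E} (hx : x ∈ U) {y : ℝ}
    (hy : y ∈ Icc a b) (hd : DifferentiableAt ℝ f (x, y)) (v : E × ℝ) :
    fderiv ℝ f (x, y) v = 0 := by
  have hu : UniqueDiffWithinAt ℝ (U ×ˢ Icc a b) (x, y) :=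
    (hU.uniqueDiffOn.prod (uniqueDiffOn_Icc hab)) _ ⟨hx, hy⟩
  have h0 : HasFDerivWithinAt f (0 : E × ℝ →L[ℝ] F) (U ×ˢ Icc a b) (x, y) :=
    (hasFDerivWithinAt_const (0 : F) _ _).congr (fun p hp => hf p.1 hp.1 p.2 hp.2) (hf x hx y hy)
  rw [hu.eq hd.hasFDerivAt.hasFDerivWithinAt h0]
  rfl

theorem hasDerivAt_slice {f : E × ℝ → F} {x : E} {y : ℝ} (hf : DifferentiableAt ℝ f (x, y)) :
    HasDerivAt (fun y => f (x, y)) (fderiv ℝ f (x, y) (0, 1)) y := by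
  have := hf.hasFDerivAt.comp_hasDerivAt y
    ((hasDerivAt_const y x).prodMk (hasDerivAt_id y))
  exact this

end Uniqueness

/-! ### Root systems and the differentiated Bethe equation -/

/-- The derivative of `b ((q, H), y)` in the direction `e` of the `(q, H)`-plane. -/
def dirDeriv (b : (ℝ × ℝ) × ℝ → ℂ) (e : ℝ × ℝ) (p : (ℝ × ℝ) × ℝ) : ℂ := fderiv ℝ b p (e, 0)

/-- The derivative of `b ((q, H), y)` in the curve parameter `y`. -/
def tangent (b : (ℝ × ℝ) × ℝ → ℂ) (p : (ℝ × ℝ) × ℝ) : ℂ := fderiv ℝ b p (0, 1)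

/-- The shift function `F_e = q ∂_e b / ∂_y b`: the velocity of the contour in the direction `e`,
measured in the original curve parameter `t = q y`. -/
def shift (b : (ℝ × ℝ) × ℝ → ℂ) (e : ℝ × ℝ) (p : (ℝ × ℝ) × ℝ) : ℂ :=
  p.1.1 * dirDeriv b e p / tangent b p

/-- The properties of a rescaled family of Bethe roots `b ((q, H), y)`, `(q, H) ∈ U`,
`y ∈ [-1/2, 1/2]`, on which the argument rests. `K` is the derivative of the two-body phase `Θ`,
holomorphic on `S`, and `R (x, y) = 2 π y + ∫ Θ(b (x, y) - b (x, s)) ds`. As `Θ` is multivalued, it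
enters only through the derivatives of `R` and through `integral_eq`. The field `bethe` is
the derivative of the Bethe equation `p(b) + 2 i H = q R` in the direction `e`, from which the
momentum `p` has been eliminated by means of the derivative along the curve. -/
structure RootSystem (U : Set (ℝ × ℝ)) (S : Set ℂ) (K : ℂ → ℂ) (b R : (ℝ × ℝ) × ℝ → ℂ) :
    Prop where
  isOpen : IsOpen U
  pos : ∀ x ∈ U, 0 < x.1
  isOpen_dom : IsOpen S
  neg_mem : ∀ z ∈ S, -z ∈ S
  differentiableOn : DifferentiableOn ℂ K S
  even : ∀ z, K (-z) = K z
  contDiffAt : ∀ x ∈ U, ∀ y ∈ 𝕀, ContDiffAt ℝ 2 b (x, y)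
  sub_mem : ∀ x ∈ U, ∀ y ∈ 𝕀, ∀ s ∈ 𝕀, b (x, y) - b (x, s) ∈ S
  tangent_ne : ∀ x ∈ U, ∀ y ∈ 𝕀, tangent b (x, y) ≠ 0
  symm : ∀ x ∈ U, ∀ y ∈ 𝕀, b (x, -y) = -(starRingEnd ℂ) (b (x, y))
  differentiableAt : ∀ x ∈ U, ∀ y ∈ 𝕀, DifferentiableAt ℝ R (x, y)
  dirDeriv_eq : ∀ x ∈ U, ∀ y ∈ 𝕀, ∀ e, dirDeriv R e (x, y) =
    ∫ s in (-(1 / 2) : ℝ)..(1 / 2),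
      K (b (x, y) - b (x, s)) * (dirDeriv b e (x, y) - dirDeriv b e (x, s))
  tangent_eq : ∀ x ∈ U, ∀ y ∈ 𝕀, tangent R (x, y) = 2 * Real.pi +
    (∫ s in (-(1 / 2) : ℝ)..(1 / 2), K (b (x, y) - b (x, s))) * tangent b (x, y)
  integral_eq : ∀ x ∈ U, ∫ y in (-(1 / 2) : ℝ)..(1 / 2), R (x, y) = 0
  bethe : ∀ x ∈ U, ∀ y ∈ 𝕀, ∀ e : ℝ × ℝ,
    2 * Real.pi * shift b e (x, y) + x.1 * (∫ s in (-(1 / 2) : ℝ)..(1 / 2),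
      K (b (x, y) - b (x, s)) * dirDeriv b e (x, s)) = -2 * Complex.I * e.2 + e.1 * R (x, y)

/-- The derivative of `q ∫ χ(b) dy` at `x = (q, H)` in the direction `e`. -/
def firstVar (b : (ℝ × ℝ) × ℝ → ℂ) (e x : ℝ × ℝ) (χ : ℂ → ℂ) : ℂ :=
  ∫ y in (-(1 / 2) : ℝ)..(1 / 2),
    (e.1 * χ (b (x, y)) + x.1 * (deriv χ (b (x, y)) * dirDeriv b e (x, y)))

/-- The second derivative of `q ∫ X(b) dy` at `x = (q, H)` in the direction `e`, where `X' = χ`. It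
is written in terms of `χ`, so that no primitive `X` needs to exist. -/
def secondVar (b : (ℝ × ℝ) × ℝ → ℂ) (e x : ℝ × ℝ) (χ : ℂ → ℂ) : ℂ :=
  ∫ y in (-(1 / 2) : ℝ)..(1 / 2),
    (2 * e.1 * (χ (b (x, y)) * dirDeriv b e (x, y)) +
      x.1 * (deriv χ (b (x, y)) * dirDeriv b e (x, y) ^ 2 +
        χ (b (x, y)) * dirDeriv (dirDeriv b e) e (x, y)))

/-- The density, with respect to `dz` on the contour, of the part of `firstVar` that is not
concentrated at the endpoints. -/
def firstDensity (b : (ℝ × ℝ) × ℝ → ℂ) (e : ℝ × ℝ) (p : (ℝ × ℝ) × ℝ) : ℂ :=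
  -(tangent (shift b e) p - e.1) / tangent b p

/-- The density, with respect to `dz` on the contour, of the part of `secondVar` that is not
concentrated at the endpoints. -/
def secondDensity (b : (ℝ × ℝ) × ℝ → ℂ) (e : ℝ × ℝ) (p : (ℝ × ℝ) × ℝ) : ℂ :=
  dirDeriv (shift b e) e p + e.1 * dirDeriv b e p / tangent b p -
    dirDeriv b e p / tangent b p * tangent (shift b e) p

namespace RootSystem

variable {U : Set (ℝ × ℝ)} {S : Set ℂ} {K : ℂ → ℂ} {b R : (ℝ × ℝ) × ℝ → ℂ}
  (h : RootSystem U S K b R) {x : ℝ × ℝ} {y : ℝ}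

include h

theorem contDiffAt_kernel {z : ℂ} (hz : z ∈ S) {n : WithTop ℕ∞} : ContDiffAt ℝ n K z :=
  ((h.differentiableOn.analyticAt (h.isOpen_dom.mem_nhds hz)).contDiffAt).restrict_scalars ℝ

theorem hasDerivAt_kernel {z : ℂ} (hz : z ∈ S) : HasDerivAt K (deriv K z) z :=
  (h.differentiableOn.differentiableAt (h.isOpen_dom.mem_nhds hz)).hasDerivAt

theorem differentiableOn_deriv : DifferentiableOn ℂ (deriv K) S :=
  h.differentiableOn.deriv h.isOpen_dom

theorem contDiffAt_dirDeriv (hx : x ∈ U) (hy : y ∈ 𝕀) (e : ℝ × ℝ) :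
    ContDiffAt ℝ 1 (dirDeriv b e) (x, y) :=
  ((h.contDiffAt x hx y hy).fderiv_right (by norm_num)).clm_apply contDiffAt_const

theorem contDiffAt_tangent (hx : x ∈ U) (hy : y ∈ 𝕀) : ContDiffAt ℝ 1 (tangent b) (x, y) :=
  ((h.contDiffAt x hx y hy).fderiv_right (by norm_num)).clm_apply contDiffAt_const

theorem contDiffAt_shift (hx : x ∈ U) (hy : y ∈ 𝕀) (e : ℝ × ℝ) :
    ContDiffAt ℝ 1 (shift b e) (x, y) := by
  refine ContDiffAt.mul (ContDiffAt.mul ?_ (h.contDiffAt_dirDeriv hx hy e))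
    ((h.contDiffAt_tangent hx hy).inv (h.tangent_ne x hx y hy))
  exact (Complex.ofRealCLM.contDiff.comp (contDiff_fst.comp contDiff_fst)).contDiffAt

theorem hasDerivAt_root (hx : x ∈ U) (hy : y ∈ 𝕀) :
    HasDerivAt (fun y => b (x, y)) (tangent b (x, y)) y :=
  hasDerivAt_slice ((h.contDiffAt x hx y hy).differentiableAt (by simp))

theorem tangent_dirDeriv (hx : x ∈ U) (hy : y ∈ 𝕀) (e : ℝ × ℝ) :
    tangent (dirDeriv b e) (x, y) = dirDeriv (tangent b) e (x, y) := by
  have hd : DifferentiableAt ℝ (fderiv ℝ b) (x, y) :=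
    ((h.contDiffAt x hx y hy).fderiv_right (m := 1) (by norm_num)).differentiableAt (by simp)
  have h1 : ∀ v w : (ℝ × ℝ) × ℝ, fderiv ℝ (fun p => fderiv ℝ b p v) (x, y) w =
      fderiv ℝ (fderiv ℝ b) (x, y) w v := by
    intro v w
    rw [fderiv_clm_apply hd (differentiableAt_const v)]
    simp
  have hs := (h.contDiffAt x hx y hy).isSymmSndFDerivAt (by simp)
  unfold tangent dirDeriv
  rw [h1, h1]
  exact hs _ _

theorem fderiv_kernelIntegral {g : (ℝ × ℝ) × ℝ → ℂ} (hx : x ∈ U) (hy : y ∈ 𝕀)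
    (hg : ∀ s ∈ 𝕀, ContDiffAt ℝ 1 g (x, s)) (v : (ℝ × ℝ) × ℝ) :
    DifferentiableAt ℝ (fun p : (ℝ × ℝ) × ℝ =>
      ∫ s in (-(1 / 2) : ℝ)..(1 / 2), K (b p - b (p.1, s)) * g (p.1, s)) (x, y) ∧
    fderiv ℝ (fun p : (ℝ × ℝ) × ℝ =>
      ∫ s in (-(1 / 2) : ℝ)..(1 / 2), K (b p - b (p.1, s)) * g (p.1, s)) (x, y) v =
    ∫ s in (-(1 / 2) : ℝ)..(1 / 2),
      (deriv K (b (x, y) - b (x, s)) * (fderiv ℝ b (x, y) v - dirDeriv b v.1 (x, s)) * g (x, s) +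
        K (b (x, y) - b (x, s)) * dirDeriv g v.1 (x, s)) := by
  have hpt : ∀ s ∈ 𝕀, HasFDerivAt (fun q : ((ℝ × ℝ) × ℝ) × ℝ => (q.1.1, q.2))
      (((ContinuousLinearMap.fst ℝ _ _).comp (ContinuousLinearMap.fst ℝ _ _)).prod
        (ContinuousLinearMap.snd ℝ _ _)) ((x, y), s) := fun s hs =>
    (((ContinuousLinearMap.fst ℝ (ℝ × ℝ) ℝ).comp (ContinuousLinearMap.fst ℝ _ _)).prod
        (ContinuousLinearMap.snd ℝ ((ℝ × ℝ) × ℝ) ℝ)).hasFDerivAt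
  have hcd : ∀ s ∈ 𝕀, ContDiffAt ℝ 1 (fun q : ((ℝ × ℝ) × ℝ) × ℝ =>
      K (b q.1 - b (q.1.1, q.2)) * g (q.1.1, q.2)) ((x, y), s) := by
    intro s hs
    have hp : ContDiffAt ℝ 1 (fun q : ((ℝ × ℝ) × ℝ) × ℝ => (q.1.1, q.2)) ((x, y), s) := by
      fun_prop
    have h1 : ContDiffAt ℝ 1 (fun q : ((ℝ × ℝ) × ℝ) × ℝ => b (q.1.1, q.2)) ((x, y), s) :=
      ((h.contDiffAt x hx s hs).of_le (by norm_num)).comp ((x, y), s) hp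
    have h2 : ContDiffAt ℝ 1 (fun q : ((ℝ × ℝ) × ℝ) × ℝ => b q.1) ((x, y), s) :=
      ((h.contDiffAt x hx y hy).of_le (by norm_num)).comp ((x, y), s) contDiffAt_fst
    refine ContDiffAt.mul ?_ ((hg s hs).comp ((x, y), s) hp)
    exact (h.contDiffAt_kernel (h.sub_mem x hx y hy s hs)).comp ((x, y), s) (h2.sub h1)
  refine ⟨(hasFDerivAt_paramIntegral_of_contDiffAt (by norm_num) hcd).differentiableAt, ?_⟩
  rw [fderiv_paramIntegral_apply (f := fun q : ((ℝ × ℝ) × ℝ) × ℝ =>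
      K (b q.1 - b (q.1.1, q.2)) * g (q.1.1, q.2)) (by norm_num) hcd]
  refine intervalIntegral.integral_congr fun s hs => ?_
  rw [uIcc_of_le (by norm_num)] at hs
  have hb1 : HasFDerivAt (fun q : ((ℝ × ℝ) × ℝ) × ℝ => b q.1) _ ((x, y), s) :=
    HasFDerivAt.comp (g := b) ((x, y), s)
      ((h.contDiffAt x hx y hy).differentiableAt (by simp)).hasFDerivAt hasFDerivAt_fst
  have hb2 := HasFDerivAt.comp (g := b) ((x, y), s)
      ((h.contDiffAt x hx s hs).differentiableAt (by simp)).hasFDerivAt (hpt s hs)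
  have hg2 := HasFDerivAt.comp (g := g) ((x, y), s)
      ((hg s hs).differentiableAt (by simp)).hasFDerivAt (hpt s hs)
  have hK := (h.hasDerivAt_kernel (h.sub_mem x hx y hy s hs)).comp_hasFDerivAt ((x, y), s)
    (hb1.sub hb2)
  have key : fderiv ℝ (fun q : ((ℝ × ℝ) × ℝ) × ℝ => K (b q.1 - b (q.1.1, q.2)) * g (q.1.1, q.2))
    ((x, y), s) = _ := (hK.mul hg2).fderiv
  simp only [key]
  simp [dirDeriv]
  ring

/-- The derivative of the equation `RootSystem.bethe` in an arbitrary direction `v`. -/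
theorem fderiv_bethe (hx : x ∈ U) (hy : y ∈ 𝕀) (e : ℝ × ℝ) (v : (ℝ × ℝ) × ℝ) :
    2 * Real.pi * fderiv ℝ (shift b e) (x, y) v +
      v.1.1 * (∫ s in (-(1 / 2) : ℝ)..(1 / 2), K (b (x, y) - b (x, s)) * dirDeriv b e (x, s)) +
      x.1 * (∫ s in (-(1 / 2) : ℝ)..(1 / 2),
        (deriv K (b (x, y) - b (x, s)) * (fderiv ℝ b (x, y) v - dirDeriv b v.1 (x, s)) *
          dirDeriv b e (x, s) +
        K (b (x, y) - b (x, s)) * dirDeriv (dirDeriv b e) v.1 (x, s))) =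
      e.1 * fderiv ℝ R (x, y) v := by
  obtain ⟨hJ, hJ'⟩ := h.fderiv_kernelIntegral hx hy
    (fun s hs => h.contDiffAt_dirDeriv hx hs e) v
  have hF := (((h.contDiffAt_shift hx hy e).differentiableAt (by simp)).hasFDerivAt).const_mul
    (2 * Real.pi : ℂ)
  have hq : HasFDerivAt (fun p : (ℝ × ℝ) × ℝ => (p.1.1 : ℂ)) (Complex.ofRealCLM.comp
      ((ContinuousLinearMap.fst ℝ _ _).comp (ContinuousLinearMap.fst ℝ _ _))) (x, y) :=
    (Complex.ofRealCLM.comp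
      ((ContinuousLinearMap.fst ℝ _ _).comp (ContinuousLinearMap.fst ℝ (ℝ × ℝ) ℝ))).hasFDerivAt
  have hR := (((h.differentiableAt x hx y hy).hasFDerivAt).const_mul (e.1 : ℂ)).const_add
    (-2 * Complex.I * e.2)
  have hL := (hF.add (hq.mul hJ.hasFDerivAt)).sub hR
  have h0 := fderiv_apply_eq_zero_of_eqOn h.isOpen (a := -(1 / 2)) (b := 1 / 2) (by norm_num)
    (fun x hx y hy => by exact sub_eq_zero.2 (h.bethe x hx y hy e)) hx hy hL.differentiableAt v
  rw [hL.fderiv] at h0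
  simp only [sub_apply, add_apply, smul_apply, hJ', smul_eq_mul] at h0
  simp [-one_div] at h0
  linear_combination h0

omit h in
theorem continuousOn_slice {g : (ℝ × ℝ) × ℝ → ℂ} (hg : ContinuousOn g (U ×ˢ 𝕀)) (hx : x ∈ U) :
    ContinuousOn (fun y => g (x, y)) 𝕀 :=
  hg.comp (f := fun y => (x, y)) (by fun_prop) fun _ hy => ⟨hx, hy⟩

omit h in
theorem continuousOn_fderiv_apply {g : (ℝ × ℝ) × ℝ → ℂ}
    (hg : ∀ x ∈ U, ∀ y ∈ 𝕀, ContDiffAt ℝ 1 g (x, y)) (v : (ℝ × ℝ) × ℝ) :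
    ContinuousOn (fun p => fderiv ℝ g p v) (U ×ˢ 𝕀) := fun p hp =>
  (((hg p.1 hp.1 p.2 hp.2).continuousAt_fderiv (by simp)).clm_apply
    continuousAt_const).continuousWithinAt

theorem continuousOn_root : ContinuousOn b (U ×ˢ 𝕀) := fun p hp =>
  (h.contDiffAt p.1 hp.1 p.2 hp.2).continuousAt.continuousWithinAt

theorem continuousOn_dirDeriv (e : ℝ × ℝ) : ContinuousOn (dirDeriv b e) (U ×ˢ 𝕀) := fun _ hp =>
  (h.contDiffAt_dirDeriv hp.1 hp.2 e).continuousAt.continuousWithinAt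

theorem continuousOn_tangent : ContinuousOn (tangent b) (U ×ˢ 𝕀) := fun _ hp =>
  (h.contDiffAt_tangent hp.1 hp.2).continuousAt.continuousWithinAt

theorem continuousOn_shift (e : ℝ × ℝ) : ContinuousOn (shift b e) (U ×ˢ 𝕀) := fun _ hp =>
  (h.contDiffAt_shift hp.1 hp.2 e).continuousAt.continuousWithinAt

theorem continuousOn_dirDeriv_dirDeriv (e : ℝ × ℝ) :
    ContinuousOn (dirDeriv (dirDeriv b e) e) (U ×ˢ 𝕀) :=
  continuousOn_fderiv_apply (fun _ hx _ hy => h.contDiffAt_dirDeriv hx hy e) _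

theorem continuousOn_tangent_shift (e : ℝ × ℝ) :
    ContinuousOn (tangent (shift b e)) (U ×ˢ 𝕀) :=
  continuousOn_fderiv_apply (fun _ hx _ hy => h.contDiffAt_shift hx hy e) _

theorem continuousOn_dirDeriv_shift (e : ℝ × ℝ) :
    ContinuousOn (dirDeriv (shift b e) e) (U ×ˢ 𝕀) :=
  continuousOn_fderiv_apply (fun _ hx _ hy => h.contDiffAt_shift hx hy e) _

omit h in
theorem intervalIntegrable_half {g : ℝ → ℂ} (hg : ContinuousOn g 𝕀) :
    IntervalIntegrable g volume (-(1 / 2)) (1 / 2) :=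
  ContinuousOn.intervalIntegrable (by rwa [uIcc_of_le (by norm_num)])

theorem continuousOn_kernel_comp {f : ℂ → ℂ} (hf : ContinuousOn f S) {T : Type*}
    [TopologicalSpace T] {s : Set T} {u v : T → ℝ} (hu : ContinuousOn u s) (hv : ContinuousOn v s)
    (hus : ∀ t ∈ s, u t ∈ 𝕀) (hvs : ∀ t ∈ s, v t ∈ 𝕀) (hx : x ∈ U) :
    ContinuousOn (fun t => f (b (x, u t) - b (x, v t))) s := by
  have hb := continuousOn_slice h.continuousOn_root hx
  exact hf.comp ((hb.comp hu hus).sub (hb.comp hv hvs))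
    fun t ht => h.sub_mem x hx _ (hus t ht) _ (hvs t ht)

theorem continuousOn_kernel_right {f : ℂ → ℂ} (hf : ContinuousOn f S) (hx : x ∈ U) (hy : y ∈ 𝕀) :
    ContinuousOn (fun s => f (b (x, y) - b (x, s))) 𝕀 :=
  h.continuousOn_kernel_comp hf (u := fun _ => y) (v := fun s => s) (by fun_prop) (by fun_prop)
    (fun _ _ => hy) (fun _ hs => hs) hx

omit h in
theorem integral_swap_half {g : ℝ → ℝ → ℂ}
    (hg : ContinuousOn (fun p : ℝ × ℝ => g p.1 p.2) (𝕀 ×ˢ 𝕀)) :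
    ∫ y in (-(1 / 2) : ℝ)..(1 / 2), ∫ s in (-(1 / 2) : ℝ)..(1 / 2), g y s =
      ∫ s in (-(1 / 2) : ℝ)..(1 / 2), ∫ y in (-(1 / 2) : ℝ)..(1 / 2), g y s := by
  refine intervalIntegral_intervalIntegral_swap ?_
  have := hg.integrableOn_compact (μ := volume) (isCompact_Icc.prod isCompact_Icc)
  have h2 : Integrable (fun p : ℝ × ℝ => g p.1 p.2)
      ((volume.prod volume).restrict (𝕀 ×ˢ 𝕀)) := this
  rw [uIoc_of_le (show (-(1 / 2) : ℝ) ≤ 1 / 2 by norm_num)]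
  exact IntegrableOn.mono_set (s := Ioc _ _ ×ˢ Ioc _ _) h2
    (prod_mono Ioc_subset_Icc_self Ioc_subset_Icc_self)

theorem deriv_kernel_neg (z : ℂ) : deriv K (-z) = -deriv K z := by
  have h1 := deriv_comp_neg K z
  have h2 : (fun z => K (-z)) = K := funext h.even
  rw [h2] at h1
  rw [h1, neg_neg]

theorem fderiv_bethe_tangent (hx : x ∈ U) (hy : y ∈ 𝕀) (e : ℝ × ℝ) :
    2 * Real.pi * tangent (shift b e) (x, y) + x.1 * (∫ s in (-(1 / 2) : ℝ)..(1 / 2),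
      deriv K (b (x, y) - b (x, s)) * tangent b (x, y) * dirDeriv b e (x, s)) =
    e.1 * (2 * Real.pi +
      (∫ s in (-(1 / 2) : ℝ)..(1 / 2), K (b (x, y) - b (x, s))) * tangent b (x, y)) := by
  have key := h.fderiv_bethe hx hy e (0, 1)
  have h0 : ∀ (g : (ℝ × ℝ) × ℝ → ℂ) p, dirDeriv g 0 p = 0 := fun g p => by
    have : ((0, 0) : (ℝ × ℝ) × ℝ) = 0 := rfl
    simp [dirDeriv, this]
  simp only [h0, sub_zero, mul_zero, add_zero, Prod.fst_zero, Complex.ofReal_zero, zero_mul] at key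
  have hR := h.tangent_eq x hx y hy
  rw [← hR]
  exact key

/-- The density of the first variation solves an integral equation, whose source consists of the
endpoint contributions hidden in `firstVar` by `firstVar_eq`. -/
theorem firstDensity_eq (hx : x ∈ U) (hy : y ∈ 𝕀) (e : ℝ × ℝ) :
    2 * Real.pi * firstDensity b e (x, y) + firstVar b e x (fun z => K (b (x, y) - z)) = 0 := by
  have key := h.fderiv_bethe_tangent hx hy e
  have hb := h.tangent_ne x hx y hy
  have hK := h.continuousOn_kernel_right h.differentiableOn.continuousOn hx hy
  have hK' := h.continuousOn_kernel_right h.differentiableOn_deriv.continuousOn hx hy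
  have hd := continuousOn_slice (h.continuousOn_dirDeriv e) hx
  have h1 : firstVar b e x (fun z => K (b (x, y) - z)) =
      e.1 * (∫ s in (-(1 / 2) : ℝ)..(1 / 2), K (b (x, y) - b (x, s))) -
      x.1 * (∫ s in (-(1 / 2) : ℝ)..(1 / 2),
        deriv K (b (x, y) - b (x, s)) * dirDeriv b e (x, s)) := by
    have i₀ : IntervalIntegrable (fun s => K (b (x, y) - b (x, s))) volume (-(1 / 2)) (1 / 2) :=
      intervalIntegrable_half hK
    have j₁ : IntervalIntegrable (fun s => deriv K (b (x, y) - b (x, s)) * dirDeriv b e (x, s))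
      volume (-(1 / 2)) (1 / 2) := intervalIntegrable_half (hK'.mul hd)
    unfold firstVar
    rw [← intervalIntegral.integral_const_mul, ← intervalIntegral.integral_const_mul,
      ← intervalIntegral.integral_sub (i₀.const_mul _) (j₁.const_mul _)]
    refine intervalIntegral.integral_congr fun s _ => ?_
    simp only [deriv_comp_const_sub]
    ring
  have h2 : (∫ s in (-(1 / 2) : ℝ)..(1 / 2),
      deriv K (b (x, y) - b (x, s)) * tangent b (x, y) * dirDeriv b e (x, s)) =
      tangent b (x, y) * ∫ s in (-(1 / 2) : ℝ)..(1 / 2),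
        deriv K (b (x, y) - b (x, s)) * dirDeriv b e (x, s) := by
    rw [← intervalIntegral.integral_const_mul]
    congr 1 with s
    ring
  rw [h2] at key
  rw [h1, firstDensity]
  field_simp
  linear_combination -key

/-- The density of the second variation solves the same integral equation as `firstDensity`, again
with a source that consists of endpoint contributions (`secondVar_eq`). -/
theorem secondDensity_eq (hx : x ∈ U) (hy : y ∈ 𝕀) (e : ℝ × ℝ) :
    2 * Real.pi * secondDensity b e (x, y) + secondVar b e x (fun z => K (b (x, y) - z)) = 0 := by
  have key := h.fderiv_bethe_tangent hx hy e
  have key2 := h.fderiv_bethe hx hy e (e, 0)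
  have hR := h.dirDeriv_eq x hx y hy e
  have hb := h.tangent_ne x hx y hy
  have hK := h.continuousOn_kernel_right h.differentiableOn.continuousOn hx hy
  have hK' := h.continuousOn_kernel_right h.differentiableOn_deriv.continuousOn hx hy
  have hd := continuousOn_slice (h.continuousOn_dirDeriv e) hx
  have hdd := continuousOn_slice (h.continuousOn_dirDeriv_dirDeriv e) hx
  change 2 * Real.pi * dirDeriv (shift b e) e (x, y) + e.1 * _ + _ = e.1 * dirDeriv R e (x, y)
    at key2
  rw [hR] at key2
  simp only [show fderiv ℝ b (x, y) (e, 0) = dirDeriv b e (x, y) from rfl] at key2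
  set z := b (x, y)
  set t := tangent b (x, y)
  set d := dirDeriv b e (x, y)
  set I₀ := ∫ s in (-(1 / 2) : ℝ)..(1 / 2), K (z - b (x, s)) with hI₀
  set I₁ := ∫ s in (-(1 / 2) : ℝ)..(1 / 2), K (z - b (x, s)) * dirDeriv b e (x, s) with hI₁
  set J₁ := ∫ s in (-(1 / 2) : ℝ)..(1 / 2), deriv K (z - b (x, s)) * dirDeriv b e (x, s) with hJ₁
  set J₂ := ∫ s in (-(1 / 2) : ℝ)..(1 / 2), deriv K (z - b (x, s)) * dirDeriv b e (x, s) ^ 2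
    with hJ₂
  set I₂ := ∫ s in (-(1 / 2) : ℝ)..(1 / 2), K (z - b (x, s)) * dirDeriv (dirDeriv b e) e (x, s)
    with hI₂
  have i₀ : IntervalIntegrable (fun s => K (z - b (x, s))) volume (-(1 / 2)) (1 / 2) :=
    intervalIntegrable_half hK
  have i₁ : IntervalIntegrable (fun s => K (z - b (x, s)) * dirDeriv b e (x, s)) volume
    (-(1 / 2)) (1 / 2) := intervalIntegrable_half (hK.mul hd)
  have j₁ : IntervalIntegrable (fun s => deriv K (z - b (x, s)) * dirDeriv b e (x, s)) volume
    (-(1 / 2)) (1 / 2) := intervalIntegrable_half (hK'.mul hd)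
  have j₂ : IntervalIntegrable (fun s => deriv K (z - b (x, s)) * dirDeriv b e (x, s) ^ 2) volume
    (-(1 / 2)) (1 / 2) := intervalIntegrable_half (hK'.mul (hd.pow 2))
  have i₂ : IntervalIntegrable (fun s => K (z - b (x, s)) * dirDeriv (dirDeriv b e) e (x, s)) volume
    (-(1 / 2)) (1 / 2) := intervalIntegrable_half (hK.mul hdd)
  have h1 : secondVar b e x (fun w => K (z - w)) = 2 * e.1 * I₁ + x.1 * (I₂ - J₂) := by
    rw [hI₁, hJ₂, hI₂,
      ← intervalIntegral.integral_sub i₂ j₂, ← intervalIntegral.integral_const_mul,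
      ← intervalIntegral.integral_const_mul,
      ← intervalIntegral.integral_add (i₁.const_mul _) ((i₂.sub j₂).const_mul _)]
    unfold secondVar
    refine intervalIntegral.integral_congr fun s _ => ?_
    simp only [deriv_comp_const_sub]
    ring
  have h2 : (∫ s in (-(1 / 2) : ℝ)..(1 / 2),
      deriv K (z - b (x, s)) * t * dirDeriv b e (x, s)) = t * J₁ := by
    rw [hJ₁, ← intervalIntegral.integral_const_mul]
    congr 1 with s
    ring
  have h3 : (∫ s in (-(1 / 2) : ℝ)..(1 / 2),
      (deriv K (z - b (x, s)) * (d - dirDeriv b e (x, s)) * dirDeriv b e (x, s) +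
        K (z - b (x, s)) * dirDeriv (dirDeriv b e) e (x, s))) = d * J₁ - J₂ + I₂ := by
    rw [hI₂, hJ₂, hJ₁, ← intervalIntegral.integral_const_mul,
      ← intervalIntegral.integral_sub (j₁.const_mul _) j₂,
      ← intervalIntegral.integral_add ((j₁.const_mul _).sub j₂) i₂]
    congr 1 with s
    ring
  have h4 : (∫ s in (-(1 / 2) : ℝ)..(1 / 2),
      K (z - b (x, s)) * (d - dirDeriv b e (x, s))) = d * I₀ - I₁ := by
    rw [hI₀, hI₁, ← intervalIntegral.integral_const_mul,
      ← intervalIntegral.integral_sub (i₀.const_mul _) i₁]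
    congr 1 with s
    ring
  rw [h2] at key
  rw [h3, h4] at key2
  rw [h1, secondDensity]
  change 2 * Real.pi * (dirDeriv (shift b e) e (x, y) + e.1 * d / t - d / t *
    tangent (shift b e) (x, y)) + _ = 0
  field_simp
  linear_combination t * key2 - d * key

end RootSystem

/-! ### The shift function at the endpoints -/

namespace RootSystem

variable {U : Set (ℝ × ℝ)} {S : Set ℂ} {K : ℂ → ℂ} {b R : (ℝ × ℝ) × ℝ → ℂ}
  (h : RootSystem U S K b R) {x : ℝ × ℝ} {y : ℝ}

theorem left_mem : (-(1 / 2) : ℝ) ∈ 𝕀 := ⟨le_rfl, by norm_num⟩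
theorem right_mem : (1 / 2 : ℝ) ∈ 𝕀 := ⟨by norm_num, le_rfl⟩

include h

theorem mul_dirDeriv_eq (hx : x ∈ U) (hy : y ∈ 𝕀) (e : ℝ × ℝ) :
    x.1 * dirDeriv b e (x, y) = shift b e (x, y) * tangent b (x, y) := by
  rw [shift, div_mul_cancel₀ _ (h.tangent_ne x hx y hy)]

theorem hasDerivAt_shift (hx : x ∈ U) (hy : y ∈ 𝕀) (e : ℝ × ℝ) :
    HasDerivAt (fun y => shift b e (x, y)) (tangent (shift b e) (x, y)) y :=
  hasDerivAt_slice ((h.contDiffAt_shift hx hy e).differentiableAt (by simp))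

/-- The endpoint values of the shift function determine each other up to sign. The derivative of the
Bethe equation along the contour, integrated against the shift function, gives a double integral of
the odd kernel `deriv K`, which vanishes. -/
theorem shift_sq_sub (hx : x ∈ U) (e : ℝ × ℝ) :
    Real.pi * (shift b e (x, 1 / 2) ^ 2 - shift b e (x, -(1 / 2)) ^ 2) =
      -2 * Complex.I * e.1 * e.2 := by
  have hb := continuousOn_slice h.continuousOn_root hx
  have ht := continuousOn_slice h.continuousOn_tangent hx
  have hF := continuousOn_slice (h.continuousOn_shift e) hx
  have hF' := continuousOn_slice (h.continuousOn_tangent_shift e) hx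
  have hq : (x.1 : ℂ) ≠ 0 := by exact_mod_cast (h.pos x hx).ne'
  have hKK : ∀ f : ℂ → ℂ, ContinuousOn f S →
      ContinuousOn (fun p : ℝ × ℝ => f (b (x, p.1) - b (x, p.2))) (𝕀 ×ˢ 𝕀) := fun f hf =>
    h.continuousOn_kernel_comp hf continuousOn_fst continuousOn_snd (fun p hp => hp.1)
      (fun p hp => hp.2) hx
  have hFt1 : ContinuousOn (fun p : ℝ × ℝ => shift b e (x, p.1) * tangent b (x, p.1)) (𝕀 ×ˢ 𝕀) :=
    (hF.mul ht).comp continuousOn_fst fun p hp => hp.1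
  have hFt2 : ContinuousOn (fun p : ℝ × ℝ => shift b e (x, p.2) * tangent b (x, p.2)) (𝕀 ×ˢ 𝕀) :=
    (hF.mul ht).comp continuousOn_snd fun p hp => hp.2
  -- the double integral of the odd kernel `K'` against a symmetric product vanishes
  set G : ℝ → ℝ → ℂ := fun y s => deriv K (b (x, y) - b (x, s)) *
    ((shift b e (x, y) * tangent b (x, y)) * (shift b e (x, s) * tangent b (x, s))) with hG
  have hGc : ContinuousOn (fun p : ℝ × ℝ => G p.1 p.2) (𝕀 ×ˢ 𝕀) :=
    (hKK _ h.differentiableOn_deriv.continuousOn).mul (hFt1.mul hFt2)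
  have h0 : ∫ y in (-(1 / 2) : ℝ)..(1 / 2), ∫ s in (-(1 / 2) : ℝ)..(1 / 2), G y s = 0 := by
    have hswap := integral_swap_half hGc
    have hneg : ∫ s in (-(1 / 2) : ℝ)..(1 / 2), ∫ y in (-(1 / 2) : ℝ)..(1 / 2), G y s =
        -∫ y in (-(1 / 2) : ℝ)..(1 / 2), ∫ s in (-(1 / 2) : ℝ)..(1 / 2), G y s := by
      rw [← intervalIntegral.integral_neg]
      congr 1 with s
      rw [← intervalIntegral.integral_neg]
      congr 1 with y
      rw [hG]
      simp only
      rw [← neg_sub (b (x, s)), h.deriv_kernel_neg]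
      ring
    rw [hneg] at hswap
    linear_combination hswap / 2
  -- hence `∫ F_e (e_q ∂_y R - 2 π ∂_y F_e) dy = 0`
  have h1 : ∫ y in (-(1 / 2) : ℝ)..(1 / 2), shift b e (x, y) * (e.1 * (2 * Real.pi +
      (∫ s in (-(1 / 2) : ℝ)..(1 / 2), K (b (x, y) - b (x, s))) * tangent b (x, y)) -
        2 * Real.pi * tangent (shift b e) (x, y)) = 0 := by
    rw [← h0]
    refine intervalIntegral.integral_congr fun y hy => ?_
    rw [uIcc_of_le (by norm_num)] at hy
    rw [← h.fderiv_bethe_tangent hx hy e, add_sub_cancel_left,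
      ← intervalIntegral.integral_const_mul, ← intervalIntegral.integral_const_mul]
    refine intervalIntegral.integral_congr fun s hs => ?_
    rw [uIcc_of_le (by norm_num)] at hs
    simp only [hG]
    rw [← h.mul_dirDeriv_eq hx hs e]
    ring
  set H : ℝ → ℝ → ℂ := fun y s => K (b (x, y) - b (x, s)) *
    (shift b e (x, y) * tangent b (x, y)) with hH
  have hHc : ContinuousOn (fun p : ℝ × ℝ => H p.1 p.2) (𝕀 ×ˢ 𝕀) :=
    (hKK _ h.differentiableOn.continuousOn).mul hFt1
  have hHi : ContinuousOn (fun y => ∫ s in (-(1 / 2) : ℝ)..(1 / 2), H y s) 𝕀 :=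
    continuousOn_paramIntegral (f := fun p : ℝ × ℝ => H p.1 p.2) (by norm_num) hHc
  have hR : ContinuousOn (fun y => R (x, y)) 𝕀 := fun y hy =>
    ((h.differentiableAt x hx y hy).continuousAt.comp (f := fun y => (x, y))
      (by fun_prop)).continuousWithinAt
  have h2 : ∫ y in (-(1 / 2) : ℝ)..(1 / 2), ∫ s in (-(1 / 2) : ℝ)..(1 / 2), H y s =
      -2 * Complex.I * e.2 - 2 * Real.pi * ∫ y in (-(1 / 2) : ℝ)..(1 / 2), shift b e (x, y) := by
    rw [integral_swap_half hHc]
    have : ∀ s ∈ 𝕀, ∫ y in (-(1 / 2) : ℝ)..(1 / 2), H y s =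
        (-2 * Complex.I * e.2 + e.1 * R (x, s)) - 2 * Real.pi * shift b e (x, s) := by
      intro s hs
      rw [← h.bethe x hx s hs e, add_sub_cancel_left, ← intervalIntegral.integral_const_mul]
      refine intervalIntegral.integral_congr fun y hy => ?_
      rw [uIcc_of_le (by norm_num)] at hy
      simp only [hH]
      rw [← h.mul_dirDeriv_eq hx hy e, ← neg_sub, h.even]
      ring
    rw [intervalIntegral.integral_congr (g := fun s => (-2 * Complex.I * e.2 + e.1 * R (x, s)) -
      2 * Real.pi * shift b e (x, s))
      (fun s hs => this s (by rwa [uIcc_of_le (by norm_num)] at hs))]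
    have iR := (intervalIntegrable_half hR).const_mul (e.1 : ℂ)
    rw [intervalIntegral.integral_sub (intervalIntegrable_const.add iR)
      ((intervalIntegrable_half hF).const_mul _), intervalIntegral.integral_add
      intervalIntegrable_const iR, intervalIntegral.integral_const_mul,
      intervalIntegral.integral_const_mul, h.integral_eq x hx, intervalIntegral.integral_const]
    norm_num
  have h3 : ∫ y in (-(1 / 2) : ℝ)..(1 / 2), 2 * (shift b e (x, y) * tangent (shift b e) (x, y)) =
      shift b e (x, 1 / 2) ^ 2 - shift b e (x, -(1 / 2)) ^ 2 := by
    refine intervalIntegral.integral_eq_sub_of_hasDerivAt (f := fun y => shift b e (x, y) ^ 2)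
      (fun y hy => ?_) (intervalIntegrable_half (continuousOn_const.mul (hF.mul hF')))
    rw [uIcc_of_le (by norm_num)] at hy
    refine ((h.hasDerivAt_shift hx hy e).pow 2).congr_deriv ?_
    simp
    ring
  have h4 : ∫ y in (-(1 / 2) : ℝ)..(1 / 2), shift b e (x, y) * (e.1 * (2 * Real.pi +
      (∫ s in (-(1 / 2) : ℝ)..(1 / 2), K (b (x, y) - b (x, s))) * tangent b (x, y)) -
        2 * Real.pi * tangent (shift b e) (x, y)) =
      e.1 * (2 * Real.pi * (∫ y in (-(1 / 2) : ℝ)..(1 / 2), shift b e (x, y)) +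
        ∫ y in (-(1 / 2) : ℝ)..(1 / 2), ∫ s in (-(1 / 2) : ℝ)..(1 / 2), H y s) -
      Real.pi * ∫ y in (-(1 / 2) : ℝ)..(1 / 2),
        2 * (shift b e (x, y) * tangent (shift b e) (x, y)) := by
    have iF := (intervalIntegrable_half hF).const_mul (2 * Real.pi : ℂ)
    have iH := intervalIntegrable_half hHi
    have iG : IntervalIntegrable
        (fun y => 2 * (shift b e (x, y) * tangent (shift b e) (x, y))) volume (-(1 / 2)) (1 / 2) :=
      intervalIntegrable_half (continuousOn_const.mul (hF.mul hF'))
    rw [← intervalIntegral.integral_const_mul, ← intervalIntegral.integral_add iF iH,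
      ← intervalIntegral.integral_const_mul, ← intervalIntegral.integral_const_mul,
      ← intervalIntegral.integral_sub ((iF.add iH).const_mul _) (iG.const_mul _)]
    refine intervalIntegral.integral_congr fun y hy => ?_
    simp only [hH]
    rw [intervalIntegral.integral_mul_const]
    ring
  rw [h4, h2, h3] at h1
  linear_combination -h1

theorem symm_deriv (hx : x ∈ U) (hy : y ∈ 𝕀) (v : (ℝ × ℝ) × ℝ) :
    fderiv ℝ b (x, -y) (v.1, -v.2) = -(starRingEnd ℂ) (fderiv ℝ b (x, y) v) := by
  have hy' : -y ∈ 𝕀 := ⟨by linarith [hy.2], by linarith [hy.1]⟩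
  have h1 : HasFDerivAt (fun p : (ℝ × ℝ) × ℝ => (p.1, -p.2))
      ((ContinuousLinearMap.fst ℝ _ _).prod (-ContinuousLinearMap.snd ℝ _ _)) (x, y) :=
    ((ContinuousLinearMap.fst ℝ (ℝ × ℝ) ℝ).prod (-ContinuousLinearMap.snd ℝ (ℝ × ℝ) ℝ)).hasFDerivAt
  have h2 := HasFDerivAt.comp (g := b) (x, y)
    ((h.contDiffAt x hx (-y) hy').differentiableAt (by simp)).hasFDerivAt h1
  have h3 := (Complex.conjCLE.toContinuousLinearMap.hasFDerivAt (x := b (x, y))).comp (x, y)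
    ((h.contDiffAt x hx y hy).differentiableAt (by simp)).hasFDerivAt
  have h4 := h2.add h3
  have h0 := fderiv_apply_eq_zero_of_eqOn (a := -(1 / 2)) (b := 1 / 2) h.isOpen (by norm_num)
    (fun x hx y hy => by
      change b (x, -y) + (starRingEnd ℂ) (b (x, y)) = 0
      rw [h.symm x hx y hy]; ring) hx hy h4.differentiableAt v
  rw [h4.fderiv] at h0
  exact eq_neg_of_add_eq_zero_left h0

theorem tangent_neg (hx : x ∈ U) (hy : y ∈ 𝕀) :
    tangent b (x, -y) = (starRingEnd ℂ) (tangent b (x, y)) := by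
  have := h.symm_deriv hx hy (0, 1)
  have h2 : fderiv ℝ b (x, -y) (0, -1) = -fderiv ℝ b (x, -y) (0, 1) := by
    rw [← map_neg]; simp
  simp only at this
  rw [h2, neg_inj] at this
  exact this

theorem dirDeriv_neg (hx : x ∈ U) (hy : y ∈ 𝕀) (e : ℝ × ℝ) :
    dirDeriv b e (x, -y) = -(starRingEnd ℂ) (dirDeriv b e (x, y)) := by
  have := h.symm_deriv hx hy (e, 0)
  simp only [neg_zero] at this
  exact this

theorem shift_neg (hx : x ∈ U) (hy : y ∈ 𝕀) (e : ℝ × ℝ) :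
    shift b e (x, -y) = -(starRingEnd ℂ) (shift b e (x, y)) := by
  simp only [shift, h.tangent_neg hx hy, h.dirDeriv_neg hx hy, map_div₀, map_mul,
    Complex.conj_ofReal]
  ring

omit h in
theorem shift_add (e e' : ℝ × ℝ) (p : (ℝ × ℝ) × ℝ) :
    shift b (e + e') p = shift b e p + shift b e' p := by
  have : ((e + e', 0) : (ℝ × ℝ) × ℝ) = (e, 0) + (e', 0) := by simp
  simp only [shift, dirDeriv, this, map_add]
  ring

/-- `shift_sq_sub` with the reflection symmetry: the two endpoint values are exchanged by
`z ↦ -conj z`, so that only an imaginary part remains. -/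
theorem shift_sq_im (hx : x ∈ U) (e : ℝ × ℝ) :
    Real.pi * (shift b e (x, 1 / 2) ^ 2).im = -(e.1 * e.2) := by
  have h1 := h.shift_sq_sub hx e
  rw [h.shift_neg hx right_mem, neg_sq, ← map_pow, Complex.sub_conj] at h1
  have h2 := congrArg Complex.im h1
  simp at h2
  norm_num at h2 ⊢
  linarith

/-- At the right endpoint, one of the shifts in the two coordinate directions is real and the other
one imaginary, and neither is zero: this is `shift_sq_im` for `(0, 1)`, `(1, 0)` and, polarized,
`(1, 1)`. -/
theorem shift_relations (hx : x ∈ U) :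
    (shift b (0, 1) (x, 1 / 2)).re * (shift b (0, 1) (x, 1 / 2)).im = 0 ∧
    (shift b (1, 0) (x, 1 / 2)).re * (shift b (1, 0) (x, 1 / 2)).im = 0 ∧
    (shift b (0, 1) (x, 1 / 2)).re * (shift b (1, 0) (x, 1 / 2)).im +
      (shift b (0, 1) (x, 1 / 2)).im * (shift b (1, 0) (x, 1 / 2)).re ≠ 0 := by
  have h1 := h.shift_sq_im hx (0, 1)
  have h2 := h.shift_sq_im hx (1, 0)
  have h3 := h.shift_sq_im hx ((0, 1) + (1, 0))
  rw [shift_add] at h3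
  set f := shift b (0, 1) (x, 1 / 2)
  set g := shift b (1, 0) (x, 1 / 2)
  have hpi := Real.pi_pos
  simp [pow_two, hpi.ne'] at h1 h2 h3
  refine ⟨by nlinarith, by nlinarith, fun h0 => ?_⟩
  have : (f.re + g.re) * (f.im + g.im) + (f.im + g.im) * (f.re + g.re) = 0 := by nlinarith
  rw [this] at h3
  norm_num at h3

theorem shift_det_ne (hx : x ∈ U) :
    ((starRingEnd ℂ) (shift b (0, 1) (x, 1 / 2)) * shift b (1, 0) (x, 1 / 2)).im ≠ 0 := by
  obtain ⟨h1, h2, h3⟩ := h.shift_relations hx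
  set f := shift b (0, 1) (x, 1 / 2)
  set g := shift b (1, 0) (x, 1 / 2)
  simp only [Complex.mul_im, Complex.conj_re, Complex.conj_im]
  intro h0
  apply h3
  rcases mul_eq_zero.1 h1 with hf | hf <;> rcases mul_eq_zero.1 h2 with hg | hg <;>
    simp [hf, hg] at h0 ⊢ <;> tauto

end RootSystem

/-! ### The homogeneous integral equation -/

/-- The function `z ↦ -(1 / 2π) ∫_C K(z - w) n(w) dw`, where `C` is the contour at `x` and `n` is
given as a function of the curve parameter. -/
def kernelPotential (K : ℂ → ℂ) (b n : (ℝ × ℝ) × ℝ → ℂ) (x : ℝ × ℝ) (z : ℂ) : ℂ :=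
  -(2 * Real.pi : ℂ)⁻¹ * ∫ s in (-(1 / 2) : ℝ)..(1 / 2),
    K (z - b (x, s)) * (n (x, s) * tangent b (x, s))

/-- `n` is a solution of the homogeneous equation `2 π n(z) + ∫_C K(z - w) n(w) dw = 0` on the
contour for every `x ∈ U`, and is continuous in `x` and the curve parameter jointly. -/
structure IsNullFamily (U : Set (ℝ × ℝ)) (K : ℂ → ℂ) (b n : (ℝ × ℝ) × ℝ → ℂ) : Prop where
  continuousOn : ContinuousOn n (U ×ˢ 𝕀)
  eq_potential : ∀ x ∈ U, ∀ y ∈ 𝕀, n (x, y) = kernelPotential K b n x (b (x, y))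

/-- The pairs `(x, z)` for which `K(z - w)` is regular at all `w` on the contour at `x`. -/
def regularPoints (U : Set (ℝ × ℝ)) (S : Set ℂ) (b : (ℝ × ℝ) × ℝ → ℂ) : Set ((ℝ × ℝ) × ℂ) :=
  {p | p.1 ∈ U ∧ ∀ s ∈ 𝕀, p.2 - b (p.1, s) ∈ S}

namespace RootSystem

variable {U : Set (ℝ × ℝ)} {S : Set ℂ} {K : ℂ → ℂ} {b R n : (ℝ × ℝ) × ℝ → ℂ}
  (h : RootSystem U S K b R) {x : ℝ × ℝ} {y : ℝ}

include h

theorem isOpen_regularPoints : IsOpen (regularPoints U S b) := by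
  rw [isOpen_iff_mem_nhds]
  rintro ⟨x, z⟩ ⟨hx, hz⟩
  have h1 : ∀ᶠ p : (ℝ × ℝ) × ℂ in 𝓝 (x, z), ∀ s ∈ 𝕀, p.2 - b (p.1, s) ∈ S := by
    refine isCompact_Icc.eventually_forall_of_forall_eventually fun s hs => ?_
    have hc : ContinuousAt (fun q : ((ℝ × ℝ) × ℂ) × ℝ => q.1.2 - b (q.1.1, q.2)) ((x, z), s) := by
      refine ContinuousAt.sub (by fun_prop) ?_
      exact ContinuousAt.comp (g := b) (f := fun q : ((ℝ × ℝ) × ℂ) × ℝ => (q.1.1, q.2))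
        (h.contDiffAt x hx s hs).continuousAt (by fun_prop)
    exact hc (h.isOpen_dom.mem_nhds (hz s hs))
  have h2 : ∀ᶠ p : (ℝ × ℝ) × ℂ in 𝓝 (x, z), p.1 ∈ U :=
    continuousAt_fst (h.isOpen.mem_nhds hx)
  filter_upwards [h1, h2] with p hp1 hp2 using ⟨hp2, hp1⟩

theorem root_mem_regularPoints (hx : x ∈ U) (hy : y ∈ 𝕀) : (x, b (x, y)) ∈ regularPoints U S b :=
  ⟨hx, h.sub_mem x hx y hy⟩

theorem isOpen_regularPoints_slice (x : ℝ × ℝ) : IsOpen {z | (x, z) ∈ regularPoints U S b} :=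
  h.isOpen_regularPoints.preimage (by fun_prop)

theorem continuousOn_potential_integrand {f : ℂ → ℂ} (hf : ContinuousOn f S)
    (hn : IsNullFamily U K b n) :
    ContinuousOn (fun p : ((ℝ × ℝ) × ℂ) × ℝ => f (p.1.2 - b (p.1.1, p.2)) *
      (n (p.1.1, p.2) * tangent b (p.1.1, p.2))) (regularPoints U S b ×ˢ 𝕀) := by
  have hm : MapsTo (fun p : ((ℝ × ℝ) × ℂ) × ℝ => (p.1.1, p.2))
      (regularPoints U S b ×ˢ 𝕀) (U ×ˢ 𝕀) :=
    fun p hp => ⟨hp.1.1, hp.2⟩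
  have hc : ContinuousOn (fun p : ((ℝ × ℝ) × ℂ) × ℝ => (p.1.1, p.2))
      (regularPoints U S b ×ˢ 𝕀) := by
    fun_prop
  have hb := h.continuousOn_root.comp hc hm
  have hn' := hn.continuousOn.comp hc hm
  have ht := h.continuousOn_tangent.comp hc hm
  refine ContinuousOn.mul (hf.comp (ContinuousOn.sub (by fun_prop) hb) fun p hp => ?_) (hn'.mul ht)
  exact hp.1.2 _ hp.2

theorem continuousOn_potential (hn : IsNullFamily U K b n) :
    ContinuousOn (fun p : (ℝ × ℝ) × ℂ => kernelPotential K b n p.1 p.2) (regularPoints U S b) :=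
  continuousOn_const.mul (continuousOn_paramIntegral (by norm_num)
    (h.continuousOn_potential_integrand h.differentiableOn.continuousOn hn))

theorem hasDerivAt_potential (hn : IsNullFamily U K b n) {z : ℂ}
    (hz : (x, z) ∈ regularPoints U S b) :
    HasDerivAt (kernelPotential K b n x) (kernelPotential (deriv K) b n x z) z := by
  refine HasDerivAt.const_mul _ ?_
  have hsl : ∀ {f : ℂ → ℂ}, ContinuousOn f S → ContinuousOn (fun p : ℂ × ℝ => f (p.1 - b (x, p.2)) *
      (n (x, p.2) * tangent b (x, p.2))) ({z | (x, z) ∈ regularPoints U S b} ×ˢ 𝕀) := fun {f} hf =>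
    (h.continuousOn_potential_integrand hf hn).comp (f := fun p : ℂ × ℝ => ((x, p.1), p.2))
      (by fun_prop) fun p hp => ⟨hp.1, hp.2⟩
  refine hasDerivAt_paramIntegral (V := {z | (x, z) ∈ regularPoints U S b})
    (f := fun z s => K (z - b (x, s)) * (n (x, s) * tangent b (x, s)))
    (f' := fun z s => deriv K (z - b (x, s)) * (n (x, s) * tangent b (x, s)))
    (h.isOpen_regularPoints_slice x) (by norm_num) ?_ ?_ ?_ hz
  · intro z hz
    exact (hsl h.differentiableOn.continuousOn).comp (f := fun s => (z, s)) (by fun_prop)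
      fun s hs => ⟨hz, hs⟩
  · exact hsl h.differentiableOn_deriv.continuousOn
  · intro z hz s hs
    exact ((h.hasDerivAt_kernel (hz.2 s hs)).comp_sub_const z (b (x, s))).mul_const _

theorem analyticAt_potential (hn : IsNullFamily U K b n) {z : ℂ}
    (hz : (x, z) ∈ regularPoints U S b) : AnalyticAt ℂ (kernelPotential K b n x) z :=
  DifferentiableOn.analyticAt (s := {z | (x, z) ∈ regularPoints U S b})
    (fun _ hw => (h.hasDerivAt_potential hn hw).differentiableAt.differentiableWithinAt)
    ((h.isOpen_regularPoints_slice x).mem_nhds hz)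

/-- The contour integral of a holomorphic function varies through the endpoints only. -/
theorem hasFDerivAt_contourIntegral (hx : x ∈ U) {f : ℂ → ℂ}
    (hf : ∀ y ∈ 𝕀, AnalyticAt ℂ f (b (x, y))) :
    HasFDerivAt (fun x => ∫ y in (-(1 / 2) : ℝ)..(1 / 2), f (b (x, y)) * tangent b (x, y))
      (f (b (x, 1 / 2)) • (fderiv ℝ b (x, 1 / 2)).comp (ContinuousLinearMap.inl ℝ (ℝ × ℝ) ℝ) -
        f (b (x, -(1 / 2))) •
          (fderiv ℝ b (x, -(1 / 2))).comp (ContinuousLinearMap.inl ℝ (ℝ × ℝ) ℝ)) x := by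
  have hcd : ∀ y ∈ 𝕀, ContDiffAt ℝ 1 (fun p => f (b p) * tangent b p) (x, y) := fun y hy =>
    (ContDiffAt.comp (x, y) ((hf y hy).contDiffAt.restrict_scalars ℝ)
      ((h.contDiffAt x hx y hy).of_le (by norm_num))).mul (h.contDiffAt_tangent hx hy)
  have h0 := hasFDerivAt_paramIntegral_of_contDiffAt (by norm_num) hcd
  refine h0.differentiableAt.hasFDerivAt.congr_fderiv ?_
  refine ContinuousLinearMap.ext fun e => ?_
  rw [fderiv_paramIntegral_apply (f := fun p => f (b p) * tangent b p) (by norm_num) hcd]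
  have hd : ∀ y ∈ 𝕀, HasDerivAt (fun y => f (b (x, y)) * dirDeriv b e (x, y))
      (fderiv ℝ (fun p => f (b p) * tangent b p) (x, y) (e, 0)) y := by
    intro y hy
    have hfy := (hf y hy).differentiableAt.hasDerivAt
    have h1 := hfy.comp_hasFDerivAt (x, y)
      ((h.contDiffAt x hx y hy).differentiableAt (by simp)).hasFDerivAt
    have h2 := (h1.mul ((h.contDiffAt_tangent hx hy).differentiableAt (by simp)).hasFDerivAt).fderiv
    have h3 : fderiv ℝ (fun p => f (b p) * tangent b p) (x, y) (e, 0) =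
        f (b (x, y)) * dirDeriv (tangent b) e (x, y) +
          tangent b (x, y) * (deriv f (b (x, y)) * dirDeriv b e (x, y)) :=
      congrArg (fun L => L (e, (0 : ℝ))) h2
    have h4 := (hfy.comp_of_eq y (h.hasDerivAt_root hx hy) rfl).mul
      (hasDerivAt_slice ((h.contDiffAt_dirDeriv hx hy e).differentiableAt (by simp)))
    refine h4.congr_deriv ?_
    rw [h3, ← h.tangent_dirDeriv hx hy e]
    simp only [tangent, Function.comp_apply]
    ring
  rw [intervalIntegral.integral_eq_sub_of_hasDerivAt
    (f := fun y => f (b (x, y)) * dirDeriv b e (x, y))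
    (fun y hy => hd y (by rwa [uIcc_of_le (by norm_num)] at hy))]
  · simp [dirDeriv]
  · refine intervalIntegrable_half fun y hy => ?_
    have := ((hcd y hy).continuousAt_fderiv (by simp)).clm_apply
      (continuousAt_const (y := ((e, 0) : (ℝ × ℝ) × ℝ)))
    exact (this.comp (f := fun y => (x, y)) (by fun_prop)).continuousWithinAt

/-- Both sides are the double integral of `n(z) K(z - w) n(w)` over `C_x' × C_x`, as `K` is even. -/
theorem potential_symm (hn : IsNullFamily U K b n) {x' : ℝ × ℝ} (hx : x ∈ U) (hx' : x' ∈ U)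
    (hreg : ∀ y ∈ 𝕀, (x, b (x', y)) ∈ regularPoints U S b) :
    ∫ y in (-(1 / 2) : ℝ)..(1 / 2), kernelPotential K b n x' (b (x', y)) *
        kernelPotential K b n x (b (x', y)) * tangent b (x', y) =
      ∫ y in (-(1 / 2) : ℝ)..(1 / 2), kernelPotential K b n x' (b (x, y)) *
        kernelPotential K b n x (b (x, y)) * tangent b (x, y) := by
  set g : ℝ → ℝ → ℂ := fun y s => -(2 * Real.pi : ℂ)⁻¹ * (K (b (x', y) - b (x, s)) *
    ((n (x', y) * tangent b (x', y)) * (n (x, s) * tangent b (x, s)))) with hg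
  have hω : ∀ {w}, w ∈ U → ContinuousOn (fun y => n (w, y) * tangent b (w, y)) 𝕀 := fun hw =>
    (continuousOn_slice hn.continuousOn hw).mul (continuousOn_slice h.continuousOn_tangent hw)
  have hgc : ContinuousOn (fun p : ℝ × ℝ => g p.1 p.2) (𝕀 ×ˢ 𝕀) := by
    refine continuousOn_const.mul (ContinuousOn.mul ?_ (((hω hx').comp continuousOn_fst
      fun p hp => hp.1).mul ((hω hx).comp continuousOn_snd fun p hp => hp.2)))
    refine h.differentiableOn.continuousOn.comp (ContinuousOn.sub
      ((continuousOn_slice h.continuousOn_root hx').comp continuousOn_fst fun p hp => hp.1)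
      ((continuousOn_slice h.continuousOn_root hx).comp continuousOn_snd fun p hp => hp.2)) ?_
    exact fun p hp => (hreg p.1 hp.1).2 p.2 hp.2
  have h1 : ∫ y in (-(1 / 2) : ℝ)..(1 / 2), kernelPotential K b n x' (b (x', y)) *
        kernelPotential K b n x (b (x', y)) * tangent b (x', y) =
      ∫ y in (-(1 / 2) : ℝ)..(1 / 2), ∫ s in (-(1 / 2) : ℝ)..(1 / 2), g y s := by
    refine intervalIntegral.integral_congr fun y hy => ?_
    rw [uIcc_of_le (by norm_num)] at hy
    simp only [hg]
    rw [← hn.eq_potential x' hx' y hy, intervalIntegral.integral_const_mul]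
    have : ∀ s, K (b (x', y) - b (x, s)) *
        ((n (x', y) * tangent b (x', y)) * (n (x, s) * tangent b (x, s))) =
        (n (x', y) * tangent b (x', y)) *
          (K (b (x', y) - b (x, s)) * (n (x, s) * tangent b (x, s))) := fun s => by ring
    simp only [this]
    rw [intervalIntegral.integral_const_mul, kernelPotential]
    ring
  have h2 : ∫ y in (-(1 / 2) : ℝ)..(1 / 2), kernelPotential K b n x' (b (x, y)) *
        kernelPotential K b n x (b (x, y)) * tangent b (x, y) =
      ∫ s in (-(1 / 2) : ℝ)..(1 / 2), ∫ y in (-(1 / 2) : ℝ)..(1 / 2), g y s := by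
    refine intervalIntegral.integral_congr fun s hs => ?_
    rw [uIcc_of_le (by norm_num)] at hs
    simp only [hg]
    rw [← hn.eq_potential x hx s hs, intervalIntegral.integral_const_mul]
    have : ∀ y, K (b (x', y) - b (x, s)) *
        ((n (x', y) * tangent b (x', y)) * (n (x, s) * tangent b (x, s))) =
        (n (x, s) * tangent b (x, s)) *
          (K (b (x, s) - b (x', y)) * (n (x', y) * tangent b (x', y))) := fun y => by
      rw [← neg_sub, h.even]; ring
    simp only [this]
    rw [intervalIntegral.integral_const_mul, kernelPotential]
    ring
  rw [h1, h2, integral_swap_half hgc]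

/-- With `f = N_x N_x'` fixed, the integral of `f dz` has the same value on the contours at `x` and
at `x'` by `potential_symm`, whereas its first variation is `f ∂_e b` at the endpoints. -/
theorem null_endpoint_eq (hn : IsNullFamily U K b n) (hx : x ∈ U) (e : ℝ × ℝ) :
    n (x, 1 / 2) ^ 2 * dirDeriv b e (x, 1 / 2) =
      n (x, -(1 / 2)) ^ 2 * dirDeriv b e (x, -(1 / 2)) := by
  set N := kernelPotential K b n with hN
  set D : ℝ → ℝ × ℝ → (ℝ × ℝ →L[ℝ] ℂ) := fun y x' =>
    (fderiv ℝ b (x', y)).comp (ContinuousLinearMap.inl ℝ (ℝ × ℝ) ℝ) with hD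
  set c : ℝ → (ℝ × ℝ) × (ℝ × ℝ) → (ℝ × ℝ →L[ℝ] ℂ) := fun y q =>
    (N q.1 (b (q.2, y)) * N x (b (q.2, y))) • D y q.2 with hc
  have hbc : ∀ y ∈ 𝕀, ContinuousAt (fun q : (ℝ × ℝ) × (ℝ × ℝ) => b (q.2, y)) (x, x) := fun y hy =>
    ContinuousAt.comp (g := b) (f := fun q : (ℝ × ℝ) × (ℝ × ℝ) => (q.2, y))
      (h.contDiffAt x hx y hy).continuousAt (by fun_prop)
  have hcc : ∀ y ∈ 𝕀, ContinuousAt (c y) (x, x) := by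
    intro y hy
    have hNc := (h.continuousOn_potential hn).continuousAt
      (h.isOpen_regularPoints.mem_nhds (h.root_mem_regularPoints hx hy))
    have h1 : ContinuousAt (fun q : (ℝ × ℝ) × (ℝ × ℝ) => N q.1 (b (q.2, y))) (x, x) :=
      ContinuousAt.comp (g := fun p : (ℝ × ℝ) × ℂ => N p.1 p.2)
        (f := fun q : (ℝ × ℝ) × (ℝ × ℝ) => (q.1, b (q.2, y))) hNc
        (continuousAt_fst.prodMk (hbc y hy))
    have h2 : ContinuousAt (fun q : (ℝ × ℝ) × (ℝ × ℝ) => N x (b (q.2, y))) (x, x) :=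
      ContinuousAt.comp (g := fun p : (ℝ × ℝ) × ℂ => N p.1 p.2)
        (f := fun q : (ℝ × ℝ) × (ℝ × ℝ) => (x, b (q.2, y))) hNc
        (continuousAt_const.prodMk (hbc y hy))
    have h3 : ContinuousAt (fun q : (ℝ × ℝ) × (ℝ × ℝ) => fderiv ℝ b (q.2, y)) (x, x) :=
      ContinuousAt.comp (g := fderiv ℝ b) (f := fun q : (ℝ × ℝ) × (ℝ × ℝ) => (q.2, y))
        ((h.contDiffAt x hx y hy).continuousAt_fderiv (by simp)) (by fun_prop)
    exact (h1.mul h2).smul (h3.clm_comp continuousAt_const)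
  set L : ℝ × ℝ →L[ℝ] ℂ := c (1 / 2) (x, x) - c (-(1 / 2)) (x, x) with hL
  have hLc : ContinuousAt (fun q => c (1 / 2) q - c (-(1 / 2)) q) (x, x) :=
    (hcc _ right_mem).sub (hcc _ left_mem)
  have hreg : ∀ᶠ q : (ℝ × ℝ) × (ℝ × ℝ) in 𝓝 (x, x),
      ∀ y ∈ 𝕀, (q.1, b (q.2, y)) ∈ regularPoints U S b := by
    refine isCompact_Icc.eventually_forall_of_forall_eventually fun y hy => ?_
    have : ContinuousAt (fun q : ((ℝ × ℝ) × (ℝ × ℝ)) × ℝ => (q.1.1, b (q.1.2, q.2)))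
        ((x, x), y) := by
      refine ContinuousAt.prodMk (by fun_prop) ?_
      exact ContinuousAt.comp (g := b) (f := fun q : ((ℝ × ℝ) × (ℝ × ℝ)) × ℝ => (q.1.2, q.2))
        (h.contDiffAt x hx y hy).continuousAt (by fun_prop)
    exact this (h.isOpen_regularPoints.mem_nhds (h.root_mem_regularPoints hx hy))
  have hU : ∀ᶠ q : (ℝ × ℝ) × (ℝ × ℝ) in 𝓝 (x, x), q.1 ∈ U ∧ q.2 ∈ U := by
    exact (h.isOpen.prod h.isOpen).mem_nhds (mk_mem_prod hx hx)
  -- `L` is the first-order change from `x` to `x'` of the contour integral of `N x' * N x`, which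
  -- is zero by `potential_symm`; the error is uniform in `x'` by the mean value inequality
  have hzero : HasFDerivAt (fun _ : ℝ × ℝ => (0 : ℂ)) L x := by
    rw [hasFDerivAt_iff_isLittleO, Asymptotics.isLittleO_iff]
    intro ε hε
    have hb := hLc (Metric.closedBall_mem_nhds _ hε)
    obtain ⟨δ, hδ, hball⟩ := Metric.eventually_nhds_iff_ball.1 (hreg.and (hU.and hb))
    have hin : ∀ x₁ ∈ Metric.ball x δ, ∀ x₂ ∈ Metric.ball x δ, (x₁, x₂) ∈ Metric.ball (x, x) δ :=
      fun x₁ h₁ x₂ h₂ => by rw [← ball_prod_same]; exact ⟨h₁, h₂⟩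
    have hxx := Metric.mem_ball_self hδ (x := x)
    filter_upwards [Metric.ball_mem_nhds x hδ] with x' hx'
    have hder : ∀ w ∈ Metric.ball x δ, HasFDerivWithinAt
        (fun w => ∫ y in (-(1 / 2) : ℝ)..(1 / 2),
          N x' (b (w, y)) * N x (b (w, y)) * tangent b (w, y))
        (c (1 / 2) (x', w) - c (-(1 / 2)) (x', w)) (Metric.ball x δ) w := by
      intro w hw
      have h1 := hball _ (hin x' hx' w hw)
      have h2 := hball _ (hin x hxx w hw)
      refine (h.hasFDerivAt_contourIntegral (f := fun z => N x' z * N x z) h1.2.1.2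
        fun y hy => ?_).hasFDerivWithinAt
      exact (h.analyticAt_potential hn (h1.1 y hy)).mul (h.analyticAt_potential hn (h2.1 y hy))
    have hmv := Convex.norm_image_sub_le_of_norm_hasFDerivWithin_le' (φ := L) (C := ε) hder
      (fun w hw => by
        have := (hball _ (hin x' hx' w hw)).2.2
        rw [← dist_eq_norm]
        exact this) (convex_ball x δ) hxx hx'
    rw [h.potential_symm hn hx (hball _ (hin x' hx' x' hx')).2.1.1
      (hball _ (hin x hxx x' hx')).1, sub_self, zero_sub, norm_neg] at hmv
    rw [sub_self, zero_sub, norm_neg]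
    exact hmv
  have hL0 : L = 0 := hzero.unique (hasFDerivAt_const _ _)
  have h1 := congrArg (fun L : ℝ × ℝ →L[ℝ] ℂ => L e) hL0
  have e1 := hn.eq_potential x hx _ right_mem
  have e2 := hn.eq_potential x hx _ left_mem
  simp only [hL, hc, hN, ← e1, ← e2, hD] at h1
  simp [-one_div] at h1
  unfold dirDeriv
  linear_combination h1

/-- `null_endpoint_eq` for the two coordinate directions is a linear system for the squares of
`n` at the endpoints, with determinant proportional to the one in `shift_det_ne`. -/
theorem null_endpoint_eq_zero (hn : IsNullFamily U K b n) (hx : x ∈ U) :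
    n (x, 1 / 2) = 0 ∧ n (x, -(1 / 2)) = 0 := by
  have h1 := h.null_endpoint_eq hn hx (0, 1)
  have h2 := h.null_endpoint_eq hn hx (1, 0)
  have hq : (x.1 : ℂ) ≠ 0 := by exact_mod_cast (h.pos x hx).ne'
  have ht := h.tangent_ne x hx _ right_mem
  have hdet := h.shift_det_ne hx
  have hm1 := h.mul_dirDeriv_eq hx right_mem (0, 1)
  have hm2 := h.mul_dirDeriv_eq hx right_mem (1, 0)
  have hm3 := h.mul_dirDeriv_eq hx left_mem (0, 1)
  have hm4 := h.mul_dirDeriv_eq hx left_mem (1, 0)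
  rw [h.shift_neg hx right_mem, h.tangent_neg hx right_mem] at hm3 hm4
  set f := shift b (0, 1) (x, 1 / 2)
  set g := shift b (1, 0) (x, 1 / 2)
  set t := tangent b (x, 1 / 2)
  have ht' : (starRingEnd ℂ) t ≠ 0 := by simpa using ht
  have e1 : n (x, 1 / 2) ^ 2 * (f * t) =
      -(n (x, -(1 / 2)) ^ 2 * (starRingEnd ℂ f * starRingEnd ℂ t)) := by
    linear_combination x.1 * h1 - n (x, 1 / 2) ^ 2 * hm1 + n (x, -(1 / 2)) ^ 2 * hm3
  have e2 : n (x, 1 / 2) ^ 2 * (g * t) =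
      -(n (x, -(1 / 2)) ^ 2 * (starRingEnd ℂ g * starRingEnd ℂ t)) := by
    linear_combination x.1 * h2 - n (x, 1 / 2) ^ 2 * hm2 + n (x, -(1 / 2)) ^ 2 * hm4
  have hΔ : starRingEnd ℂ f * g - f * starRingEnd ℂ g ≠ 0 := by
    intro h0
    apply hdet
    have := congrArg Complex.im h0
    simp at this ⊢
    linarith
  constructor
  · have : n (x, 1 / 2) ^ 2 * (t * (starRingEnd ℂ f * g - f * starRingEnd ℂ g)) = 0 := by
      linear_combination starRingEnd ℂ f * e2 - starRingEnd ℂ g * e1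
    simpa [ht, hΔ] using this
  · have : n (x, -(1 / 2)) ^ 2 *
        (starRingEnd ℂ t * (starRingEnd ℂ f * g - f * starRingEnd ℂ g)) = 0 := by
      linear_combination g * e1 - f * e2
    simpa [ht', hΔ] using this

/-- Integration by parts: the endpoint terms vanish by `null_endpoint_eq_zero`. -/
theorem potential_deriv (hn : IsNullFamily U K b n) {z : ℂ} (hz : (x, z) ∈ regularPoints U S b) :
    kernelPotential K b (fun p => deriv (kernelPotential K b n p.1) (b p)) x z =
      deriv (kernelPotential K b n x) z := by
  have hx := hz.1
  rw [(h.hasDerivAt_potential hn hz).deriv, kernelPotential, kernelPotential]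
  congr 1
  have hd : ∀ s ∈ 𝕀, HasDerivAt (fun s => K (z - b (x, s)) * kernelPotential K b n x (b (x, s)))
      (K (z - b (x, s)) * (deriv (kernelPotential K b n x) (b (x, s)) * tangent b (x, s)) -
        deriv K (z - b (x, s)) * (n (x, s) * tangent b (x, s))) s := by
    intro s hs
    have hb := h.hasDerivAt_root hx hs
    have h1 := (h.hasDerivAt_kernel (hz.2 s hs)).comp s (hb.const_sub z)
    have h2 := (h.hasDerivAt_potential hn (h.root_mem_regularPoints hx
      hs)).differentiableAt.hasDerivAt.comp s hb
    refine (h1.mul h2).congr_deriv ?_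
    simp only [Function.comp_apply]
    rw [← hn.eq_potential x hx s hs]
    ring
  have hb := continuousOn_slice h.continuousOn_root hx
  have hK : ∀ {f : ℂ → ℂ}, ContinuousOn f S → ContinuousOn (fun s => f (z - b (x, s))) 𝕀 :=
    fun hf => hf.comp (continuousOn_const.sub hb) fun s hs => hz.2 s hs
  have hω := (continuousOn_slice hn.continuousOn hx).mul
    (continuousOn_slice h.continuousOn_tangent hx)
  have hN' : ContinuousOn (fun s => deriv (kernelPotential K b n x) (b (x, s))) 𝕀 := fun s hs =>
    ((h.analyticAt_potential hn
      (h.root_mem_regularPoints hx hs)).deriv.continuousAt.comp_continuousWithinAt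
      (f := fun s => b (x, s)) (hb s hs))
  have i1 : IntervalIntegrable (fun s => K (z - b (x, s)) *
      (deriv (kernelPotential K b n x) (b (x, s)) * tangent b (x, s))) volume (-(1 / 2)) (1 / 2) :=
    intervalIntegrable_half ((hK h.differentiableOn.continuousOn).mul
      (hN'.mul (continuousOn_slice h.continuousOn_tangent hx)))
  have i2 : IntervalIntegrable (fun s => deriv K (z - b (x, s)) *
      (n (x, s) * tangent b (x, s))) volume (-(1 / 2)) (1 / 2) :=
    intervalIntegrable_half ((hK h.differentiableOn_deriv.continuousOn).mul hω)
  have hI := intervalIntegral.integral_eq_sub_of_hasDerivAt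
    (fun s hs => hd s (by rwa [uIcc_of_le (by norm_num)] at hs)) (i1.sub i2)
  rw [intervalIntegral.integral_sub i1 i2, ← hn.eq_potential x hx _ right_mem,
    ← hn.eq_potential x hx _ left_mem, (h.null_endpoint_eq_zero hn hx).1,
    (h.null_endpoint_eq_zero hn hx).2] at hI
  simp only [mul_zero, sub_zero] at hI
  exact sub_eq_zero.1 hI

/-- The derivative along the contour of a solution of the homogeneous equation is a solution. -/
theorem isNullFamily_deriv (hn : IsNullFamily U K b n) :
    IsNullFamily U K b (fun p => deriv (kernelPotential K b n p.1) (b p)) where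
  continuousOn := by
    have h1 : ContinuousOn (fun p : (ℝ × ℝ) × ℂ => kernelPotential (deriv K) b n p.1 p.2)
        (regularPoints U S b) :=
      continuousOn_const.mul (continuousOn_paramIntegral (by norm_num)
        (h.continuousOn_potential_integrand h.differentiableOn_deriv.continuousOn hn))
    have h2 := h1.comp (f := fun p : (ℝ × ℝ) × ℝ => (p.1, b p)) (s := U ×ˢ 𝕀)
      (continuousOn_fst.prodMk h.continuousOn_root)
      fun p hp => h.root_mem_regularPoints hp.1 hp.2
    exact h2.congr fun p hp =>
      (h.hasDerivAt_potential hn (h.root_mem_regularPoints hp.1 hp.2)).deriv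
  eq_potential x hx y hy := (h.potential_deriv hn (h.root_mem_regularPoints hx hy)).symm

theorem iteratedDeriv_potential (k : ℕ) (hn : IsNullFamily U K b n) (hx : x ∈ U) :
    iteratedDeriv k (kernelPotential K b n x) (b (x, 1 / 2)) = 0 := by
  induction k generalizing n with
  | zero =>
    rw [iteratedDeriv_zero, ← hn.eq_potential x hx _ right_mem, (h.null_endpoint_eq_zero hn hx).1]
  | succ k ih =>
    rw [iteratedDeriv_succ', ← ih (h.isNullFamily_deriv hn)]
    refine Filter.EventuallyEq.iteratedDeriv_eq k ?_
    filter_upwards [(h.isOpen_regularPoints_slice x).mem_nhds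
      (h.root_mem_regularPoints hx right_mem)] with z hz
    exact (h.potential_deriv hn hz).symm

/-- The homogeneous equation has no nonzero solution that is continuous in `x`: the potential has a
zero of infinite order at an endpoint. -/
theorem null_eq_zero (hn : IsNullFamily U K b n) (hx : x ∈ U) (hy : y ∈ 𝕀) : n (x, y) = 0 := by
  rw [hn.eq_potential x hx y hy]
  have han : AnalyticOnNhd ℂ (kernelPotential K b n x) ((fun y => b (x, y)) '' 𝕀) := by
    rintro _ ⟨y, hy, rfl⟩
    exact h.analyticAt_potential hn (h.root_mem_regularPoints hx hy)
  refine han.eqOn_zero_of_preconnected_of_eventuallyEq_zero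
    (isPreconnected_Icc.image _ (continuousOn_slice h.continuousOn_root hx))
    (mem_image_of_mem _ right_mem) ?_ (mem_image_of_mem _ hy)
  refine analyticOrderAt_eq_top.1 (ENat.eq_top_iff_forall_ge.2 fun m => ?_)
  exact (natCast_le_analyticOrderAt_iff_iteratedDeriv_eq_zero
    (han _ (mem_image_of_mem _ right_mem))).2 fun i _ => h.iteratedDeriv_potential i hn hx

end RootSystem

/-! ### First and second variations of contour integrals -/

namespace RootSystem

variable {U : Set (ℝ × ℝ)} {S : Set ℂ} {K : ℂ → ℂ} {b R : (ℝ × ℝ) × ℝ → ℂ}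
  (h : RootSystem U S K b R) {x : ℝ × ℝ} {y : ℝ}

include h

/-- The derivative of `F_e ∂_y b = q ∂_e b` in the direction `e`. -/
theorem dirDeriv_shift_mul (hx : x ∈ U) (hy : y ∈ 𝕀) (e : ℝ × ℝ) :
    dirDeriv (shift b e) e (x, y) * tangent b (x, y) +
      shift b e (x, y) * tangent (dirDeriv b e) (x, y) =
    e.1 * dirDeriv b e (x, y) + x.1 * dirDeriv (dirDeriv b e) e (x, y) := by
  have hF := ((h.contDiffAt_shift hx hy e).differentiableAt (by simp)).hasFDerivAt
  have ht := ((h.contDiffAt_tangent hx hy).differentiableAt (by simp)).hasFDerivAt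
  have hd := ((h.contDiffAt_dirDeriv hx hy e).differentiableAt (by simp)).hasFDerivAt
  have hq : HasFDerivAt (fun p : (ℝ × ℝ) × ℝ => (p.1.1 : ℂ)) (Complex.ofRealCLM.comp
      ((ContinuousLinearMap.fst ℝ _ _).comp (ContinuousLinearMap.fst ℝ _ _))) (x, y) :=
    (Complex.ofRealCLM.comp
      ((ContinuousLinearMap.fst ℝ _ _).comp (ContinuousLinearMap.fst ℝ (ℝ × ℝ) ℝ))).hasFDerivAt
  have hL := (hF.mul ht).sub (hq.mul hd)
  have h0 := fderiv_apply_eq_zero_of_eqOn h.isOpen (a := -(1 / 2)) (b := 1 / 2) (by norm_num)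
    (fun x hx y hy => by exact sub_eq_zero.2 (h.mul_dirDeriv_eq hx hy e).symm) hx hy
    hL.differentiableAt (e, 0)
  rw [hL.fderiv] at h0
  simp at h0
  rw [h.tangent_dirDeriv hx hy e]
  unfold dirDeriv at h0 ⊢
  linear_combination h0

theorem continuousOn_firstDensity (e : ℝ × ℝ) : ContinuousOn (firstDensity b e) (U ×ˢ 𝕀) :=
  ((h.continuousOn_tangent_shift e).sub continuousOn_const).neg.div h.continuousOn_tangent
    fun p hp => h.tangent_ne p.1 hp.1 p.2 hp.2

theorem continuousOn_secondDensity (e : ℝ × ℝ) : ContinuousOn (secondDensity b e) (U ×ˢ 𝕀) := by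
  have ht : ∀ p ∈ U ×ˢ 𝕀, tangent b p ≠ 0 := fun p hp => h.tangent_ne p.1 hp.1 p.2 hp.2
  have hd := h.continuousOn_dirDeriv e
  exact ((h.continuousOn_dirDeriv_shift e).add
    ((continuousOn_const.mul hd).div h.continuousOn_tangent ht)).sub
    ((hd.div h.continuousOn_tangent ht).mul (h.continuousOn_tangent_shift e))

theorem continuousOn_comp_root (hx : x ∈ U) {χ : ℂ → ℂ}
    (hχ : ∀ y ∈ 𝕀, AnalyticAt ℂ χ (b (x, y))) : ContinuousOn (fun y => χ (b (x, y))) 𝕀 :=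
  fun y hy => (hχ y hy).continuousAt.comp_continuousWithinAt (f := fun y => b (x, y))
    (continuousOn_slice h.continuousOn_root hx y hy)

/-- Integration by parts, using `q ∂_e b = F_e ∂_y b`. -/
theorem firstVar_eq (hx : x ∈ U) (e : ℝ × ℝ) {χ : ℂ → ℂ}
    (hχ : ∀ y ∈ 𝕀, AnalyticAt ℂ χ (b (x, y))) :
    firstVar b e x χ = χ (b (x, 1 / 2)) * shift b e (x, 1 / 2) -
      χ (b (x, -(1 / 2))) * shift b e (x, -(1 / 2)) +
      ∫ y in (-(1 / 2) : ℝ)..(1 / 2),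
        χ (b (x, y)) * (firstDensity b e (x, y) * tangent b (x, y)) := by
  have hc := h.continuousOn_comp_root hx hχ
  have hc' := h.continuousOn_comp_root hx (fun y hy => (hχ y hy).deriv)
  have hd := continuousOn_slice (h.continuousOn_dirDeriv e) hx
  have ht := continuousOn_slice h.continuousOn_tangent hx
  have hF' := continuousOn_slice (h.continuousOn_tangent_shift e) hx
  have hw := continuousOn_slice (h.continuousOn_firstDensity e) hx
  have hder : ∀ y ∈ 𝕀, HasDerivAt (fun y => χ (b (x, y)) * shift b e (x, y))
      (x.1 * (deriv χ (b (x, y)) * dirDeriv b e (x, y)) + χ (b (x, y)) * tangent (shift b e) (x, y))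
      y := by
    intro y hy
    have h1 := (hχ y hy).differentiableAt.hasDerivAt.comp y (h.hasDerivAt_root hx hy)
    refine (h1.mul (h.hasDerivAt_shift hx hy e)).congr_deriv ?_
    simp only [Function.comp_apply]
    linear_combination -deriv χ (b (x, y)) * h.mul_dirDeriv_eq hx hy e
  have i1 : IntervalIntegrable (fun y => x.1 * (deriv χ (b (x, y)) * dirDeriv b e (x, y)) +
      χ (b (x, y)) * tangent (shift b e) (x, y)) volume (-(1 / 2)) (1 / 2) :=
    intervalIntegrable_half ((continuousOn_const.mul (hc'.mul hd)).add (hc.mul hF'))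
  have i2 : IntervalIntegrable (fun y => χ (b (x, y)) *
      (firstDensity b e (x, y) * tangent b (x, y))) volume (-(1 / 2)) (1 / 2) :=
    intervalIntegrable_half (hc.mul (hw.mul ht))
  rw [← intervalIntegral.integral_eq_sub_of_hasDerivAt
    (fun y hy => hder y (by rwa [uIcc_of_le (by norm_num)] at hy)) i1,
    ← intervalIntegral.integral_add i1 i2]
  refine intervalIntegral.integral_congr fun y hy => ?_
  rw [uIcc_of_le (by norm_num)] at hy
  simp only [firstDensity]
  rw [div_mul_cancel₀ _ (h.tangent_ne x hx y hy)]
  ring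

theorem secondVar_eq (hx : x ∈ U) (e : ℝ × ℝ) {χ : ℂ → ℂ}
    (hχ : ∀ y ∈ 𝕀, AnalyticAt ℂ χ (b (x, y))) :
    secondVar b e x χ =
      χ (b (x, 1 / 2)) * (shift b e (x, 1 / 2) * dirDeriv b e (x, 1 / 2)) -
      χ (b (x, -(1 / 2))) * (shift b e (x, -(1 / 2)) * dirDeriv b e (x, -(1 / 2))) +
      ∫ y in (-(1 / 2) : ℝ)..(1 / 2),
        χ (b (x, y)) * (secondDensity b e (x, y) * tangent b (x, y)) := by
  have hc := h.continuousOn_comp_root hx hχ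
  have hc' := h.continuousOn_comp_root hx (fun y hy => (hχ y hy).deriv)
  have hd := continuousOn_slice (h.continuousOn_dirDeriv e) hx
  have hdt := continuousOn_slice (continuousOn_fderiv_apply
    (fun _ hx _ hy => h.contDiffAt_dirDeriv hx hy e) ((0, 1) : (ℝ × ℝ) × ℝ)) hx
  have ht := continuousOn_slice h.continuousOn_tangent hx
  have hF := continuousOn_slice (h.continuousOn_shift e) hx
  have hF' := continuousOn_slice (h.continuousOn_tangent_shift e) hx
  have hw := continuousOn_slice (h.continuousOn_secondDensity e) hx
  have hder : ∀ y ∈ 𝕀, HasDerivAt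
      (fun y => χ (b (x, y)) * (shift b e (x, y) * dirDeriv b e (x, y)))
      (x.1 * (deriv χ (b (x, y)) * dirDeriv b e (x, y) ^ 2) + χ (b (x, y)) *
        (tangent (shift b e) (x, y) * dirDeriv b e (x, y) +
          shift b e (x, y) * tangent (dirDeriv b e) (x, y))) y := by
    intro y hy
    have h1 := (hχ y hy).differentiableAt.hasDerivAt.comp y (h.hasDerivAt_root hx hy)
    have h2 := hasDerivAt_slice ((h.contDiffAt_dirDeriv hx hy e).differentiableAt (by simp))
    refine (h1.mul ((h.hasDerivAt_shift hx hy e).mul h2)).congr_deriv ?_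
    simp only [Function.comp_apply]
    change _ * (shift b e (x, y) * dirDeriv b e (x, y)) + _ * (_ + shift b e (x, y) *
      tangent (dirDeriv b e) (x, y)) = _
    linear_combination -deriv χ (b (x, y)) * dirDeriv b e (x, y) * h.mul_dirDeriv_eq hx hy e
  have i1 : IntervalIntegrable (fun y => x.1 * (deriv χ (b (x, y)) * dirDeriv b e (x, y) ^ 2) +
      χ (b (x, y)) * (tangent (shift b e) (x, y) * dirDeriv b e (x, y) +
          shift b e (x, y) * tangent (dirDeriv b e) (x, y))) volume (-(1 / 2)) (1 / 2) :=
    intervalIntegrable_half ((continuousOn_const.mul (hc'.mul (hd.pow 2))).add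
      (hc.mul ((hF'.mul hd).add (hF.mul hdt))))
  have i2 : IntervalIntegrable (fun y => χ (b (x, y)) *
      (secondDensity b e (x, y) * tangent b (x, y))) volume (-(1 / 2)) (1 / 2) :=
    intervalIntegrable_half (hc.mul (hw.mul ht))
  rw [← intervalIntegral.integral_eq_sub_of_hasDerivAt
    (fun y hy => hder y (by rwa [uIcc_of_le (by norm_num)] at hy)) i1,
    ← intervalIntegral.integral_add i1 i2]
  refine intervalIntegral.integral_congr fun y hy => ?_
  rw [uIcc_of_le (by norm_num)] at hy
  have hb := h.tangent_ne x hx y hy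
  have hs : secondDensity b e (x, y) * tangent b (x, y) =
      dirDeriv (shift b e) e (x, y) * tangent b (x, y) + e.1 * dirDeriv b e (x, y) -
        dirDeriv b e (x, y) * tangent (shift b e) (x, y) := by
    unfold secondDensity
    field_simp
  simp only [hs]
  linear_combination -χ (b (x, y)) * h.dirDeriv_shift_mul hx hy e

omit h in
/-- The combination of a second variation `T₂` and the first variations `T₁`, `T₀` in the directions
`(0, 1)` and `(1, 0)` in which the contributions of both endpoints cancel. It is the determinant
whose columns are `(T₂, T₁, T₀)` and the values of `(F_e ∂_e b, F_(0,1), F_(1,0))` at `1/2` and at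
`-1/2`. -/
def defect (b : (ℝ × ℝ) × ℝ → ℂ) (e : ℝ × ℝ) (x : ℝ × ℝ) (T₂ T₁ T₀ : ℂ) : ℂ :=
  (shift b (0, 1) (x, 1 / 2) * shift b (1, 0) (x, -(1 / 2)) -
    shift b (0, 1) (x, -(1 / 2)) * shift b (1, 0) (x, 1 / 2)) * T₂ -
  (shift b e (x, 1 / 2) * dirDeriv b e (x, 1 / 2) * shift b (1, 0) (x, -(1 / 2)) -
    shift b e (x, -(1 / 2)) * dirDeriv b e (x, -(1 / 2)) * shift b (1, 0) (x, 1 / 2)) * T₁ -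
  (shift b (0, 1) (x, 1 / 2) * (shift b e (x, -(1 / 2)) * dirDeriv b e (x, -(1 / 2))) -
    shift b (0, 1) (x, -(1 / 2)) * (shift b e (x, 1 / 2) * dirDeriv b e (x, 1 / 2))) * T₀

/-- The defect of the variations has no endpoint contributions. -/
theorem defect_var (hx : x ∈ U) (e : ℝ × ℝ) {χ : ℂ → ℂ}
    (hχ : ∀ y ∈ 𝕀, AnalyticAt ℂ χ (b (x, y))) :
    defect b e x (secondVar b e x χ) (firstVar b (0, 1) x χ) (firstVar b (1, 0) x χ) =
    ∫ y in (-(1 / 2) : ℝ)..(1 / 2), χ (b (x, y)) * (defect b e x (secondDensity b e (x, y))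
      (firstDensity b (0, 1) (x, y)) (firstDensity b (1, 0) (x, y)) * tangent b (x, y)) := by
  have hc := h.continuousOn_comp_root hx hχ
  have ht := continuousOn_slice h.continuousOn_tangent hx
  have i2 : IntervalIntegrable (fun y => χ (b (x, y)) *
      (secondDensity b e (x, y) * tangent b (x, y))) volume (-(1 / 2)) (1 / 2) :=
    intervalIntegrable_half (hc.mul
      ((continuousOn_slice (h.continuousOn_secondDensity e) hx).mul ht))
  have i1 : ∀ e, IntervalIntegrable (fun y => χ (b (x, y)) *
      (firstDensity b e (x, y) * tangent b (x, y))) volume (-(1 / 2)) (1 / 2) := fun e =>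
    intervalIntegrable_half (hc.mul
      ((continuousOn_slice (h.continuousOn_firstDensity e) hx).mul ht))
  -- a determinant with two equal columns vanishes: the endpoint contributions cancel
  obtain ⟨A, B, C, hABC, hr, hl⟩ : ∃ A B C : ℂ,
      (∀ T₂ T₁ T₀, defect b e x T₂ T₁ T₀ = A * T₂ - B * T₁ - C * T₀) ∧
      A * (shift b e (x, 1 / 2) * dirDeriv b e (x, 1 / 2)) =
        B * shift b (0, 1) (x, 1 / 2) + C * shift b (1, 0) (x, 1 / 2) ∧
      A * (shift b e (x, -(1 / 2)) * dirDeriv b e (x, -(1 / 2))) =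
        B * shift b (0, 1) (x, -(1 / 2)) + C * shift b (1, 0) (x, -(1 / 2)) :=
    ⟨_, _, _, fun _ _ _ => rfl, by ring, by ring⟩
  rw [hABC, h.secondVar_eq hx e hχ, h.firstVar_eq hx (0, 1) hχ, h.firstVar_eq hx (1, 0) hχ]
  have hint : ∫ y in (-(1 / 2) : ℝ)..(1 / 2), χ (b (x, y)) * (defect b e x
      (secondDensity b e (x, y)) (firstDensity b (0, 1) (x, y)) (firstDensity b (1, 0) (x, y)) *
        tangent b (x, y)) =
      A * (∫ y in (-(1 / 2) : ℝ)..(1 / 2),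
        χ (b (x, y)) * (secondDensity b e (x, y) * tangent b (x, y))) -
      B * (∫ y in (-(1 / 2) : ℝ)..(1 / 2),
        χ (b (x, y)) * (firstDensity b (0, 1) (x, y) * tangent b (x, y))) -
      C * ∫ y in (-(1 / 2) : ℝ)..(1 / 2),
        χ (b (x, y)) * (firstDensity b (1, 0) (x, y) * tangent b (x, y)) := by
    rw [← intervalIntegral.integral_const_mul, ← intervalIntegral.integral_const_mul,
      ← intervalIntegral.integral_const_mul,
      ← intervalIntegral.integral_sub (i2.const_mul A) ((i1 _).const_mul B),
      ← intervalIntegral.integral_sub ((i2.const_mul A).sub ((i1 _).const_mul B))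
        ((i1 _).const_mul C)]
    refine intervalIntegral.integral_congr fun y _ => ?_
    simp only [hABC]
    ring
  rw [hint]
  linear_combination χ (b (x, 1 / 2)) * hr - χ (b (x, -(1 / 2))) * hl

theorem isNullFamily_defect (e : ℝ × ℝ) : IsNullFamily U K b fun p =>
    defect b e p.1 (secondDensity b e p) (firstDensity b (0, 1) p) (firstDensity b (1, 0) p) where
  continuousOn := by
    have hm : ∀ y ∈ 𝕀, MapsTo (fun p : (ℝ × ℝ) × ℝ => (p.1, y)) (U ×ˢ 𝕀) (U ×ˢ 𝕀) :=
      fun y hy p hp => ⟨hp.1, hy⟩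
    have hF : ∀ e, ∀ y ∈ 𝕀, ContinuousOn (fun p => shift b e (p.1, y)) (U ×ˢ 𝕀) := fun e y hy =>
      (h.continuousOn_shift e).comp (f := fun p : (ℝ × ℝ) × ℝ => (p.1, y)) (by fun_prop) (hm y hy)
    have hd : ∀ y ∈ 𝕀, ContinuousOn (fun p => dirDeriv b e (p.1, y)) (U ×ˢ 𝕀) := fun y hy =>
      (h.continuousOn_dirDeriv e).comp (f := fun p : (ℝ × ℝ) × ℝ => (p.1, y)) (by fun_prop)
        (hm y hy)
    have hl := left_mem
    have hr := right_mem
    exact (((((hF _ _ hr).mul (hF _ _ hl)).sub ((hF _ _ hl).mul (hF _ _ hr))).mul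
      (h.continuousOn_secondDensity e)).sub ((((((hF _ _ hr).mul (hd _ hr)).mul (hF _ _ hl)).sub
      (((hF _ _ hl).mul (hd _ hl)).mul (hF _ _ hr)))).mul (h.continuousOn_firstDensity _))).sub
      ((((hF _ _ hr).mul ((hF _ _ hl).mul (hd _ hl))).sub
        ((hF _ _ hl).mul ((hF _ _ hr).mul (hd _ hr)))).mul (h.continuousOn_firstDensity _))
  eq_potential x hx y hy := by
    -- the test function `w ↦ K (b (x, y) - w)` turns `defect_var` into the homogeneous equation
    have hχ : ∀ s ∈ 𝕀, AnalyticAt ℂ (fun w => K (b (x, y) - w)) (b (x, s)) := fun s hs =>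
      AnalyticAt.comp (g := K) (f := fun w => b (x, y) - w)
        (h.differentiableOn.analyticAt (h.isOpen_dom.mem_nhds (h.sub_mem x hx y hy s hs)))
        (analyticAt_const.sub analyticAt_id)
    have h0 := h.defect_var hx e hχ
    have h2 := h.secondDensity_eq hx hy e
    have h1 := h.firstDensity_eq hx hy (0, 1)
    have h1' := h.firstDensity_eq hx hy (1, 0)
    rw [kernelPotential]
    simp only
    rw [← h0]
    have hpi : (2 * Real.pi : ℂ) ≠ 0 := by simp [Real.pi_ne_zero]
    rw [neg_mul, eq_neg_iff_add_eq_zero, ← mul_right_inj' hpi, mul_add,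
      mul_inv_cancel_left₀ hpi, mul_zero]
    unfold defect
    linear_combination (shift b (0, 1) (x, 1 / 2) * shift b (1, 0) (x, -(1 / 2)) -
      shift b (0, 1) (x, -(1 / 2)) * shift b (1, 0) (x, 1 / 2)) * h2 -
      (shift b e (x, 1 / 2) * dirDeriv b e (x, 1 / 2) * shift b (1, 0) (x, -(1 / 2)) -
      shift b e (x, -(1 / 2)) * dirDeriv b e (x, -(1 / 2)) * shift b (1, 0) (x, 1 / 2)) * h1 -
      (shift b (0, 1) (x, 1 / 2) * (shift b e (x, -(1 / 2)) * dirDeriv b e (x, -(1 / 2))) -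
      shift b (0, 1) (x, -(1 / 2)) * (shift b e (x, 1 / 2) * dirDeriv b e (x, 1 / 2))) * h1'

/-- The second variation is a combination of the two first variations, with coefficients that are
the same for all test functions `χ`. -/
theorem defect_var_eq_zero (hx : x ∈ U) (e : ℝ × ℝ) {χ : ℂ → ℂ}
    (hχ : ∀ y ∈ 𝕀, AnalyticAt ℂ χ (b (x, y))) :
    defect b e x (secondVar b e x χ) (firstVar b (0, 1) x χ) (firstVar b (1, 0) x χ) = 0 := by
  rw [h.defect_var hx e hχ, intervalIntegral.integral_congr (g := fun _ => 0)]
  · simp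
  · intro y hy
    rw [uIcc_of_le (by norm_num)] at hy
    have := h.null_eq_zero (h.isNullFamily_defect e) hx hy
    simp only at this
    simp [this]

/-- The imaginary part of `defect = 0`, the left endpoint being the reflection of the right one. -/
theorem re_secondVar (hx : x ∈ U) (e : ℝ × ℝ) {χ : ℂ → ℂ}
    (hχ : ∀ y ∈ 𝕀, AnalyticAt ℂ χ (b (x, y))) :
    ((starRingEnd ℂ) (shift b (0, 1) (x, 1 / 2)) * shift b (1, 0) (x, 1 / 2)).im *
      (secondVar b e x χ).re =
    (shift b e (x, 1 / 2) * dirDeriv b e (x, 1 / 2) *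
      (starRingEnd ℂ) (shift b (1, 0) (x, 1 / 2))).re * (Complex.I * firstVar b (0, 1) x χ).re -
    (shift b e (x, 1 / 2) * dirDeriv b e (x, 1 / 2) *
      (starRingEnd ℂ) (shift b (0, 1) (x, 1 / 2))).re * (Complex.I * firstVar b (1, 0) x χ).re := by
  have h0 := h.defect_var_eq_zero hx e hχ
  unfold defect at h0
  simp only [h.shift_neg hx right_mem, h.dirDeriv_neg hx right_mem] at h0
  set f := shift b (0, 1) (x, 1 / 2)
  set g := shift b (1, 0) (x, 1 / 2)
  set k := shift b e (x, 1 / 2)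
  set d := dirDeriv b e (x, 1 / 2)
  have := congrArg Complex.im h0
  simp at this ⊢
  linear_combination this / 2

end RootSystem

/-! ### Linear relations between the variations -/

namespace RootSystem

variable {U : Set (ℝ × ℝ)} {S : Set ℂ} {K : ℂ → ℂ} {b R : (ℝ × ℝ) × ℝ → ℂ}
  (h : RootSystem U S K b R) {x : ℝ × ℝ} {y : ℝ}

include h

/-- The three second variations as combinations of the two first ones. The relations of
`shift_relations` provide a real `κ` with `F_(0,1) = i κ F_(1,0)` at the right endpoint, which
yields the common shape of the coefficients. -/
theorem exists_hessian_relations (hx : x ∈ U) : ∃ m₁ m₂ κ : ℝ, ∀ χ : ℂ → ℂ,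
    (∀ y ∈ 𝕀, AnalyticAt ℂ χ (b (x, y))) →
    (secondVar b (1, 0) x χ).re = m₁ * (Complex.I * firstVar b (0, 1) x χ).re +
      m₂ * (Complex.I * firstVar b (1, 0) x χ).re ∧
    (secondVar b (0, 1) x χ).re = -κ ^ 2 * (m₁ * (Complex.I * firstVar b (0, 1) x χ).re +
      m₂ * (Complex.I * firstVar b (1, 0) x χ).re) ∧
    (secondVar b (1, 1) x χ).re = (secondVar b (1, 0) x χ).re + (secondVar b (0, 1) x χ).re +
      2 * (m₂ * (Complex.I * firstVar b (0, 1) x χ).re -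
        κ ^ 2 * m₁ * (Complex.I * firstVar b (1, 0) x χ).re) := by
  have hd := h.shift_det_ne hx
  obtain ⟨h1, h2, h3⟩ := h.shift_relations hx
  have hq : (x.1 : ℂ) ≠ 0 := by exact_mod_cast (h.pos x hx).ne'
  have hdir : ∀ e, dirDeriv b e (x, 1 / 2) =
      shift b e (x, 1 / 2) * (tangent b (x, 1 / 2) / x.1) := fun e => by
    rw [mul_div_assoc', eq_div_iff hq, ← h.mul_dirDeriv_eq hx right_mem e, mul_comm]
  have hadd : shift b (1, 1) (x, 1 / 2) =
      shift b (1, 0) (x, 1 / 2) + shift b (0, 1) (x, 1 / 2) := by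
    rw [← shift_add]; simp
  have key := fun (e : ℝ × ℝ) (χ : ℂ → ℂ) (hχ : ∀ y ∈ 𝕀, AnalyticAt ℂ χ (b (x, y))) =>
    h.re_secondVar hx e hχ
  simp only [hdir] at key
  have k1 := fun χ hχ => key (1, 0) χ hχ
  have k2 := fun χ hχ => key (0, 1) χ hχ
  have k3 := fun χ hχ => key (1, 1) χ hχ
  simp only [hadd] at k3
  clear key hadd hdir
  set f := shift b (0, 1) (x, 1 / 2)
  set g := shift b (1, 0) (x, 1 / 2)
  set a := tangent b (x, 1 / 2) / x.1
  obtain ⟨κ, hκ₁, hκ₂⟩ : ∃ κ : ℝ, f.re = -κ * g.im ∧ f.im = κ * g.re := by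
    rcases mul_eq_zero.1 h1 with hf | hf <;> rcases mul_eq_zero.1 h2 with hg | hg <;>
      simp only [hf, hg, zero_mul, mul_zero, zero_add, add_zero, ne_eq, not_true_eq_false,
        mul_eq_zero, not_or] at h3
    · exact ⟨f.im / g.re, by simp [hf, hg], by field_simp [h3.2]⟩
    · exact ⟨-f.re / g.im, by field_simp [h3.2], by simp [hf, hg]⟩
  set d := ((starRingEnd ℂ) f * g).im with hdd
  refine ⟨(g * (g * a) * (starRingEnd ℂ) g).re / d, -(g * (g * a) * (starRingEnd ℂ) f).re / d, κ,
    fun χ hχ => ?_⟩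
  specialize k1 χ hχ
  specialize k2 χ hχ
  specialize k3 χ hχ
  set P := (Complex.I * firstVar b (0, 1) x χ).re
  set Q := (Complex.I * firstVar b (1, 0) x χ).re
  have gen : ∀ A B : ℝ, d * (A / d * P + -B / d * Q) = A * P - B * Q := fun A B => by
    field_simp; ring
  have gen' : ∀ A B : ℝ, d * (-B / d * P - κ ^ 2 * (A / d) * Q) = -B * P - κ ^ 2 * A * Q :=
    fun A B => by field_simp
  refine ⟨mul_left_cancel₀ hd ?_, mul_left_cancel₀ hd ?_, mul_left_cancel₀ hd ?_⟩
  · rw [k1, gen]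
  · rw [k2, mul_left_comm d, gen]
    simp only [Complex.mul_re, Complex.mul_im, Complex.conj_re, Complex.conj_im, hκ₁, hκ₂]
    ring
  · rw [mul_add, mul_add, mul_left_comm, gen', k1, k2, k3]
    simp only [Complex.mul_re, Complex.mul_im, Complex.conj_re, Complex.conj_im, Complex.add_re,
      Complex.add_im, hκ₁, hκ₂]
    ring

end RootSystem

/-! ### Derivatives of the integrated energy -/

section Energy

/-- `log ‖f‖` is locally the real part of a holomorphic logarithm of `f`, up to a constant. -/
theorem hasFDerivAt_log_norm {E : Type*} [NormedAddCommGroup E] [NormedSpace ℝ E] {f : E → ℂ}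
    {f' : E →L[ℝ] ℂ} {p : E} (hf : HasFDerivAt f f' p) (hp : f p ≠ 0) :
    HasFDerivAt (fun x => Real.log ‖f x‖) (Complex.reCLM.comp ((f p)⁻¹ • f')) p := by
  have h1 : HasFDerivAt (fun x => (f p)⁻¹ * f x) ((f p)⁻¹ • f') p := hf.const_smul (f p)⁻¹
  have h1' : (f p)⁻¹ * f p = 1 := inv_mul_cancel₀ hp
  have h2 := (Complex.hasStrictDerivAt_log (x := (f p)⁻¹ * f p)
    (by simp [h1'])).hasDerivAt.comp_hasFDerivAt p h1
  rw [h1', inv_one, one_smul] at h2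
  have h3 := (Complex.reCLM.hasFDerivAt.comp p h2).add_const (Real.log ‖f p‖)
  refine h3.congr_of_eventuallyEq ?_
  filter_upwards [hf.continuousAt.eventually_ne hp] with x hx
  simp only [Function.comp_apply, Complex.reCLM_apply, Complex.log_re, norm_mul, norm_inv]
  rw [Real.log_mul (by simpa using hp) (by simpa using hx), Real.log_inv]
  ring

theorem hasFDerivAt_log_norm_comp {E : Type*} [NormedAddCommGroup E] [NormedSpace ℝ E] {f : E → ℂ}
    {f' : E →L[ℝ] ℂ} {p : E} {Ψ : ℂ → ℂ} (hf : HasFDerivAt f f' p) (hΨ : AnalyticAt ℂ Ψ (f p))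
    (hΨ0 : Ψ (f p) ≠ 0) :
    HasFDerivAt (fun x => Real.log ‖Ψ (f x)‖) (Complex.reCLM.comp (logDeriv Ψ (f p) • f')) p := by
  refine (hasFDerivAt_log_norm (hΨ.differentiableAt.hasDerivAt.comp_hasFDerivAt p hf)
    hΨ0).congr_fderiv ?_
  rw [smul_smul, logDeriv_apply, div_eq_inv_mul]
  rfl

/-- The point `((q, H), y)` below `((q, H, u), y)`. -/
def planePoint (p : (Fin 3 → ℝ) × ℝ) : (ℝ × ℝ) × ℝ := ((p.1 0, p.1 1), p.2)

/-- The point `b ((q, H), y) + i u` as a function of `((q, H, u), y)`. -/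
def shiftedRoot (b : (ℝ × ℝ) × ℝ → ℂ) (p : (Fin 3 → ℝ) × ℝ) : ℂ :=
  b (planePoint p) + Complex.I * (p.1 2 : ℂ)

/-- The integrand `q log ‖Ψ(b + i u)‖` of the energy as a function of `((q, H, u), y)`. -/
def energyDensity (b : (ℝ × ℝ) × ℝ → ℂ) (Ψ : ℂ → ℂ) (p : (Fin 3 → ℝ) × ℝ) : ℝ :=
  p.1 0 * Real.log ‖Ψ (shiftedRoot b p)‖

variable {b : (ℝ × ℝ) × ℝ → ℂ} {Ψ : ℂ → ℂ}

/-- `planePoint` as a continuous linear map. -/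
def planePointL : (Fin 3 → ℝ) × ℝ →L[ℝ] (ℝ × ℝ) × ℝ :=
  (((ContinuousLinearMap.proj 0).prod (ContinuousLinearMap.proj 1)).comp
    (ContinuousLinearMap.fst ℝ (Fin 3 → ℝ) ℝ)).prod (ContinuousLinearMap.snd ℝ (Fin 3 → ℝ) ℝ)

theorem hasFDerivAt_planePoint (p : (Fin 3 → ℝ) × ℝ) : HasFDerivAt planePoint planePointL p :=
  planePointL.hasFDerivAt

theorem contDiff_planePoint {n : WithTop ℕ∞} : ContDiff ℝ n planePoint :=
  planePointL.contDiff

/-- The continuous linear map `((q, H, u), y) ↦ i u`. -/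
def heightL : (Fin 3 → ℝ) × ℝ →L[ℝ] ℂ :=
  Complex.I • Complex.ofRealCLM.comp
    ((ContinuousLinearMap.proj 2).comp (ContinuousLinearMap.fst ℝ (Fin 3 → ℝ) ℝ))

theorem contDiffAt_shiftedRoot {p : (Fin 3 → ℝ) × ℝ} (hb : ContDiffAt ℝ 2 b (planePoint p)) :
    ContDiffAt ℝ 2 (shiftedRoot b) p :=
  (hb.comp p contDiff_planePoint.contDiffAt).add heightL.contDiff.contDiffAt

theorem fderiv_shiftedRoot {p : (Fin 3 → ℝ) × ℝ} (hb : DifferentiableAt ℝ b (planePoint p)) :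
    fderiv ℝ (shiftedRoot b) p = (fderiv ℝ b (planePoint p)).comp planePointL + heightL :=
  ((hb.hasFDerivAt.comp p (hasFDerivAt_planePoint p)).add heightL.hasFDerivAt).fderiv

theorem contDiffAt_energyDensity {p : (Fin 3 → ℝ) × ℝ} (hb : ContDiffAt ℝ 2 b (planePoint p))
    (hΨ : AnalyticAt ℂ Ψ (shiftedRoot b p)) (hΨ0 : Ψ (shiftedRoot b p) ≠ 0) :
    ContDiffAt ℝ 2 (energyDensity b Ψ) p := by
  have h1 : ContDiffAt ℝ 2 (fun p => Ψ (shiftedRoot b p)) p :=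
    ContDiffAt.comp p (hΨ.contDiffAt.restrict_scalars ℝ) (contDiffAt_shiftedRoot hb)
  refine ContDiffAt.mul ?_ ((h1.norm ℝ hΨ0).log (by simpa using hΨ0))
  fun_prop

theorem fderiv_energyDensity {p : (Fin 3 → ℝ) × ℝ} (hb : ContDiffAt ℝ 2 b (planePoint p))
    (hΨ : AnalyticAt ℂ Ψ (shiftedRoot b p)) (hΨ0 : Ψ (shiftedRoot b p) ≠ 0)
    (v : (Fin 3 → ℝ) × ℝ) :
    fderiv ℝ (energyDensity b Ψ) p v = v.1 0 * Real.log ‖Ψ (shiftedRoot b p)‖ +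
      p.1 0 * (logDeriv Ψ (shiftedRoot b p) * fderiv ℝ (shiftedRoot b) p v).re := by
  have hz := ((contDiffAt_shiftedRoot hb).differentiableAt (by simp)).hasFDerivAt
  have h1 := hasFDerivAt_log_norm_comp hz hΨ hΨ0
  have h0 : HasFDerivAt (fun p : (Fin 3 → ℝ) × ℝ => p.1 0) ((ContinuousLinearMap.proj 0).comp
    (ContinuousLinearMap.fst ℝ (Fin 3 → ℝ) ℝ)) p := ((ContinuousLinearMap.proj 0).comp
    (ContinuousLinearMap.fst ℝ (Fin 3 → ℝ) ℝ)).hasFDerivAt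
  have h2 : fderiv ℝ (energyDensity b Ψ) p = _ := (h0.mul h1).fderiv
  rw [h2]
  simp
  ring

theorem fderiv_fderiv_energyDensity {p : (Fin 3 → ℝ) × ℝ} (hb : ContDiffAt ℝ 2 b (planePoint p))
    (hΨ : AnalyticAt ℂ Ψ (shiftedRoot b p)) (hΨ0 : Ψ (shiftedRoot b p) ≠ 0)
    (v w : (Fin 3 → ℝ) × ℝ) :
    fderiv ℝ (fun p => fderiv ℝ (energyDensity b Ψ) p v) p w =
      v.1 0 * (logDeriv Ψ (shiftedRoot b p) * fderiv ℝ (shiftedRoot b) p w).re +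
      w.1 0 * (logDeriv Ψ (shiftedRoot b p) * fderiv ℝ (shiftedRoot b) p v).re +
      p.1 0 * (deriv (logDeriv Ψ) (shiftedRoot b p) * fderiv ℝ (shiftedRoot b) p w *
        fderiv ℝ (shiftedRoot b) p v + logDeriv Ψ (shiftedRoot b p) *
          fderiv ℝ (fun p => fderiv ℝ (shiftedRoot b) p v) p w).re := by
  have hzc := contDiffAt_shiftedRoot hb
  have hz := (hzc.differentiableAt (by simp)).hasFDerivAt
  have hev : (fun p => fderiv ℝ (energyDensity b Ψ) p v) =ᶠ[𝓝 p] fun p =>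
      v.1 0 * Real.log ‖Ψ (shiftedRoot b p)‖ +
      p.1 0 * (logDeriv Ψ (shiftedRoot b p) * fderiv ℝ (shiftedRoot b) p v).re := by
    filter_upwards [(contDiff_planePoint (n := 0)).continuous.continuousAt.eventually
      (hb.eventually (by simp)), hzc.continuousAt.eventually hΨ.eventually_analyticAt,
      hzc.continuousAt.eventually (hΨ.continuousAt.eventually_ne hΨ0)] with p' h1 h2 h3
    exact fderiv_energyDensity h1 h2 h3 v
  rw [hev.fderiv_eq]
  have h1 := hasFDerivAt_log_norm_comp hz hΨ hΨ0
  have h0 : HasFDerivAt (fun p : (Fin 3 → ℝ) × ℝ => p.1 0) ((ContinuousLinearMap.proj 0).comp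
    (ContinuousLinearMap.fst ℝ (Fin 3 → ℝ) ℝ)) p := ((ContinuousLinearMap.proj 0).comp
    (ContinuousLinearMap.fst ℝ (Fin 3 → ℝ) ℝ)).hasFDerivAt
  have hlog : AnalyticAt ℂ (logDeriv Ψ) (shiftedRoot b p) := hΨ.deriv.div hΨ hΨ0
  have h3 := hlog.differentiableAt.hasDerivAt.comp_hasFDerivAt p hz
  have h4 : HasFDerivAt (fun p => fderiv ℝ (shiftedRoot b) p v) _ p :=
    (((hzc.fderiv_right (m := 1) (by norm_num)).clm_apply
      contDiffAt_const).differentiableAt (by simp)).hasFDerivAt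
  have h5 := (h1.const_mul (v.1 0)).add (h0.mul (Complex.reCLM.hasFDerivAt.comp p (h3.mul h4)))
  have h6 : fderiv ℝ (fun p => v.1 0 * Real.log ‖Ψ (shiftedRoot b p)‖ +
      p.1 0 * (logDeriv Ψ (shiftedRoot b p) * fderiv ℝ (shiftedRoot b) p v).re) p = _ := h5.fderiv
  rw [h6]
  simp
  ring

/-- The integral `q ∫ log ‖Ψ(b ((q, H), y) + i u)‖ dy` over `[-1/2, 1/2]` as a function of
`(q, H, u)`. -/
def energy (b : (ℝ × ℝ) × ℝ → ℂ) (Ψ : ℂ → ℂ) (X : Fin 3 → ℝ) : ℝ :=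
  ∫ y in (-(1 / 2) : ℝ)..(1 / 2), energyDensity b Ψ (X, y)

namespace RootSystem

variable {U : Set (ℝ × ℝ)} {S : Set ℂ} {K : ℂ → ℂ} {R : (ℝ × ℝ) × ℝ → ℂ}
  (h : RootSystem U S K b R) {X : Fin 3 → ℝ}

include h

theorem contDiffAt_energy (hX : (X 0, X 1) ∈ U)
    (hΨ : ∀ y ∈ 𝕀, AnalyticAt ℂ Ψ (shiftedRoot b (X, y)) ∧ Ψ (shiftedRoot b (X, y)) ≠ 0) :
    ContDiffAt ℝ 2 (energy b Ψ) X :=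
  contDiffAt_paramIntegral (n := 2) (by norm_num) fun y hy =>
    contDiffAt_energyDensity (h.contDiffAt _ hX y hy) (hΨ y hy).1 (hΨ y hy).2

omit h in
theorem analyticAt_logDeriv_shift
    (hΨ : ∀ y ∈ 𝕀, AnalyticAt ℂ Ψ (shiftedRoot b (X, y)) ∧ Ψ (shiftedRoot b (X, y)) ≠ 0)
    {y : ℝ} (hy : y ∈ 𝕀) :
    AnalyticAt ℂ (fun z => logDeriv Ψ (z + Complex.I * (X 2 : ℂ))) (b ((X 0, X 1), y)) := by
  have h1 : AnalyticAt ℂ (logDeriv Ψ) (b ((X 0, X 1), y) + Complex.I * (X 2 : ℂ)) :=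
    (hΨ y hy).1.deriv.div (hΨ y hy).1 (hΨ y hy).2
  exact AnalyticAt.comp (g := logDeriv Ψ) (f := fun z => z + Complex.I * (X 2 : ℂ)) h1
    (analyticAt_id.add analyticAt_const)

theorem fderiv_shiftedRoot_horizontal {y : ℝ} (hX : (X 0, X 1) ∈ U) (hy : y ∈ 𝕀) (e : ℝ × ℝ) :
    fderiv ℝ (shiftedRoot b) (X, y) (![e.1, e.2, 0], 0) = dirDeriv b e ((X 0, X 1), y) := by
  rw [fderiv_shiftedRoot ((h.contDiffAt _ hX y hy).differentiableAt (by simp))]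
  simp [planePointL, heightL, planePoint, dirDeriv]

/-- The second derivative in a direction of the `(q, H)`-plane is a second variation. -/
theorem fderiv_fderiv_energy_horizontal (hX : (X 0, X 1) ∈ U)
    (hΨ : ∀ y ∈ 𝕀, AnalyticAt ℂ Ψ (shiftedRoot b (X, y)) ∧ Ψ (shiftedRoot b (X, y)) ≠ 0)
    (e : ℝ × ℝ) :
    fderiv ℝ (fun Y => fderiv ℝ (energy b Ψ) Y ![e.1, e.2, 0]) X ![e.1, e.2, 0] =
      (secondVar b e (X 0, X 1) (fun z => logDeriv Ψ (z + Complex.I * (X 2 : ℂ)))).re := by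
  have hG := fderiv_fderiv_paramIntegral (f := energyDensity b Ψ) (a := -(1 / 2)) (b := 1 / 2)
    (x := X) (by norm_num) (fun y hy => contDiffAt_energyDensity (h.contDiffAt _ hX y hy)
      (hΨ y hy).1 (hΨ y hy).2) ![e.1, e.2, 0] ![e.1, e.2, 0]
  refine hG.trans ?_
  have hχ := fun y hy => analyticAt_logDeriv_shift hΨ (y := y) hy
  have hc := h.continuousOn_comp_root hX hχ
  have hc' := h.continuousOn_comp_root hX (fun y hy => (hχ y hy).deriv)
  have hd := continuousOn_slice (h.continuousOn_dirDeriv e) hX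
  have hdd := continuousOn_slice (h.continuousOn_dirDeriv_dirDeriv e) hX
  rw [secondVar, ← Complex.reCLM_apply, ← ContinuousLinearMap.intervalIntegral_comp_comm]
  · refine intervalIntegral.integral_congr fun y hy => ?_
    rw [uIcc_of_le (by norm_num)] at hy
    have hbc := h.contDiffAt _ hX y hy
    have hev : (fun p => fderiv ℝ (shiftedRoot b) p (![e.1, e.2, 0], 0)) =ᶠ[𝓝 (X, y)]
        fun p => dirDeriv b e (planePoint p) := by
      filter_upwards [(contDiff_planePoint (n := 0)).continuous.continuousAt.eventually
        (ContDiffAt.eventually (x := planePoint (X, y)) hbc (by simp))] with p hp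
      rw [fderiv_shiftedRoot (hp.differentiableAt (by simp))]
      simp [planePointL, heightL, dirDeriv]
    have h2 : fderiv ℝ (fun p => fderiv ℝ (shiftedRoot b) p (![e.1, e.2, 0], 0)) (X, y)
        (![e.1, e.2, 0], 0) = dirDeriv (dirDeriv b e) e ((X 0, X 1), y) := by
      rw [hev.fderiv_eq]
      have := (((h.contDiffAt_dirDeriv hX hy e).differentiableAt (by simp)).hasFDerivAt.comp
        (f := planePoint) (X, y) (hasFDerivAt_planePoint (X, y))).fderiv
      have h3 : fderiv ℝ (fun p => dirDeriv b e (planePoint p)) (X, y) = _ := this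
      rw [h3]
      simp only [ContinuousLinearMap.comp_apply]
      change _ = fderiv ℝ (dirDeriv b e) ((X 0, X 1), y) (e, 0)
      congr 1
    simp only
    rw [fderiv_fderiv_energyDensity hbc (hΨ y hy).1 (hΨ y hy).2, h2,
      h.fderiv_shiftedRoot_horizontal hX hy e, deriv_comp_add_const]
    simp only [shiftedRoot, planePoint, Complex.reCLM_apply, Matrix.cons_val_zero]
    set A := logDeriv Ψ (b ((X 0, X 1), y) + Complex.I * (X 2 : ℂ))
    set B := deriv (logDeriv Ψ) (b ((X 0, X 1), y) + Complex.I * (X 2 : ℂ))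
    simp [pow_two]
    ring
  · exact intervalIntegrable_half ((continuousOn_const.mul (hc.mul hd)).add (continuousOn_const.mul
      ((hc'.mul (hd.pow 2)).add (hc.mul hdd))))

/-- The mixed derivative is a first variation, because the `u`-derivative multiplies the logarithmic
derivative of `Ψ` by `i`. -/
theorem fderiv_fderiv_energy_mixed (hX : (X 0, X 1) ∈ U)
    (hΨ : ∀ y ∈ 𝕀, AnalyticAt ℂ Ψ (shiftedRoot b (X, y)) ∧ Ψ (shiftedRoot b (X, y)) ≠ 0)
    (e : ℝ × ℝ) :
    fderiv ℝ (fun Y => fderiv ℝ (energy b Ψ) Y ![0, 0, 1]) X ![e.1, e.2, 0] =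
      (Complex.I *
        firstVar b e (X 0, X 1) (fun z => logDeriv Ψ (z + Complex.I * (X 2 : ℂ)))).re := by
  have hG := fderiv_fderiv_paramIntegral (f := energyDensity b Ψ) (a := -(1 / 2)) (b := 1 / 2)
    (x := X) (by norm_num) (fun y hy => contDiffAt_energyDensity (h.contDiffAt _ hX y hy)
      (hΨ y hy).1 (hΨ y hy).2) ![0, 0, 1] ![e.1, e.2, 0]
  refine hG.trans ?_
  have hχ := fun y hy => analyticAt_logDeriv_shift hΨ (y := y) hy
  have hc := h.continuousOn_comp_root hX hχ
  have hc' := h.continuousOn_comp_root hX (fun y hy => (hχ y hy).deriv)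
  have hd := continuousOn_slice (h.continuousOn_dirDeriv e) hX
  rw [firstVar, ← intervalIntegral.integral_const_mul, ← Complex.reCLM_apply,
    ← ContinuousLinearMap.intervalIntegral_comp_comm]
  · refine intervalIntegral.integral_congr fun y hy => ?_
    rw [uIcc_of_le (by norm_num)] at hy
    have hbc := h.contDiffAt _ hX y hy
    have hev : (fun p => fderiv ℝ (shiftedRoot b) p (![0, 0, 1], 0)) =ᶠ[𝓝 (X, y)]
        fun _ => Complex.I := by
      filter_upwards [(contDiff_planePoint (n := 0)).continuous.continuousAt.eventually
        (ContDiffAt.eventually (x := planePoint (X, y)) hbc (by simp))] with p hp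
      rw [fderiv_shiftedRoot (hp.differentiableAt (by simp))]
      have : planePointL (![0, 0, 1], 0) = 0 := by
        simp [planePointL]
      simp [heightL, this]
    have h2 : fderiv ℝ (fun p => fderiv ℝ (shiftedRoot b) p (![0, 0, 1], 0)) (X, y)
        (![e.1, e.2, 0], 0) = 0 := by
      rw [hev.fderiv_eq]
      simp
    have hI : fderiv ℝ (shiftedRoot b) (X, y) (![0, 0, 1], 0) = Complex.I := hev.self_of_nhds
    simp only
    rw [fderiv_fderiv_energyDensity hbc (hΨ y hy).1 (hΨ y hy).2, h2,
      h.fderiv_shiftedRoot_horizontal hX hy e, hI, deriv_comp_add_const]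
    simp only [shiftedRoot, planePoint, Complex.reCLM_apply, Matrix.cons_val_zero]
    set A := logDeriv Ψ (b ((X 0, X 1), y) + Complex.I * (X 2 : ℂ))
    set B := deriv (logDeriv Ψ) (b ((X 0, X 1), y) + Complex.I * (X 2 : ℂ))
    simp
    ring
  · exact intervalIntegrable_half (continuousOn_const.mul ((continuousOn_const.mul hc).add
      (continuousOn_const.mul (hc'.mul hd))))

end RootSystem

end Energy

/-! ### Derivatives of continued phases -/

section Logarithms

variable {E : Type*} [NormedAddCommGroup E] [NormedSpace ℝ E]

/-- If `e^{iφ} = G ∘ w` on the strip `V × [a, b]` and `k` is the logarithmic derivative of `G`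
divided by `i`, then `dφ = k dw` on the strip, edges included. -/
theorem fderiv_apply_of_exp_eq {φ w : E × ℝ → ℂ} {G : ℂ → ℂ} {k : ℂ} {V : Set E} (hV : IsOpen V)
    {a b : ℝ} (hab : a < b) {x : E} (hx : x ∈ V) {y : ℝ} (hy : y ∈ Icc a b)
    (h : ∀ x ∈ V, ∀ y ∈ Icc a b, Complex.exp (Complex.I * φ (x, y)) = G (w (x, y)))
    (hφ : DifferentiableAt ℝ φ (x, y)) (hw : DifferentiableAt ℝ w (x, y))
    (hG : HasDerivAt G (G (w (x, y)) * (Complex.I * k)) (w (x, y))) (v : E × ℝ) :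
    fderiv ℝ φ (x, y) v = k * fderiv ℝ w (x, y) v := by
  have hu : UniqueDiffWithinAt ℝ (V ×ˢ Icc a b) (x, y) :=
    (hV.uniqueDiffOn.prod (uniqueDiffOn_Icc hab)) _ ⟨hx, hy⟩
  have h1 : HasFDerivAt (fun p => Complex.I * φ p) (Complex.I • fderiv ℝ φ (x, y)) (x, y) :=
    hφ.hasFDerivAt.const_smul Complex.I
  have h2 := hasFDerivWithinAt_of_exp_eq (φ := fun p => Complex.I * φ p) (g := fun p => G (w p))
    (s := V ×ˢ Icc a b) (p := (x, y)) ⟨hx, hy⟩ h1.continuousAt.continuousWithinAt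
    (fun p hp => h p.1 hp.1 p.2 hp.2)
    (hG.comp_hasFDerivAt (x, y) hw.hasFDerivAt).hasFDerivWithinAt
  have h3 := congrArg (fun L => L v) (hu.eq h1.hasFDerivWithinAt h2)
  have hne : G (w (x, y)) ≠ 0 := by rw [← h x hx y hy]; exact Complex.exp_ne_zero _
  simp only [smul_apply, smul_eq_mul] at h3
  refine mul_left_cancel₀ Complex.I_ne_zero (h3.trans ?_)
  field_simp

/-- The increment of a continuous logarithm is the integral of the logarithmic derivative. -/
theorem eq_add_integral_of_exp_eq {φ g k : ℝ → ℂ} {a b : ℝ} (hab : a ≤ b)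
    (hφ : ContinuousOn φ (Icc a b))
    (h : ∀ t ∈ Icc a b, Complex.exp (Complex.I * φ t) = g t)
    (hg : ∀ t ∈ Icc a b, HasDerivAt g (g t * (Complex.I * k t)) t)
    (hk : ContinuousOn k (Icc a b)) : φ b = φ a + ∫ t in a..b, k t := by
  rw [intervalIntegral.integral_eq_sub_of_hasDerivAt_of_le hab hφ (f' := k)]
  · ring
  · intro t ht
    have ht' := Ioo_subset_Icc_self ht
    have hn : Icc a b ∈ 𝓝 t := Icc_mem_nhds ht.1 ht.2
    have h1 := hasFDerivWithinAt_of_exp_eq (φ := fun t => Complex.I * φ t) ht'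
      (continuousWithinAt_const.mul (hφ t ht')) h (hg t ht').hasFDerivAt.hasFDerivWithinAt
    have h2 := ((h1.hasFDerivAt hn).hasDerivAt).const_mul (-Complex.I)
    have hne : g t ≠ 0 := by rw [← h t ht']; exact Complex.exp_ne_zero _
    simp only [smul_apply, ContinuousLinearMap.toSpanSingleton_apply, one_smul, smul_eq_mul,
      inv_mul_cancel_left₀ hne] at h2
    simpa only [neg_mul, ← mul_assoc, Complex.I_mul_I, neg_neg, one_mul] using h2
  · exact ContinuousOn.intervalIntegrable (by rwa [uIcc_of_le hab])

end Logarithms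

/-! ### Momentum, phase and the kernel -/

section Kernel

variable (η : ℝ)

/-- The derivative `K = Θ'` of the two-body phase. -/
def phaseKernel (z : ℂ) : ℂ :=
  -Complex.sinh (2 * η) / (Complex.sinh (Complex.I * z + η) * Complex.sinh (Complex.I * z - η))

/-- The points where numerator and denominator of `e^{iΘ}` do not vanish. -/
def phaseDomain : Set ℂ :=
  {z | Complex.sinh (Complex.I * z + η) ≠ 0 ∧ Complex.sinh (Complex.I * z - η) ≠ 0}

variable {η}

theorem isOpen_phaseDomain : IsOpen (phaseDomain η) := by
  refine (isOpen_ne_fun ?_ continuous_const).inter (isOpen_ne_fun ?_ continuous_const)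
  all_goals exact Complex.continuous_sinh.comp (by fun_prop)

theorem sinh_neg_add (z a : ℂ) :
    Complex.sinh (Complex.I * -z + a) = -Complex.sinh (Complex.I * z - a) := by
  rw [← Complex.sinh_neg]; ring_nf

theorem sinh_neg_sub (z a : ℂ) :
    Complex.sinh (Complex.I * -z - a) = -Complex.sinh (Complex.I * z + a) := by
  rw [← Complex.sinh_neg]; ring_nf

theorem neg_mem_phaseDomain {z : ℂ} (hz : z ∈ phaseDomain η) : -z ∈ phaseDomain η :=
  ⟨by rw [sinh_neg_add]; exact neg_ne_zero.2 hz.2, by rw [sinh_neg_sub]; exact neg_ne_zero.2 hz.1⟩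

theorem phaseKernel_neg (z : ℂ) : phaseKernel η (-z) = phaseKernel η z := by
  unfold phaseKernel
  rw [sinh_neg_add, sinh_neg_sub]
  congr 1
  ring

theorem differentiableOn_phaseKernel : DifferentiableOn ℂ (phaseKernel η) (phaseDomain η) := by
  intro z hz
  refine DifferentiableAt.differentiableWithinAt ?_
  unfold phaseKernel
  have hd := mul_ne_zero hz.1 hz.2
  fun_prop (disch := assumption)

theorem expPhase_mul_neg {z : ℂ} (hz : z ∈ phaseDomain η) :
    expPhase η z * expPhase η (-z) = 1 := by
  unfold expPhase
  rw [sinh_neg_add, sinh_neg_sub]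
  have h1 := hz.1
  have h2 := hz.2
  field_simp

theorem mem_phaseDomain_of_expPhase_ne {z : ℂ} (hz : expPhase η z ≠ 0) : z ∈ phaseDomain η := by
  unfold expPhase at hz
  constructor <;> intro h <;> simp [h] at hz

theorem hasDerivAt_expPhase {z : ℂ} (hz : z ∈ phaseDomain η) :
    HasDerivAt (expPhase η) (expPhase η z * (Complex.I * phaseKernel η z)) z := by
  have h0 : HasDerivAt (fun z => Complex.I * z) Complex.I z := by
    simpa using (hasDerivAt_id z).const_mul Complex.I
  have h1 := ((h0.add_const (η : ℂ)).csinh.div (h0.sub_const (η : ℂ)).csinh hz.2).neg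
  refine h1.congr_deriv ?_
  have e : Complex.sinh (2 * η) = Complex.sinh (Complex.I * z + η) * Complex.cosh
      (Complex.I * z - η) -
      Complex.cosh (Complex.I * z + η) * Complex.sinh (Complex.I * z - η) := by
    rw [← Complex.sinh_sub]; ring_nf
  have h1 := hz.1
  have h2 := hz.2
  rw [expPhase, phaseKernel, e]
  set A := Complex.I * z + (η : ℂ)
  set B := Complex.I * z - (η : ℂ)
  field_simp
  ring

theorem exists_hasDerivAt_expMomentum {z : ℂ} (hz : expMomentum η z ≠ 0) : ∃ k : ℂ,
    HasDerivAt (expMomentum η) (expMomentum η z * (Complex.I * k)) z := by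
  have hd : Complex.sinh ((η : ℂ) / 2 - Complex.I * z) ≠ 0 := fun h0 =>
    hz (by rw [expMomentum, h0, div_zero])
  have h1 : DifferentiableAt ℂ (expMomentum η) z := by
    unfold expMomentum
    fun_prop (disch := assumption)
  refine ⟨-Complex.I * (deriv (expMomentum η) z / expMomentum η z), ?_⟩
  refine h1.hasDerivAt.congr_deriv ?_
  field_simp
  simp

end Kernel

/-! ### The phase as a function of the rescaled roots -/

section Phase

variable (b : (ℝ × ℝ) × ℝ → ℂ) (K : ℂ → ℂ)

/-- The value of `Θ(b (x, y) - b (x, s))` continued along the curve, at `((x, y), s)`: the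
integral of `K = Θ'` over the part of the curve from `s` to `y`. -/
def phase (p : ((ℝ × ℝ) × ℝ) × ℝ) : ℂ :=
  ∫ θ in (0 : ℝ)..1, K (b (p.1.1, p.2 + θ * (p.1.2 - p.2)) - b (p.1.1, p.2)) *
    (((p.1.2 : ℂ) - p.2) * tangent b (p.1.1, p.2 + θ * (p.1.2 - p.2)))

/-- The function `2 π y + ∫ Θ(b (x, y) - b (x, s)) ds`. In these terms the Bethe equation reads
`p(b) + 2 i H = q · totalPhase`. -/
def totalPhase (p : (ℝ × ℝ) × ℝ) : ℂ :=
  2 * Real.pi * p.2 + ∫ s in (-(1 / 2) : ℝ)..(1 / 2), phase b K (p, s)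

/-- The roots `α q H (q y)`, parametrized by `y ∈ [-1/2, 1/2]` for all `q`. -/
def rescaledRoot (α : ℝ → ℝ → ℝ → ℂ) (p : (ℝ × ℝ) × ℝ) : ℂ := α p.1.1 p.1.2 (p.1.1 * p.2)

theorem segment_mem {y s θ : ℝ} (hy : y ∈ 𝕀) (hs : s ∈ 𝕀) (hθ : θ ∈ Icc (0 : ℝ) 1) :
    s + θ * (y - s) ∈ 𝕀 := by
  have := (convex_Icc (-(1 / 2) : ℝ) (1 / 2)).add_smul_sub_mem hs hy hθ
  simpa using this

variable {b K} {S : Set ℂ}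

theorem contDiffAt_phase (hS : IsOpen S) (hK : DifferentiableOn ℂ K S) {x : ℝ × ℝ} {y s : ℝ}
    (hy : y ∈ 𝕀) (hs : s ∈ 𝕀) (hb : ∀ y ∈ 𝕀, ContDiffAt ℝ 2 b (x, y))
    (hm : ∀ y ∈ 𝕀, b (x, y) - b (x, s) ∈ S) : ContDiffAt ℝ 1 (phase b K) ((x, y), s) := by
  refine contDiffAt_paramIntegral (n := 1) (f := fun p : (((ℝ × ℝ) × ℝ) × ℝ) × ℝ =>
    K (b (p.1.1.1, p.1.2 + p.2 * (p.1.1.2 - p.1.2)) - b (p.1.1.1, p.1.2)) *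
    (((p.1.1.2 : ℂ) - p.1.2) * tangent b (p.1.1.1, p.1.2 + p.2 * (p.1.1.2 - p.1.2))))
    zero_le_one fun θ hθ => ?_
  have hy' := segment_mem hy hs hθ
  have hp : ContDiffAt ℝ 1 (fun p : (((ℝ × ℝ) × ℝ) × ℝ) × ℝ =>
      (p.1.1.1, p.1.2 + p.2 * (p.1.1.2 - p.1.2))) (((x, y), s), θ) := by fun_prop
  have hp' : ContDiffAt ℝ 1 (fun p : (((ℝ × ℝ) × ℝ) × ℝ) × ℝ =>
      (p.1.1.1, p.1.2)) (((x, y), s), θ) := by fun_prop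
  have h1 := ContDiffAt.comp (g := b) (((x, y), s), θ) ((hb _ hy').of_le (by norm_num)) hp
  have h2 := ContDiffAt.comp (g := b) (((x, y), s), θ) ((hb _ hs).of_le (by norm_num)) hp'
  have h3 : ContDiffAt ℝ 1 (tangent b) (x, s + θ * (y - s)) :=
    ((hb _ hy').fderiv_right (by norm_num)).clm_apply contDiffAt_const
  have h4 := ContDiffAt.comp (g := tangent b) (((x, y), s), θ) h3 hp
  have h5 : ContDiffAt ℝ 1 K (b (x, s + θ * (y - s)) - b (x, s)) :=
    ((hK.analyticAt (hS.mem_nhds (hm _ hy'))).contDiffAt).restrict_scalars ℝ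
  refine (ContDiffAt.comp (g := K) (((x, y), s), θ) h5 (h1.sub h2)).mul (ContDiffAt.mul ?_ h4)
  exact (Complex.ofRealCLM.contDiff.contDiffAt.comp (((x, y), s), θ)
    (f := fun p : (((ℝ × ℝ) × ℝ) × ℝ) × ℝ => p.1.1.2) (by fun_prop)).sub
    (Complex.ofRealCLM.contDiff.contDiffAt.comp (((x, y), s), θ)
    (f := fun p : (((ℝ × ℝ) × ℝ) × ℝ) × ℝ => p.1.2) (by fun_prop))

end Phase

/-! ### Families of root curves are root systems -/

section Family

variable {η : ℝ} {U : Set (ℝ × ℝ)} {α : ℝ → ℝ → ℝ → ℂ}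

namespace IsRootFamily

variable (h : IsRootFamily η U α) {x : ℝ × ℝ} {y s : ℝ}

include h

theorem mul_mem (hx : x ∈ U) (hy : y ∈ 𝕀) : x.1 * y ∈ Icc (-x.1 / 2) (x.1 / 2) := by
  have := (h.density_mem x.1 x.2 hx).1
  constructor <;> nlinarith [hy.1, hy.2]

theorem contDiffAt_rescaledRoot (hx : x ∈ U) (hy : y ∈ 𝕀) :
    ContDiffAt ℝ 2 (rescaledRoot α) (x, y) := by
  have h1 := h.contDiffAt x.1 x.2 hx _ (h.mul_mem hx hy)
  exact ContDiffAt.comp (g := fun x : ℝ × ℝ × ℝ => α x.1 x.2.1 x.2.2)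
    (f := fun p : (ℝ × ℝ) × ℝ => (p.1.1, p.1.2, p.1.1 * p.2)) (x, y) h1 (by fun_prop)

theorem rescaledRoot_neg (hx : x ∈ U) (hy : y ∈ 𝕀) :
    rescaledRoot α (x, -y) = -(starRingEnd ℂ) (rescaledRoot α (x, y)) := by
  simp only [rescaledRoot, mul_neg]
  exact (h.rootCurve x.1 x.2 hx).symm _ (h.mul_mem hx hy)

theorem sub_mem_phaseDomain (hx : x ∈ U) (hy : y ∈ 𝕀) (hs : s ∈ 𝕀) :
    rescaledRoot α (x, y) - rescaledRoot α (x, s) ∈ phaseDomain η := by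
  obtain ⟨P, Φ, -, hΦ, -⟩ := (h.rootCurve x.1 x.2 hx).bethe
  refine mem_phaseDomain_of_expPhase_ne ?_
  have := hΦ.exp_eq _ (h.mul_mem hx hy) _ (h.mul_mem hx hs)
  rw [rescaledRoot, rescaledRoot, ← this]
  exact Complex.exp_ne_zero _

/-- A phase along the curve is unique, hence equal to `phase`. -/
theorem phase_eq {Φ : ℝ → ℝ → ℂ} (hx : x ∈ U) (hΦ : IsPhaseAlong η x.1 (α x.1 x.2) Φ)
    (hy : y ∈ 𝕀) (hs : s ∈ 𝕀) :
    phase (rescaledRoot α) (phaseKernel η) ((x, y), s) = Φ (x.1 * y) (x.1 * s) := by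
  have hc : ∀ θ ∈ Icc (0 : ℝ) 1, HasDerivAt (fun θ => rescaledRoot α (x, s + θ * (y - s)))
      (((y : ℂ) - s) * tangent (rescaledRoot α) (x, s + θ * (y - s))) θ := fun θ hθ => by
    have h1 := hasDerivAt_slice ((h.contDiffAt_rescaledRoot hx
      (segment_mem hy hs hθ)).differentiableAt (by simp))
    have h2 : HasDerivAt (fun θ => s + θ * (y - s)) (y - s) θ := by
      simpa using ((hasDerivAt_id θ).mul_const (y - s)).const_add s
    refine (h1.scomp θ h2).congr_deriv ?_
    simp [tangent]
  have key := eq_add_integral_of_exp_eq (φ := fun θ => Φ (x.1 * (s + θ * (y - s))) (x.1 * s))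
    (g := fun θ => expPhase η (rescaledRoot α (x, s + θ * (y - s)) - rescaledRoot α (x, s)))
    (k := fun θ => phaseKernel η (rescaledRoot α (x, s + θ * (y - s)) - rescaledRoot α (x, s)) *
      (((y : ℂ) - s) * tangent (rescaledRoot α) (x, s + θ * (y - s)))) zero_le_one ?_ ?_ ?_ ?_
  · simp only [zero_mul, add_zero, hΦ.diag _ (h.mul_mem hx hs), zero_add, one_mul,
      add_sub_cancel] at key
    rw [key, phase]
  · exact hΦ.continuousOn.comp (f := fun θ => (x.1 * (s + θ * (y - s)), x.1 * s)) (by fun_prop)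
      fun θ hθ => ⟨h.mul_mem hx (segment_mem hy hs hθ), h.mul_mem hx hs⟩
  · intro θ hθ
    exact hΦ.exp_eq _ (h.mul_mem hx (segment_mem hy hs hθ)) _ (h.mul_mem hx hs)
  · intro θ hθ
    have h1 := (hasDerivAt_expPhase (h.sub_mem_phaseDomain hx (segment_mem hy hs hθ) hs)).comp θ
      ((hc θ hθ).sub_const _)
    refine h1.congr_deriv ?_
    ring
  · refine ContinuousOn.mul ?_ (continuousOn_const.mul ?_)
    · exact differentiableOn_phaseKernel.continuousOn.comp (fun θ hθ =>
        (((hc θ hθ).sub_const _).continuousAt).continuousWithinAt) fun θ hθ =>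
        h.sub_mem_phaseDomain hx (segment_mem hy hs hθ) hs
    · intro θ hθ
      have h1 : ContDiffAt ℝ 1 (tangent (rescaledRoot α)) (x, s + θ * (y - s)) :=
        ((h.contDiffAt_rescaledRoot hx (segment_mem hy hs hθ)).fderiv_right
          (by norm_num)).clm_apply contDiffAt_const
      exact (h1.continuousAt.comp (f := fun θ => (x, s + θ * (y - s)))
        (by fun_prop)).continuousWithinAt

theorem exp_phase (hx : x ∈ U) (hy : y ∈ 𝕀) (hs : s ∈ 𝕀) :
    Complex.exp (Complex.I * phase (rescaledRoot α) (phaseKernel η) ((x, y), s)) =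
      expPhase η (rescaledRoot α (x, y) - rescaledRoot α (x, s)) := by
  obtain ⟨P, Φ, -, hΦ, -⟩ := (h.rootCurve x.1 x.2 hx).bethe
  rw [h.phase_eq hx hΦ hy hs]
  exact hΦ.exp_eq _ (h.mul_mem hx hy) _ (h.mul_mem hx hs)

/-- The continued phase is odd: `e^{iΘ(z)} e^{iΘ(-z)} = 1`, so the sum of the two sides has zero
derivative, and it vanishes on the diagonal. -/
theorem phase_swap (hx : x ∈ U) (hy : y ∈ 𝕀) (hs : s ∈ 𝕀) :
    phase (rescaledRoot α) (phaseKernel η) ((x, y), s) =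
      -phase (rescaledRoot α) (phaseKernel η) ((x, s), y) := by
  obtain ⟨P, Φ, -, hΦ, -⟩ := (h.rootCurve x.1 x.2 hx).bethe
  rw [h.phase_eq hx hΦ hy hs, h.phase_eq hx hΦ hs hy, eq_neg_iff_add_eq_zero]
  have key := eq_add_integral_of_exp_eq (φ := fun θ => Φ (x.1 * (s + θ * (y - s))) (x.1 * s) +
      Φ (x.1 * s) (x.1 * (s + θ * (y - s)))) (g := fun _ => 1) (k := fun _ => 0) zero_le_one
      ?_ ?_ ?_ continuousOn_const
  · simpa [hΦ.diag _ (h.mul_mem hx hs)] using key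
  · exact (hΦ.continuousOn.comp (f := fun θ => (x.1 * (s + θ * (y - s)), x.1 * s)) (by fun_prop)
      fun θ hθ => ⟨h.mul_mem hx (segment_mem hy hs hθ), h.mul_mem hx hs⟩).add
      (hΦ.continuousOn.comp (f := fun θ => (x.1 * s, x.1 * (s + θ * (y - s)))) (by fun_prop)
      fun θ hθ => ⟨h.mul_mem hx hs, h.mul_mem hx (segment_mem hy hs hθ)⟩)
  · intro θ hθ
    have hθ' := segment_mem hy hs hθ
    rw [mul_add, Complex.exp_add, hΦ.exp_eq _ (h.mul_mem hx hθ') _ (h.mul_mem hx hs),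
      hΦ.exp_eq _ (h.mul_mem hx hs) _ (h.mul_mem hx hθ')]
    have := expPhase_mul_neg (h.sub_mem_phaseDomain hx hθ' hs)
    rwa [neg_sub] at this
  · intro θ hθ
    simpa using hasDerivAt_const θ (1 : ℂ)

theorem contDiffAt_phase (hx : x ∈ U) (hy : y ∈ 𝕀) (hs : s ∈ 𝕀) :
    ContDiffAt ℝ 1 (phase (rescaledRoot α) (phaseKernel η)) ((x, y), s) :=
  SixVertex.contDiffAt_phase isOpen_phaseDomain differentiableOn_phaseKernel hy hs
    (fun _ hy => h.contDiffAt_rescaledRoot hx hy) fun _ hy => h.sub_mem_phaseDomain hx hy hs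

theorem fderiv_phase (hx : x ∈ U) (hy : y ∈ 𝕀) (hs : s ∈ 𝕀) (v : (ℝ × ℝ) × ℝ) :
    fderiv ℝ (phase (rescaledRoot α) (phaseKernel η)) ((x, y), s) (v, 0) =
      phaseKernel η (rescaledRoot α (x, y) - rescaledRoot α (x, s)) *
        (fderiv ℝ (rescaledRoot α) (x, y) v - dirDeriv (rescaledRoot α) v.1 (x, s)) := by
  have h1 := ((h.contDiffAt_phase hx hy hs).differentiableAt (by simp)).hasFDerivAt
  have h2 : HasFDerivAt (fun p => phase (rescaledRoot α) (phaseKernel η) (p, s))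
      ((fderiv ℝ (phase (rescaledRoot α) (phaseKernel η)) ((x, y), s)).comp
        (ContinuousLinearMap.inl ℝ _ ℝ)) (x, y) :=
    h1.comp (f := fun p => (p, s)) (x, y) (hasFDerivAt_prodMk_left (x, y) s)
  have hb := ((h.contDiffAt_rescaledRoot hx hy).differentiableAt (by simp)).hasFDerivAt
  have hbs := ((h.contDiffAt_rescaledRoot hx hs).differentiableAt (by simp)).hasFDerivAt
  have h3 : HasFDerivAt (fun p : (ℝ × ℝ) × ℝ => (p.1, s))
      ((ContinuousLinearMap.inl ℝ (ℝ × ℝ) ℝ).comp (ContinuousLinearMap.fst ℝ (ℝ × ℝ) ℝ)) (x, y) :=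
    ((ContinuousLinearMap.inl ℝ (ℝ × ℝ) ℝ).comp
      (ContinuousLinearMap.fst ℝ (ℝ × ℝ) ℝ)).hasFDerivAt.add_const ((0 : ℝ × ℝ), s)
      |>.congr_of_eventuallyEq (Eventually.of_forall fun p => by simp)
  have h4 := hb.sub (HasFDerivAt.comp (g := rescaledRoot α) (x, y) hbs h3)
  have key := fderiv_apply_of_exp_eq
    (φ := fun p => phase (rescaledRoot α) (phaseKernel η) (p, s))
    (w := fun p => rescaledRoot α p - rescaledRoot α (p.1, s)) h.isOpen (by norm_num) hx hy
    (fun x hx y hy => h.exp_phase hx hy hs) h2.differentiableAt h4.differentiableAt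
    (hasDerivAt_expPhase (h.sub_mem_phaseDomain hx hy hs)) v
  have h5 : fderiv ℝ (fun p => rescaledRoot α p - rescaledRoot α (p.1, s)) (x, y) = _ := h4.fderiv
  rw [h2.fderiv, h5] at key
  exact key

theorem totalPhase_fderiv (hx : x ∈ U) (hy : y ∈ 𝕀) (v : (ℝ × ℝ) × ℝ) :
    DifferentiableAt ℝ (totalPhase (rescaledRoot α) (phaseKernel η)) (x, y) ∧
    fderiv ℝ (totalPhase (rescaledRoot α) (phaseKernel η)) (x, y) v = 2 * Real.pi * v.2 +
      ∫ s in (-(1 / 2) : ℝ)..(1 / 2),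
        phaseKernel η (rescaledRoot α (x, y) - rescaledRoot α (x, s)) *
          (fderiv ℝ (rescaledRoot α) (x, y) v - dirDeriv (rescaledRoot α) v.1 (x, s)) := by
  have h1 := hasFDerivAt_paramIntegral_of_contDiffAt (f := phase (rescaledRoot α) (phaseKernel η))
    (a := -(1 / 2)) (b := 1 / 2) (x := (x, y)) (by norm_num) fun s hs => h.contDiffAt_phase hx hy hs
  have h2 : HasFDerivAt (fun p : (ℝ × ℝ) × ℝ => 2 * Real.pi * (p.2 : ℂ))
      ((2 * Real.pi : ℂ) • Complex.ofRealCLM.comp (ContinuousLinearMap.snd ℝ (ℝ × ℝ) ℝ)) (x, y) :=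
    (Complex.ofRealCLM.comp (ContinuousLinearMap.snd ℝ (ℝ × ℝ) ℝ)).hasFDerivAt.const_smul
      (2 * Real.pi : ℂ)
  have h3 : HasFDerivAt (totalPhase (rescaledRoot α) (phaseKernel η)) _ (x, y) := h2.add h1
  refine ⟨h3.differentiableAt, ?_⟩
  rw [h3.fderiv, ← h1.fderiv, add_apply,
    fderiv_paramIntegral_apply (f := phase (rescaledRoot α) (phaseKernel η)) (by norm_num)
      (fun s hs => h.contDiffAt_phase hx hy hs)]
  congr 1
  refine intervalIntegral.integral_congr fun s hs => ?_
  rw [uIcc_of_le (by norm_num)] at hs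
  exact h.fderiv_phase hx hy hs v

theorem integral_totalPhase (hx : x ∈ U) :
    ∫ y in (-(1 / 2) : ℝ)..(1 / 2), totalPhase (rescaledRoot α) (phaseKernel η) (x, y) = 0 := by
  have hc : ContinuousOn (fun p : ℝ × ℝ => phase (rescaledRoot α) (phaseKernel η) ((x, p.1), p.2))
      (𝕀 ×ˢ 𝕀) := fun p hp => ((h.contDiffAt_phase hx hp.1 hp.2).continuousAt.comp
        (f := fun p : ℝ × ℝ => ((x, p.1), p.2)) (by fun_prop)).continuousWithinAt
  have hsw := RootSystem.integral_swap_half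
    (g := fun y s => phase (rescaledRoot α) (phaseKernel η) ((x, y), s)) hc
  have hneg : ∫ s in (-(1 / 2) : ℝ)..(1 / 2), ∫ y in (-(1 / 2) : ℝ)..(1 / 2),
      phase (rescaledRoot α) (phaseKernel η) ((x, y), s) =
      -∫ s in (-(1 / 2) : ℝ)..(1 / 2), ∫ y in (-(1 / 2) : ℝ)..(1 / 2),
        phase (rescaledRoot α) (phaseKernel η) ((x, s), y) := by
    rw [← intervalIntegral.integral_neg]
    refine intervalIntegral.integral_congr fun s hs => ?_
    rw [← intervalIntegral.integral_neg]
    refine intervalIntegral.integral_congr fun y hy => ?_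
    rw [uIcc_of_le (by norm_num)] at hs hy
    exact h.phase_swap hx hy hs
  have h0 : ∫ y in (-(1 / 2) : ℝ)..(1 / 2), ∫ s in (-(1 / 2) : ℝ)..(1 / 2),
      phase (rescaledRoot α) (phaseKernel η) ((x, y), s) = 0 :=
    CharZero.eq_neg_self_iff.1 (hsw.trans hneg)
  have hl : ∫ y in (-(1 / 2) : ℝ)..(1 / 2), (2 * Real.pi * (y : ℂ)) = 0 := by
    rw [intervalIntegral.integral_const_mul, intervalIntegral.integral_ofReal, integral_id]
    norm_num
  simp only [totalPhase]
  rw [intervalIntegral.integral_add, hl, h0, add_zero]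
  · exact (by fun_prop : Continuous fun y : ℝ => 2 * (Real.pi : ℂ) * (y : ℂ)).intervalIntegrable _ _
  · refine RootSystem.intervalIntegrable_half ?_
    exact continuousOn_paramIntegral (V := 𝕀) (by norm_num)
      (f := fun p : ℝ × ℝ => phase (rescaledRoot α) (phaseKernel η) ((x, p.1), p.2)) hc

theorem exp_totalPhase (hx : x ∈ U) (hy : y ∈ 𝕀) :
    Complex.exp (Complex.I * (x.1 * totalPhase (rescaledRoot α) (phaseKernel η) (x, y) -
      2 * Complex.I * x.2)) = expMomentum η (rescaledRoot α (x, y)) := by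
  obtain ⟨P, Φ, hP, hΦ, hB⟩ := (h.rootCurve x.1 x.2 hx).bethe
  have hy' := h.mul_mem hx hy
  have h1 := hB _ hy'
  have h2 : ∫ s in (-x.1 / 2)..(x.1 / 2), Φ (x.1 * y) s =
      x.1 * ∫ s in (-(1 / 2) : ℝ)..(1 / 2),
        phase (rescaledRoot α) (phaseKernel η) ((x, y), s) := by
    have h3 := intervalIntegral.smul_integral_comp_mul_left (a := -(1 / 2)) (b := 1 / 2)
      (fun s => Φ (x.1 * y) s) x.1
    rw [show x.1 * -(1 / 2) = -x.1 / 2 by ring, show x.1 * (1 / 2) = x.1 / 2 by ring] at h3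
    rw [← h3, Complex.real_smul]
    congr 1
    refine intervalIntegral.integral_congr fun s hs => ?_
    rw [uIcc_of_le (by norm_num)] at hs
    exact (h.phase_eq hx hΦ hy hs).symm
  have h4 : (x.1 * totalPhase (rescaledRoot α) (phaseKernel η) (x, y) - 2 * Complex.I * x.2) =
      P (x.1 * y) := by
    rw [h2] at h1
    push_cast at h1
    simp only [totalPhase]
    linear_combination h1
  rw [h4, hP.exp_eq _ hy']
  rfl

theorem rootSystem : RootSystem U (phaseDomain η) (phaseKernel η) (rescaledRoot α)
    (totalPhase (rescaledRoot α) (phaseKernel η)) := by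
  have hK : ∀ x ∈ U, ∀ y ∈ 𝕀, ContinuousOn (fun s =>
      phaseKernel η (rescaledRoot α (x, y) - rescaledRoot α (x, s))) 𝕀 := fun x hx y hy =>
    differentiableOn_phaseKernel.continuousOn.comp (fun s hs => (continuousAt_const.sub
      ((h.contDiffAt_rescaledRoot hx hs).continuousAt.comp (f := fun s => (x, s))
      (by fun_prop))).continuousWithinAt) fun s hs => h.sub_mem_phaseDomain hx hy hs
  have htan : ∀ x ∈ U, ∀ y ∈ 𝕀, tangent (totalPhase (rescaledRoot α) (phaseKernel η)) (x, y) =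
      2 * Real.pi + (∫ s in (-(1 / 2) : ℝ)..(1 / 2),
        phaseKernel η (rescaledRoot α (x, y) - rescaledRoot α (x, s))) *
          tangent (rescaledRoot α) (x, y) := fun x hx y hy => by
    have h0 : ∀ p, dirDeriv (rescaledRoot α) 0 p = 0 := fun p => map_zero (fderiv ℝ _ p)
    rw [tangent, (h.totalPhase_fderiv hx hy _).2, ← intervalIntegral.integral_mul_const]
    simp [h0, tangent]
  have hdir : ∀ x ∈ U, ∀ y ∈ 𝕀, ∀ e,
      dirDeriv (totalPhase (rescaledRoot α) (phaseKernel η)) e (x, y) =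
      ∫ s in (-(1 / 2) : ℝ)..(1 / 2),
        phaseKernel η (rescaledRoot α (x, y) - rescaledRoot α (x, s)) *
          (dirDeriv (rescaledRoot α) e (x, y) - dirDeriv (rescaledRoot α) e (x, s)) :=
    fun x hx y hy e => by
    rw [dirDeriv, (h.totalPhase_fderiv hx hy _).2]
    simp [dirDeriv]
  -- the derivative of `q R = p(b) + 2 i H`, with `k` the value of `p'`
  have hmom : ∀ x ∈ U, ∀ y ∈ 𝕀, ∃ k : ℂ, ∀ v : (ℝ × ℝ) × ℝ,
      v.1.1 * totalPhase (rescaledRoot α) (phaseKernel η) (x, y) +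
      x.1 * fderiv ℝ (totalPhase (rescaledRoot α) (phaseKernel η)) (x, y) v -
      2 * Complex.I * v.1.2 = k * fderiv ℝ (rescaledRoot α) (x, y) v := fun x hx y hy => by
    obtain ⟨k, hk⟩ := exists_hasDerivAt_expMomentum (η := η) (z := rescaledRoot α (x, y))
      (by rw [← h.exp_totalPhase hx hy]; exact Complex.exp_ne_zero _)
    refine ⟨k, fun v => ?_⟩
    have hR := (h.totalPhase_fderiv hx hy 0).1
    have h1 : HasFDerivAt (fun p : (ℝ × ℝ) × ℝ => (p.1.1 : ℂ)) (Complex.ofRealCLM.comp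
        ((ContinuousLinearMap.fst ℝ ℝ ℝ).comp (ContinuousLinearMap.fst ℝ (ℝ × ℝ) ℝ))) (x, y) :=
      (Complex.ofRealCLM.comp ((ContinuousLinearMap.fst ℝ ℝ ℝ).comp
        (ContinuousLinearMap.fst ℝ (ℝ × ℝ) ℝ))).hasFDerivAt
    have h2 : HasFDerivAt (fun p : (ℝ × ℝ) × ℝ => (p.1.2 : ℂ)) (Complex.ofRealCLM.comp
        ((ContinuousLinearMap.snd ℝ ℝ ℝ).comp (ContinuousLinearMap.fst ℝ (ℝ × ℝ) ℝ))) (x, y) :=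
      (Complex.ofRealCLM.comp ((ContinuousLinearMap.snd ℝ ℝ ℝ).comp
        (ContinuousLinearMap.fst ℝ (ℝ × ℝ) ℝ))).hasFDerivAt
    have h3 := (h1.mul hR.hasFDerivAt).sub (h2.const_mul (2 * Complex.I))
    have key := fderiv_apply_of_exp_eq (φ := fun p : (ℝ × ℝ) × ℝ =>
      p.1.1 * totalPhase (rescaledRoot α) (phaseKernel η) p - 2 * Complex.I * p.1.2) h.isOpen
      (by norm_num) hx hy (fun x hx y hy => h.exp_totalPhase hx hy) h3.differentiableAt
      ((h.contDiffAt_rescaledRoot hx hy).differentiableAt (by simp)) hk v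
    have h4 : fderiv ℝ (fun p : (ℝ × ℝ) × ℝ =>
      p.1.1 * totalPhase (rescaledRoot α) (phaseKernel η) p - 2 * Complex.I * p.1.2) (x, y) = _ :=
      h3.fderiv
    rw [← key, h4]
    simp
    ring
  -- the same equation along the curve; its right-hand side is not zero, so `∂_y b` is not
  have htm : ∀ x ∈ U, ∀ y ∈ 𝕀, ∀ k : ℂ, (∀ v : (ℝ × ℝ) × ℝ,
      v.1.1 * totalPhase (rescaledRoot α) (phaseKernel η) (x, y) +
      x.1 * fderiv ℝ (totalPhase (rescaledRoot α) (phaseKernel η)) (x, y) v -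
      2 * Complex.I * v.1.2 = k * fderiv ℝ (rescaledRoot α) (x, y) v) →
      tangent (rescaledRoot α) (x, y) * (k - x.1 * ∫ s in (-(1 / 2) : ℝ)..(1 / 2),
        phaseKernel η (rescaledRoot α (x, y) - rescaledRoot α (x, s))) = 2 * Real.pi * x.1 := by
    intro x hx y hy k hk
    have h1 := hk (0, 1)
    have h2 := htan x hx y hy
    simp only [tangent] at h2 ⊢
    rw [h2] at h1
    simp only [Prod.fst_zero, Prod.snd_zero, Complex.ofReal_zero, zero_mul, mul_zero, zero_add,
      sub_zero] at h1
    linear_combination -h1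
  have hne : ∀ x ∈ U, ∀ y ∈ 𝕀, tangent (rescaledRoot α) (x, y) ≠ 0 := by
    intro x hx y hy h0
    obtain ⟨k, hk⟩ := hmom x hx y hy
    have h1 := htm x hx y hy k hk
    rw [h0, zero_mul] at h1
    have h2 : (2 * Real.pi * x.1 : ℂ) ≠ 0 := by
      have := (h.density_mem x.1 x.2 hx).1.ne'
      have := Real.pi_ne_zero
      norm_cast
      positivity
    exact h2 h1.symm
  refine ⟨h.isOpen, fun x hx => (h.density_mem x.1 x.2 hx).1, isOpen_phaseDomain,
    fun z hz => neg_mem_phaseDomain hz, differentiableOn_phaseKernel, phaseKernel_neg,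
    fun x hx y hy => h.contDiffAt_rescaledRoot hx hy,
    fun x hx y hy s hs => h.sub_mem_phaseDomain hx hy hs, hne,
    fun x hx y hy => h.rescaledRoot_neg hx hy, fun x hx y hy => (h.totalPhase_fderiv hx hy 0).1,
    hdir, htan, fun x hx => h.integral_totalPhase hx, fun x hx y hy e => ?_⟩
  obtain ⟨k, hk⟩ := hmom x hx y hy
  have h1 := htm x hx y hy k hk
  have h2 := hk (e, 0)
  have h3 := hdir x hx y hy e
  have hs : ∫ s in (-(1 / 2) : ℝ)..(1 / 2),
        phaseKernel η (rescaledRoot α (x, y) - rescaledRoot α (x, s)) *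
          (dirDeriv (rescaledRoot α) e (x, y) - dirDeriv (rescaledRoot α) e (x, s)) =
      (∫ s in (-(1 / 2) : ℝ)..(1 / 2),
        phaseKernel η (rescaledRoot α (x, y) - rescaledRoot α (x, s))) *
          dirDeriv (rescaledRoot α) e (x, y) -
      ∫ s in (-(1 / 2) : ℝ)..(1 / 2),
        phaseKernel η (rescaledRoot α (x, y) - rescaledRoot α (x, s)) *
          dirDeriv (rescaledRoot α) e (x, s) := by
    rw [← intervalIntegral.integral_mul_const, ← intervalIntegral.integral_sub]
    · simp only [mul_sub]
    · exact RootSystem.intervalIntegrable_half ((hK x hx y hy).mul continuousOn_const)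
    · refine RootSystem.intervalIntegrable_half ((hK x hx y hy).mul fun s hs => ?_)
      have h5 : ContDiffAt ℝ 1 (dirDeriv (rescaledRoot α) e) (x, s) :=
        ((h.contDiffAt_rescaledRoot hx hs).fderiv_right (by norm_num)).clm_apply contDiffAt_const
      exact (h5.continuousAt.comp (f := fun s => (x, s)) (by fun_prop)).continuousWithinAt
  rw [hs] at h3
  have ht := hne x hx y hy
  simp only [shift]
  set T := tangent (rescaledRoot α) (x, y)
  simp only [dirDeriv] at h2 h3 ⊢
  rw [h3] at h2
  field_simp
  linear_combination -T * h2 - (fderiv ℝ (rescaledRoot α) (x, y) (e, 0)) * h1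

end IsRootFamily

end Family

/-! ### Second partial derivatives and limits of parameters -/

section SecondPartials

variable {f g : (Fin 3 → ℝ) → ℝ} {X : Fin 3 → ℝ}

theorem fderiv_fderiv_apply {E F : Type*} [NormedAddCommGroup E] [NormedSpace ℝ E]
    [NormedAddCommGroup F] [NormedSpace ℝ F] {f : E → F} {X : E} (hf : ContDiffAt ℝ 2 f X)
    (v w : E) : fderiv ℝ (fun Y => fderiv ℝ f Y v) X w = fderiv ℝ (fderiv ℝ f) X w v := by
  have h1 : DifferentiableAt ℝ (fderiv ℝ f) X :=
    (hf.fderiv_right (m := 1) (by norm_num)).differentiableAt (by simp)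
  rw [fderiv_clm_apply h1 (differentiableAt_const v)]
  simp

theorem partial₂_congr (h : f =ᶠ[𝓝 X] g) (i j : Fin 3) : partial₂ i j f X = partial₂ i j g X := by
  unfold partial₂
  have h1 : (fun y => fderiv ℝ f y (Pi.single j 1)) =ᶠ[𝓝 X]
      fun y => fderiv ℝ g y (Pi.single j 1) := by
    filter_upwards [h.fderiv (𝕜 := ℝ)] with y hy
    rw [hy]
  rw [h1.fderiv_eq]

theorem continuousAt_partial₂ (hf : ContDiffAt ℝ 2 f X) (i j : Fin 3) :
    ContinuousAt (partial₂ i j f) X := by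
  have h1 : ContDiffAt ℝ 1 (fun y => fderiv ℝ f y (Pi.single j 1)) X :=
    (hf.fderiv_right (by norm_num)).clm_apply contDiffAt_const
  exact (h1.continuousAt_fderiv (by simp)).clm_apply continuousAt_const

theorem BilinearIdentities.congr {f' g' : (Fin 3 → ℝ) → ℝ} {Y : Fin 3 → ℝ}
    (h : BilinearIdentities f g X Y) (hf : f' =ᶠ[𝓝 X] f) (hg : g' =ᶠ[𝓝 Y] g) :
    BilinearIdentities f' g' X Y := by
  constructor <;> simp only [partial₂_congr hf, partial₂_congr hg]
  exacts [h.first, h.second, h.third]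

theorem eq_zero_of_mem_closure {T : Type*} [TopologicalSpace T] {φ : T → ℝ} {s : Set T} {p : T}
    (hφ : ContinuousAt φ p) (h0 : ∀ x ∈ s, φ x = 0) (hp : p ∈ closure s) : φ p = 0 := by
  have := mem_closure_iff_nhdsWithin_neBot.1 hp
  refine tendsto_nhds_unique (hφ.mono_left (nhdsWithin_le_nhds (s := s))) ?_
  exact tendsto_const_nhds.congr' (eventually_nhdsWithin_of_forall fun x hx => (h0 x hx).symm)

theorem bilinearIdentities_of_mem_closure {q H u w : ℝ} {s : Set ℝ}
    (hf : ContDiffAt ℝ 2 f ![q, H, u]) (hg : ContDiffAt ℝ 2 g ![q, H, w])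
    (hu : u ∈ closure s) (hw : w ∈ closure s)
    (h : ∀ u ∈ s, ∀ w ∈ s, BilinearIdentities f g ![q, H, u] ![q, H, w]) :
    BilinearIdentities f g ![q, H, u] ![q, H, w] := by
  have hcl : (u, w) ∈ closure (s ×ˢ s) := by rw [closure_prod_eq]; exact ⟨hu, hw⟩
  have c1 : ∀ i j, ContinuousAt (fun p : ℝ × ℝ => partial₂ i j f ![q, H, p.1]) (u, w) :=
    fun i j => ContinuousAt.comp (g := partial₂ i j f) (f := fun p : ℝ × ℝ => ![q, H, p.1])
      (continuousAt_partial₂ hf i j) (by fun_prop)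
  have c2 : ∀ i j, ContinuousAt (fun p : ℝ × ℝ => partial₂ i j g ![q, H, p.2]) (u, w) :=
    fun i j => ContinuousAt.comp (g := partial₂ i j g) (f := fun p : ℝ × ℝ => ![q, H, p.2])
      (continuousAt_partial₂ hg i j) (by fun_prop)
  refine ⟨?_, ?_, ?_⟩
  · have h0 := eq_zero_of_mem_closure (((c1 0 0).mul (c2 1 1)).sub ((c2 0 0).mul (c1 1 1)))
      (fun p hp => (h p.1 hp.1 p.2 hp.2).first) hcl
    exact h0
  · have h0 := eq_zero_of_mem_closure (((((c1 0 0).mul (c2 1 2)).add ((c1 0 1).mul (c2 0 2))).sub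
      ((c1 0 2).mul (c2 0 1))).sub ((c1 1 2).mul (c2 0 0)))
      (fun p hp => (h p.1 hp.1 p.2 hp.2).second) hcl
    exact h0
  · have h0 := eq_zero_of_mem_closure (((((c1 0 1).mul (c2 1 2)).add ((c1 1 1).mul (c2 0 2))).sub
      ((c1 0 2).mul (c2 1 1))).sub ((c1 1 2).mul (c2 0 1)))
      (fun p hp => (h p.1 hp.1 p.2 hp.2).third) hcl
    exact h0

end SecondPartials

/-! ### Branch energies and the free energy -/

section Branches

variable {η : ℝ} {U : Set (ℝ × ℝ)} {α : ℝ → ℝ → ℝ → ℂ} {X : Fin 3 → ℝ}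

/-- The function `e^{ψ_±}`. -/
def psiRatio (η : ℝ) (c : Branch) (z : ℂ) : ℂ := psiNum η c z / psiDen η c z

/-- The part `± H + l_±(u)` of the branch energy. -/
def explicitTerm (η : ℝ) (c : Branch) (X : Fin 3 → ℝ) : ℝ := fieldTerm c (X 1) + lTerm η c (X 2)

theorem analyticAt_psiRatio {c : Branch} {z : ℂ} (hz : psiDen η c z ≠ 0) :
    AnalyticAt ℂ (psiRatio η c) z := by
  have h1 : Differentiable ℂ (psiNum η c) := by cases c <;> unfold psiNum <;> fun_prop
  have h2 : Differentiable ℂ (psiDen η c) := by cases c <;> unfold psiDen <;> fun_prop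
  exact (h1.analyticAt z).div (h2.analyticAt z) hz

/-- The substitution `t = q y`. -/
theorem branchEnergy_eq (η : ℝ) (α : ℝ → ℝ → ℝ → ℂ) (c : Branch) :
    branchEnergy η α c = explicitTerm η c + energy (rescaledRoot α) (psiRatio η c) := by
  funext X
  have h1 := intervalIntegral.smul_integral_comp_mul_left (a := -(1 / 2)) (b := 1 / 2)
    (fun t => rePsi η c (α (X 0) (X 1) t + Complex.I * (X 2 : ℂ))) (X 0)
  rw [show X 0 * -(1 / 2) = -(X 0) / 2 by ring, show X 0 * (1 / 2) = X 0 / 2 by ring] at h1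
  rw [branchEnergy, ← h1, smul_eq_mul, ← intervalIntegral.integral_const_mul]
  rfl

theorem contDiffAt_explicitTerm (c : Branch) (hX : X 2 ∈ Ioo 0 η) :
    ContDiffAt ℝ 2 (explicitTerm η c) X := by
  have h1 : Real.sinh (X 2) ≠ 0 := (Real.sinh_pos_iff.2 hX.1).ne'
  have h2 : Real.sinh (η - X 2) ≠ 0 := (Real.sinh_pos_iff.2 (sub_pos.2 hX.2)).ne'
  cases c <;> unfold explicitTerm fieldTerm lTerm <;> simp only
  · refine ContDiffAt.add (by fun_prop) (ContDiffAt.log ?_ h2)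
    exact ContDiffAt.sinh (by fun_prop)
  · refine ContDiffAt.add (by fun_prop) (ContDiffAt.log ?_ h1)
    exact ContDiffAt.sinh (by fun_prop)

theorem fderiv_explicitTerm_horizontal (c : Branch) (hX : X 2 ∈ Ioo 0 η) (e : ℝ × ℝ) :
    fderiv ℝ (explicitTerm η c) X ![e.1, e.2, 0] = fieldTerm c e.2 := by
  have h1 := ((contDiffAt_explicitTerm c hX).differentiableAt (by simp)).lineDeriv_eq_fderiv
    (v := ![e.1, e.2, 0])
  rw [← h1, lineDeriv]
  have h2 : (fun t : ℝ => explicitTerm η c (X + t • ![e.1, e.2, 0])) =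
      fun t => explicitTerm η c X + t * fieldTerm c e.2 := by
    funext t
    cases c <;> simp [explicitTerm, fieldTerm] <;> ring
  rw [h2]
  simp

theorem fderiv_fderiv_explicitTerm (c : Branch) (hX : X 2 ∈ Ioo 0 η) (e : ℝ × ℝ)
    (w : Fin 3 → ℝ) : fderiv ℝ (fun Y => fderiv ℝ (explicitTerm η c) Y ![e.1, e.2, 0]) X w = 0 := by
  have h1 : (fun Y => fderiv ℝ (explicitTerm η c) Y ![e.1, e.2, 0]) =ᶠ[𝓝 X]
      fun _ => fieldTerm c e.2 := by
    have : ∀ᶠ Y : Fin 3 → ℝ in 𝓝 X, Y 2 ∈ Ioo 0 η :=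
      (continuous_apply (2 : Fin 3)).continuousAt.eventually (isOpen_Ioo.mem_nhds hX)
    filter_upwards [this] with Y hY
    exact fderiv_explicitTerm_horizontal c hY e
  rw [h1.fderiv_eq]
  simp

theorem psiRatio_shiftedRoot (hα : IsRootFamily η U α) {q H u : ℝ} (hqH : (q, H) ∈ U) {c : Branch}
    (hc : PsiRegular η α c q H u) {y : ℝ} (hy : y ∈ 𝕀) :
    AnalyticAt ℂ (psiRatio η c) (shiftedRoot (rescaledRoot α) (![q, H, u], y)) ∧
      psiRatio η c (shiftedRoot (rescaledRoot α) (![q, H, u], y)) ≠ 0 := by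
  obtain ⟨h1, h2⟩ := hc _ (hα.mul_mem hqH hy)
  exact ⟨analyticAt_psiRatio h2, div_ne_zero h1 h2⟩

theorem contDiffAt_branchEnergy (hα : IsRootFamily η U α) {q H u : ℝ} (hqH : (q, H) ∈ U)
    (hu : u ∈ Ioo 0 η) {c : Branch} (hc : PsiRegular η α c q H u) :
    ContDiffAt ℝ 2 (branchEnergy η α c) ![q, H, u] := by
  rw [branchEnergy_eq]
  exact (contDiffAt_explicitTerm c hu).add
    (hα.rootSystem.contDiffAt_energy hqH fun y hy => psiRatio_shiftedRoot hα hqH hc hy)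

theorem fderiv_fderiv_branchEnergy (hα : IsRootFamily η U α) {q H u : ℝ} (hqH : (q, H) ∈ U)
    (hu : u ∈ Ioo 0 η) {c : Branch} (hc : PsiRegular η α c q H u) (e : ℝ × ℝ) :
    fderiv ℝ (fderiv ℝ (branchEnergy η α c)) ![q, H, u] ![e.1, e.2, 0] ![e.1, e.2, 0] =
      (secondVar (rescaledRoot α) e (q, H)
        (fun z => logDeriv (psiRatio η c) (z + Complex.I * u))).re ∧
    fderiv ℝ (fderiv ℝ (branchEnergy η α c)) ![q, H, u] ![e.1, e.2, 0] ![0, 0, 1] =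
      (Complex.I * firstVar (rescaledRoot α) e (q, H)
        (fun z => logDeriv (psiRatio η c) (z + Complex.I * u))).re := by
  have hΨ := fun y hy => psiRatio_shiftedRoot hα hqH hc (y := y) hy
  have h1 := contDiffAt_explicitTerm (X := ![q, H, u]) c hu
  have h2 := hα.rootSystem.contDiffAt_energy (X := ![q, H, u]) hqH hΨ
  have h3 : fderiv ℝ (fderiv ℝ (branchEnergy η α c)) ![q, H, u] =
      fderiv ℝ (fderiv ℝ (explicitTerm η c)) ![q, H, u] +
      fderiv ℝ (fderiv ℝ (energy (rescaledRoot α) (psiRatio η c))) ![q, H, u] := by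
    have hev : fderiv ℝ (branchEnergy η α c) =ᶠ[𝓝 ![q, H, u]] fun Y =>
        fderiv ℝ (explicitTerm η c) Y +
        fderiv ℝ (energy (rescaledRoot α) (psiRatio η c)) Y := by
      filter_upwards [h1.eventually (by simp), h2.eventually (by simp)] with Y hY1 hY2
      rw [branchEnergy_eq]
      exact fderiv_add (hY1.differentiableAt (by simp)) (hY2.differentiableAt (by simp))
    rw [hev.fderiv_eq]
    exact fderiv_add
      ((h1.fderiv_right (m := 1) (by norm_num)).differentiableAt (by simp))
      ((h2.fderiv_right (m := 1) (by norm_num)).differentiableAt (by simp))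
  have h4 : ∀ w, fderiv ℝ (fderiv ℝ (explicitTerm η c)) ![q, H, u] ![e.1, e.2, 0] w = 0 := by
    intro w
    rw [h1.isSymmSndFDerivAt (by simp), ← fderiv_fderiv_apply h1]
    exact fderiv_fderiv_explicitTerm c hu e w
  constructor
  · rw [h3, add_apply, add_apply, h4, zero_add, ← fderiv_fderiv_apply h2]
    exact hα.rootSystem.fderiv_fderiv_energy_horizontal (X := ![q, H, u]) hqH hΨ e
  · rw [h3, add_apply, add_apply, h4, zero_add, ← fderiv_fderiv_apply h2]
    exact hα.rootSystem.fderiv_fderiv_energy_mixed (X := ![q, H, u]) hqH hΨ e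

/-- The Hessian of a branch energy in `(q, H)` is a linear function of its mixed derivatives with
`u`, whose coefficients depend on `(q, H)` only. -/
theorem exists_partial₂_relations (hα : IsRootFamily η U α) {q H : ℝ} (hqH : (q, H) ∈ U) :
    ∃ m₁ m₂ κ : ℝ, ∀ (c : Branch) (u : ℝ), u ∈ Ioo 0 η → PsiRegular η α c q H u →
      partial₂ 0 0 (branchEnergy η α c) ![q, H, u] =
        m₁ * partial₂ 1 2 (branchEnergy η α c) ![q, H, u] +
        m₂ * partial₂ 0 2 (branchEnergy η α c) ![q, H, u] ∧
      partial₂ 1 1 (branchEnergy η α c) ![q, H, u] =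
        -κ ^ 2 * partial₂ 0 0 (branchEnergy η α c) ![q, H, u] ∧
      partial₂ 0 1 (branchEnergy η α c) ![q, H, u] =
        m₂ * partial₂ 1 2 (branchEnergy η α c) ![q, H, u] -
        κ ^ 2 * m₁ * partial₂ 0 2 (branchEnergy η α c) ![q, H, u] := by
  obtain ⟨m₁, m₂, κ, hm⟩ := hα.rootSystem.exists_hessian_relations hqH
  refine ⟨m₁, m₂, κ, fun c u hu hc => ?_⟩
  obtain ⟨r1, r2, r3⟩ := hm (fun z => logDeriv (psiRatio η c) (z + Complex.I * u)) fun y hy =>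
    RootSystem.analyticAt_logDeriv_shift (X := ![q, H, u])
      (fun y hy => psiRatio_shiftedRoot hα hqH hc hy) hy
  have hC := contDiffAt_branchEnergy hα hqH hu hc
  have hs := hC.isSymmSndFDerivAt (by simp)
  have hd := fun e => fderiv_fderiv_branchEnergy hα hqH hu hc e
  have e0 : (Pi.single 0 1 : Fin 3 → ℝ) = ![1, 0, 0] := by ext i; fin_cases i <;> rfl
  have e1 : (Pi.single 1 1 : Fin 3 → ℝ) = ![0, 1, 0] := by ext i; fin_cases i <;> rfl
  have e2 : (Pi.single 2 1 : Fin 3 → ℝ) = ![0, 0, 1] := by ext i; fin_cases i <;> rfl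
  -- the off-diagonal derivative comes from the direction `(1, 1)` by polarization
  have e01 : (![1, 1, 0] : Fin 3 → ℝ) = ![1, 0, 0] + ![0, 1, 0] := by simp
  obtain ⟨a1, a2⟩ := hd (1, 0)
  obtain ⟨b1, b2⟩ := hd (0, 1)
  obtain ⟨c1, -⟩ := hd (1, 1)
  simp only at a1 a2 b1 b2 c1
  rw [e01] at c1
  simp only [map_add, add_apply] at c1
  have hs' := hs ![1, 0, 0] ![0, 1, 0]
  unfold partial₂
  simp only [fderiv_fderiv_apply hC, e0, e1, e2]
  rw [a1, a2, b1, b2]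
  rw [a1, b1, ← hs'] at c1
  refine ⟨r1, by rw [r2, r1], ?_⟩
  linarith

theorem bilinearIdentities_branchEnergy (hα : IsRootFamily η U α) {q H u w : ℝ}
    (hqH : (q, H) ∈ U) (hu : u ∈ Ioo 0 η) (hw : w ∈ Ioo 0 η) {c d : Branch}
    (hc : PsiRegular η α c q H u) (hd : PsiRegular η α d q H w) :
    BilinearIdentities (branchEnergy η α c) (branchEnergy η α d) ![q, H, u] ![q, H, w] := by
  obtain ⟨m₁, m₂, κ, hm⟩ := exists_partial₂_relations hα hqH
  obtain ⟨a1, a2, a3⟩ := hm c u hu hc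
  obtain ⟨b1, b2, b3⟩ := hm d w hw hd
  constructor <;> simp only [a1, a2, a3, b1, b2, b3] <;> ring

theorem freeEnergy_eventuallyEq (hα : IsRootFamily η U α) {q H s : ℝ} (hqH : (q, H) ∈ U)
    (hs : s ∈ genericParameters η α q H) : ∃ c, PsiRegular η α c q H s ∧
      freeEnergy η α =ᶠ[𝓝 ![q, H, s]] branchEnergy η α c := by
  obtain ⟨hs0, hp, hm, hne⟩ := hs
  have cp := (contDiffAt_branchEnergy hα hqH hs0 hp).continuousAt
  have cm := (contDiffAt_branchEnergy hα hqH hs0 hm).continuousAt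
  rcases hne.lt_or_gt with hlt | hlt
  · refine ⟨.minus, hm, ?_⟩
    filter_upwards [cp.eventually_lt cm hlt] with Y hY
    exact max_eq_right hY.le
  · refine ⟨.plus, hp, ?_⟩
    filter_upwards [cm.eventually_lt cp hlt] with Y hY
    exact max_eq_left hY.le

end Branches

end SixVertex

end

theorem theorem4p2 (η : ℝ) (hη : 0 < η) (U : Set (ℝ × ℝ)) (α : ℝ → ℝ → ℝ → ℂ)
    (hα : SixVertex.IsRootFamily η U α) (q H : ℝ) (hqH : (q, H) ∈ U)
    (v : ℝ → ℝ) (x u w : ℝ) (hu : u - v x ∈ Set.Ioo 0 η) (hw : w - v x ∈ Set.Ioo 0 η) :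
    (∀ b c : SixVertex.Branch,
      SixVertex.PsiRegular η α b q H (u - v x) → SixVertex.PsiRegular η α c q H (w - v x) →
        ContDiffAt ℝ 2 (SixVertex.branchEnergy η α b) ![q, H, u - v x] ∧
        ContDiffAt ℝ 2 (SixVertex.branchEnergy η α c) ![q, H, w - v x] ∧
        SixVertex.BilinearIdentities (SixVertex.branchEnergy η α b)
          (SixVertex.branchEnergy η α c) ![q, H, u - v x] ![q, H, w - v x]) ∧
    (∀ s ∈ SixVertex.genericParameters η α q H,
      ContDiffAt ℝ 2 (SixVertex.freeEnergy η α) ![q, H, s]) ∧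
    (u - v x ∈ closure (SixVertex.genericParameters η α q H) →
      w - v x ∈ closure (SixVertex.genericParameters η α q H) →
      ContDiffAt ℝ 2 (SixVertex.freeEnergy η α) ![q, H, u - v x] →
      ContDiffAt ℝ 2 (SixVertex.freeEnergy η α) ![q, H, w - v x] →
        SixVertex.BilinearIdentities (SixVertex.freeEnergy η α) (SixVertex.freeEnergy η α)
          ![q, H, u - v x] ![q, H, w - v x]) := by
  refine ⟨fun b c hb hc => ⟨SixVertex.contDiffAt_branchEnergy hα hqH hu hb,
    SixVertex.contDiffAt_branchEnergy hα hqH hw hc,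
    SixVertex.bilinearIdentities_branchEnergy hα hqH hu hw hb hc⟩, fun s hs => ?_,
    fun huG hwG hFu hFw => ?_⟩
  · obtain ⟨c, hc, hev⟩ := SixVertex.freeEnergy_eventuallyEq hα hqH hs
    exact (SixVertex.contDiffAt_branchEnergy hα hqH hs.1 hc).congr_of_eventuallyEq hev
  · refine SixVertex.bilinearIdentities_of_mem_closure hFu hFw huG hwG fun s hs t ht => ?_
    obtain ⟨c, hc, hcev⟩ := SixVertex.freeEnergy_eventuallyEq hα hqH hs
    obtain ⟨d, hd, hdev⟩ := SixVertex.freeEnergy_eventuallyEq hα hqH ht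
    exact (SixVertex.bilinearIdentities_branchEnergy hα hqH hs.1 ht.1 hc hd).congr hcev hdev
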